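/- There are functions $d:\mathbb{R}\to\mathbb{N}_0$ and $h:\mathbb{R}\to\mathbb{R}$ and an absolute constant $C$ such that $$d(K)\le C\log^6 K\quad\text{and}\quad |h(K)|\le C\log^6 K\,\log\log K\qquad\text{for all } K\ge 3,$$ and such that the following holds for every real $K$. Let $G$ be an abelian group and let $A,S\subset G$ be finite non-empty sets with $|A+S|\le K\min\{|A|,|S|\}$. Then there are an integer $0\le k\le d(K)$, a subgroup $H\le G$, elements $x_1,\dots,x_k\in G$ and positive integers $L_1,\dots,L_k$ such that the symmetric $k$-dimensional coset progression $$M=H+\{l_1x_1+\dots+l_kx_k:\ l_i\in\mathbb{Z},\ |l_i|\le L_i\text{ for all }1\le i\le k\}$$ is proper (that is, the elements $y+l_1x_1+\dots+l_kx_k$ with $y\in H$ and $|l_i|\le L_i$ are pairwise distinct), is contained in $(A-A)+(S-S)$, and has size $$|M|\ge \exp(-h(K))\,|A+S|.$$ -/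

import Mathlib

open scoped Pointwise

/-- The data `(H; x₁, …, x_d; L₁, …, L_d)` of a symmetric `d`-dimensional coset progression
`H + {l₁ x₁ + ⋯ + l_d x_d : |l_i| ≤ L_i}` in an abelian group `G`: a subgroup `H`,
generators `x_i ∈ G` and positive integer lengths `L_i`. -/
structure SymmCosetProgression (G : Type*) [AddCommGroup G] (d : ℕ) where
  subgroup : AddSubgroup G
  gen : Fin d → G
  len : Fin d → ℕ
  len_pos : ∀ i, 0 < len i

namespace SymmCosetProgression

/-- The underlying set `H + {l₁ x₁ + ⋯ + l_d x_d : |l_i| ≤ L_i}`. -/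
def carrier {G : Type*} [AddCommGroup G] {d : ℕ} (M : SymmCosetProgression G d) : Set G :=
  {g | ∃ h ∈ M.subgroup, ∃ l : Fin d → ℤ,
    (∀ i, |l i| ≤ (M.len i : ℤ)) ∧ g = h + ∑ i, l i • M.gen i}

/-- `M` is proper if the representations `h + l₁ x₁ + ⋯ + l_d x_d` with `h ∈ H` and
`|l_i| ≤ L_i` are pairwise distinct. -/
def IsProper {G : Type*} [AddCommGroup G] {d : ℕ} (M : SymmCosetProgression G d) : Prop :=
  ∀ h ∈ M.subgroup, ∀ h' ∈ M.subgroup, ∀ l l' : Fin d → ℤ,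
    (∀ i, |l i| ≤ (M.len i : ℤ)) → (∀ i, |l' i| ≤ (M.len i : ℤ)) →
    h + ∑ i, l i • M.gen i = h' + ∑ i, l' i • M.gen i → h = h' ∧ l = l'

end SymmCosetProgression

/-! Write `L = log K` and `D = (A + S) - (A + S) = (A - A) + (S - S)`. The function `hitFreq` (the
proportion of pairs `(a, s)` with `x + s + a ∈ A + S`) is `1` at `0` and vanishes off `D`, so every
point where it stays close to its value at `0` lies in `D`.

Croot–Sisask sampling (`exists_almost_periods`) gives a set `X` of almost periods with `|X| ≥ |S| /
(2 K ^ n)`, `n ~ L ^ 3`, such that `N` copies of `P = X - X`, `N ~ L`, still sum into `D`. By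
Plünnecke–Ruzsa, multiples of `D` grow slowly, hence so do those of `P`, and `chang_covering` makes
this growth polynomial of order `m ~ L ^ 4`. The Fourier coefficients of `hitFreq` have absolute sum
at most `K`, and averaging over `X` damps those outside the large spectrum of `X`. So a point where
the characters of that spectrum are all within `1 / (8 K)` of `1` lies in `D`
(`mem_sub_of_forall_norm_sub_one_le`).

It remains to find a large coset progression inside this Bohr set. Polynomial growth provides a
multiple `U` of `P` with `P + U` hardly larger than `U`, so the large spectrum of `U` is almost
trivial on `P`. A relative Chang theorem (`exists_spectrum_generators`) generates the large spectrum
of `X`, modulo that of `U`, by about `L ^ 5` characters, which a pigeonhole makes almost trivial on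
a translate `Q` of a large part of `P`. The vectors of arguments of all these characters on `Q` span
a space of small dimension: the covering of `3P` confines the possibly very many coordinates coming
from `U` to few dimensions (`argLift_mem_span_of_covering`). Geometry of numbers then replaces `Q`
by a proper coset progression (`exists_cosetProgression_of_argLift`).

All this takes place in a finite group. A general `G` is reduced to the subgroup generated by `A ∪
S`, and then to a finite quotient that is faithful on `D + D + D`. -/

section

open Finset

/-! ### Sumset estimates and covering. -/

section Combinatorics

variable {G : Type*} [AddCommGroup G] [DecidableEq G]

/-- Iterated sumsets of a set of small doubling, real form of the Plünnecke–Ruzsa inequality. -/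
theorem card_nsmul_le_pow_mul {A B : Finset G} (hA : A.Nonempty) {K : ℝ}
    (h : (#(A + B) : ℝ) ≤ K * #A) (n : ℕ) : (#(n • B) : ℝ) ≤ K ^ n * #A := by
  have hA0 : (0 : ℝ) < #A := by exact_mod_cast hA.card_pos
  have h1 := pluennecke_ruzsa_inequality_nsmul_add hA B n
  have h2 : (#(n • B) : ℝ) ≤ ((#(A + B) : ℝ) / #A) ^ n * #A := by
    have h3 : (((#(n • B) : ℚ≥0)) : ℝ) ≤ (((#(A + B) / #A : ℚ≥0) ^ n * #A : ℚ≥0) : ℝ) := by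
      exact_mod_cast h1
    simpa using h3
  refine h2.trans ?_
  gcongr
  rwa [div_le_iff₀ hA0]

/-- Two Ruzsa triangle inequalities, pivoting on `S` and then on `A`, reduce the mixed sumset to
multiples of `A` alone and of `S` alone. Plünnecke bounds the former against `|S|` and the latter
against `|A|`. -/
theorem card_nsmul_add_le_pow_mul {A S : Finset G} (hA : A.Nonempty) (hS : S.Nonempty) {K : ℝ}
    (hK : 1 ≤ K) (h1 : (#(A + S) : ℝ) ≤ K * #A) (h2 : (#(A + S) : ℝ) ≤ K * #S) (n : ℕ) :
    (#(n • (A + S)) : ℝ) ≤ K ^ (2 * n + 3) * #S := by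
  have hA0 : (0 : ℝ) < #A := by exact_mod_cast hA.card_pos
  have hS0 : (0 : ℝ) < #S := by exact_mod_cast hS.card_pos
  have hK0 : 0 ≤ K := by linarith
  have e1 : (#((n + 1) • A) : ℝ) ≤ K ^ (n + 1) * #S :=
    card_nsmul_le_pow_mul hS (by rwa [add_comm S A]) _
  have e2 : (#((n + 1) • S) : ℝ) ≤ K ^ (n + 1) * #A := card_nsmul_le_pow_mul hA h1 _
  have e3 : (#(A + n • S) : ℝ) ≤ K * (K ^ (n + 1) * #A) := by
    have := ruzsa_triangle_inequality_add_add_add A S (n • S)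
    rw [← succ_nsmul'] at this
    have : (#(A + n • S) : ℝ) * #S ≤ #(A + S) * #((n + 1) • S) := by exact_mod_cast this
    have h3 : (#(A + S) : ℝ) * #((n + 1) • S) ≤ (K * #S) * (K ^ (n + 1) * #A) := by gcongr
    refine le_of_mul_le_mul_right ?_ hS0
    linarith
  have e4 := ruzsa_triangle_inequality_add_add_add (n • A) A (n • S)
  rw [← succ_nsmul, ← nsmul_add] at e4
  have e5 : (#(n • (A + S)) : ℝ) * #A ≤ #((n + 1) • A) * #(A + n • S) := by exact_mod_cast e4
  have e6 : (#((n + 1) • A) : ℝ) * #(A + n • S) ≤ (K ^ (n + 1) * #S) * (K * (K ^ (n + 1) * #A)) := by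
    gcongr
  refine le_of_mul_le_mul_right (e5.trans (e6.trans (le_of_eq ?_))) hA0
  ring

/-- Iterated sumsets of `(A + S) - (A + S)` when `A + S` is small. -/
theorem card_nsmul_sub_le_pow_mul {A S : Finset G} (hA : A.Nonempty) (hS : S.Nonempty) {K : ℝ}
    (hK : 1 ≤ K) (h1 : (#(A + S) : ℝ) ≤ K * #A) (h2 : (#(A + S) : ℝ) ≤ K * #S) {n : ℕ}
    (hn : n ≠ 0) : (#(n • ((A + S) - (A + S))) : ℝ) ≤ K ^ (15 * n) * #S := by
  have hA0 : (0 : ℝ) < #A := by exact_mod_cast hA.card_pos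
  have hS0 : (0 : ℝ) < #S := by exact_mod_cast hS.card_pos
  have hK0 : 0 < K := by linarith
  obtain ⟨s, hs⟩ := hS
  have e1 : (#(n • (A + S) + A) : ℝ) ≤ K ^ (2 * (n + 1) + 3) * #S := by
    refine le_trans ?_ (card_nsmul_add_le_pow_mul hA ⟨s, hs⟩ hK h1 h2 (n + 1))
    have : (n • (A + S) + A) + {s} ⊆ (n + 1) • (A + S) := by
      rw [succ_nsmul, add_assoc]
      exact add_subset_add_left (add_subset_add_left (by simpa using hs))
    have := card_le_card this
    rw [add_singleton, card_vadd_finset] at this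
    exact_mod_cast this
  have e2 := ruzsa_triangle_inequality_sub_add_add (n • (A + S)) A (n • (A + S))
  have e3 : (#(n • (A + S) - n • (A + S)) : ℝ) * #A ≤
      #(n • (A + S) + A) * #(n • (A + S) + A) := by exact_mod_cast e2
  have e4 : (#S : ℝ) ≤ K * #A := le_trans (by
    exact_mod_cast card_le_card_add_left hA) h1
  rw [nsmul_sub]
  refine le_of_mul_le_mul_right (e3.trans ?_) hA0
  calc (#(n • (A + S) + A) : ℝ) * #(n • (A + S) + A)
      ≤ (K ^ (2 * (n + 1) + 3) * #S) * (K ^ (2 * (n + 1) + 3) * (K * #A)) := by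
        refine mul_le_mul e1 (e1.trans ?_) (by positivity) (by positivity)
        gcongr
    _ = K ^ (4 * n + 11) * (#S * #A) := by ring
    -- The exponent `4 * n + 11` is rounded up to a multiple of `n`, which needs `n ≠ 0`.
    _ ≤ K ^ (15 * n) * (#S * #A) := by
        gcongr
        omega
    _ = _ := by ring

/-- The linear combinations of a finite family with integer coefficients of size at most `j`. -/
noncomputable def boxSpan {r : ℕ} (τ : Fin r → G) (j : ℕ) : Finset G :=
  (Fintype.piFinset fun _ : Fin r => Icc (-(j : ℤ)) j).image fun c => ∑ i, c i • τ i

theorem mem_boxSpan {r : ℕ} {τ : Fin r → G} {j : ℕ} {x : G} :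
    x ∈ boxSpan τ j ↔ ∃ c : Fin r → ℤ, (∀ i, |c i| ≤ j) ∧ ∑ i, c i • τ i = x := by
  simp [boxSpan, abs_le]

theorem card_boxSpan_le {r : ℕ} (τ : Fin r → G) (j : ℕ) : #(boxSpan τ j) ≤ (2 * j + 1) ^ r := by
  refine card_image_le.trans ?_
  rw [Fintype.card_piFinset]
  simp only [Int.card_Icc, prod_const, card_univ, Fintype.card_fin]
  apply le_of_eq
  congr 1
  omega

theorem add_mem_boxSpan {r : ℕ} {τ : Fin r → G} {j k : ℕ} {x y : G}
    (hx : x ∈ boxSpan τ j) (hy : y ∈ boxSpan τ k) : x + y ∈ boxSpan τ (j + k) := by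
  rw [mem_boxSpan] at *
  obtain ⟨c, hc, rfl⟩ := hx
  obtain ⟨d, hd, rfl⟩ := hy
  refine ⟨c + d, fun i => ?_, ?_⟩
  · push_cast
    exact (abs_add_le _ _).trans (add_le_add (hc i) (hd i))
  · simp [add_smul, sum_add_distrib]

theorem mem_boxSpan_cons {r : ℕ} {τ : Fin r → G} {x y t : G} {a : ℤ} (ha : |a| ≤ 1)
    (hx : y ∈ boxSpan τ 1) (h : x = a • t + y) :
    x ∈ boxSpan (Fin.cons t τ : Fin (r + 1) → G) 1 := by
  rw [mem_boxSpan] at *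
  obtain ⟨c, hc, rfl⟩ := hx
  refine ⟨Fin.cons a c, fun i => ?_, ?_⟩
  · refine Fin.cases ?_ (fun i => ?_) i
    · simpa using ha
    · simpa using hc i
  · simp [Fin.sum_univ_succ, h]

theorem nsmul_subset_nsmul_of_le {P : Finset G} (h0 : 0 ∈ P) {a b : ℕ} (h : a ≤ b) :
    a • P ⊆ b • P := nsmul_subset_nsmul_right h0 h

/-- **Chang's covering lemma** for a symmetric set of slow growth. -/
theorem chang_covering {P : Finset G} (h0 : 0 ∈ P) (hsym : -P = P) {m : ℕ}
    (hP : #((3 * m + 1) • P) < 2 ^ m * #P) :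
    ∃ r ≤ m, ∃ τ : Fin r → G, (∀ i, τ i ∈ 3 • P) ∧ 3 • P ⊆ 2 • P + boxSpan τ 1 := by
  -- Greedy doubling. If `3P` is not inside `E - E`, some `x ∈ 3P` makes `E` and `x + E` disjoint,
  -- so their union doubles `E` while staying in `(3r + 4)P`; `x` becomes a new direction. After `m`
  -- doublings `E` would exceed the bound on `(3m + 1)P`.
  have key : ∀ r : ℕ, (∃ r' ≤ r, ∃ τ : Fin r' → G, (∀ i, τ i ∈ 3 • P) ∧
      3 • P ⊆ 2 • P + boxSpan τ 1) ∨
      ∃ τ : Fin r → G, (∀ i, τ i ∈ 3 • P) ∧ ∃ E : Finset G, E ⊆ (3 * r + 1) • P ∧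
        #E = 2 ^ r * #P ∧ E - E ⊆ 2 • P + boxSpan τ 1 := by
    intro r
    induction r with
    | zero =>
      right
      refine ⟨fun i => i.elim0, fun i => i.elim0, P, by simp, by simp, ?_⟩
      intro x hx
      have h1 : x ∈ 2 • P := by
        rw [two_nsmul]
        rwa [sub_eq_add_neg, hsym] at hx
      exact mem_add.2 ⟨x, h1, 0, mem_boxSpan.2 ⟨0, by simp, by simp⟩, by simp⟩
    | succ r ih =>
      obtain ⟨r', hr', h⟩ | ⟨τ, hτ, E, hE, hcard, hdiff⟩ := ih
      · exact Or.inl ⟨r', by omega, h⟩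
      by_cases hcov : 3 • P ⊆ E - E
      · exact Or.inl ⟨r, by omega, τ, hτ, hcov.trans hdiff⟩
      right
      obtain ⟨x, hx, hxE⟩ := not_subset.1 hcov
      refine ⟨Fin.cons x τ, fun i => ?_, E ∪ (x +ᵥ E), ?_, ?_, ?_⟩
      · refine Fin.cases ?_ (fun i => ?_) i
        · simpa using hx
        · simpa using hτ i
      · refine union_subset (hE.trans (nsmul_subset_nsmul_of_le h0 (by omega))) ?_
        intro y hy
        obtain ⟨e, he, rfl⟩ := mem_vadd_finset.1 hy
        have : (3 * (r + 1) + 1) • P = 3 • P + (3 * r + 1) • P := by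
          rw [← add_nsmul]; congr 1; omega
        rw [this]
        exact add_mem_add hx (hE he)
      · rw [card_union_of_disjoint, card_vadd_finset, hcard]
        · ring
        · rw [disjoint_left]
          intro y hy hy'
          obtain ⟨e, he, rfl⟩ := mem_vadd_finset.1 hy'
          exact hxE (mem_sub.2 ⟨_, hy, e, he, by simp⟩)
      · intro y hy
        obtain ⟨u, hu, v, hv, rfl⟩ := mem_sub.1 hy
        have hrep : ∀ u ∈ E ∪ (x +ᵥ E), ∃ e ∈ E, ∃ a : ℤ, 0 ≤ a ∧ a ≤ 1 ∧ u = a • x + e := by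
          intro u hu
          rcases mem_union.1 hu with h | h
          · exact ⟨u, h, 0, by simp⟩
          · obtain ⟨e, he, rfl⟩ := mem_vadd_finset.1 h
            exact ⟨e, he, 1, by simp⟩
        obtain ⟨e, he, a, ha0, ha1, rfl⟩ := hrep u hu
        obtain ⟨e', he', a', ha0', ha1', rfl⟩ := hrep v hv
        obtain ⟨p, hp, q, hq, hpq⟩ := mem_add.1 (hdiff (sub_mem_sub he he'))
        refine mem_add.2 ⟨p, hp, (a - a') • x + q,
          mem_boxSpan_cons (abs_le.2 ⟨by omega, by omega⟩) hq rfl, ?_⟩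
        have : e = p + q + e' := by rw [hpq]; simp
        rw [this, sub_smul]
        abel
  rcases key m with ⟨r, hr, h⟩ | ⟨τ, -, E, hE, hcard, -⟩
  · exact ⟨r, hr, h⟩
  · exact absurd (card_le_card hE) (by omega)

/-- Polynomial growth from a covering relation. -/
theorem card_nsmul_le_of_covering {P : Finset G} {r : ℕ} {τ : Fin r → G}
    (hcov : 3 • P ⊆ 2 • P + boxSpan τ 1) (j : ℕ) :
    #((j + 2) • P) ≤ #(2 • P) * (2 * j + 1) ^ r := by
  -- Each use of the covering trades one summand `P` for one unit of box radius.
  have key : (j + 2) • P ⊆ 2 • P + boxSpan τ j := by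
    induction j with
    | zero =>
      intro x hx
      exact mem_add.2 ⟨x, by simpa using hx, 0, mem_boxSpan.2 ⟨0, by simp, by simp⟩, by simp⟩
    | succ j ih =>
      have e : (j + 1 + 2) • P = P + (j + 2) • P := by
        rw [← succ_nsmul']
      rw [e]
      refine (add_subset_add_left ih).trans ?_
      rw [← add_assoc, ← succ_nsmul']
      refine (add_subset_add_right hcov).trans ?_
      rw [add_assoc]
      refine add_subset_add_left ?_
      intro x hx
      obtain ⟨a, ha, b, hb, rfl⟩ := mem_add.1 hx
      rw [add_comm j]
      exact add_mem_boxSpan ha hb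
  exact (card_le_card key).trans (card_add_le.trans (Nat.mul_le_mul_left _ (card_boxSpan_le τ j)))

/-- Some iterated sumset of a slowly growing set is nearly invariant. -/
theorem exists_card_succ_nsmul_le {P : Finset G} {δ : ℝ} (hδ : 0 ≤ δ) {J : ℕ}
    (hJ : (#((J + 1) • P) : ℝ) < (1 + δ) ^ J * #P) :
    ∃ j < J, (#((j + 2) • P) : ℝ) ≤ (1 + δ) * #((j + 1) • P) := by
  by_contra! hcon
  have : ∀ j ≤ J, (1 + δ) ^ j * #P ≤ (#((j + 1) • P) : ℝ) := by
    intro j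
    induction j with
    | zero => intro _; simp
    | succ j ih =>
      intro hj
      calc (1 + δ) ^ (j + 1) * #P = (1 + δ) * ((1 + δ) ^ j * #P) := by ring
        _ ≤ (1 + δ) * #((j + 1) • P) := by gcongr; exact ih (by omega)
        _ ≤ _ := (hcon j (by omega)).le
  linarith [this J le_rfl]

end Combinatorics

/-! ### Croot–Sisask almost periodicity by exponential moments. -/

section AlmostPeriods

/-- Exponential moments of sums of independent centred samples. -/
theorem sum_exp_sample_le {ι : Type*} {A : Finset ι} {b : ι → ℝ} (hb : ∀ a ∈ A, |b a| ≤ 1)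
    (hmean : ∑ a ∈ A, b a = 0) (n : ℕ) (lam : ℝ) :
    ∑ a ∈ Fintype.piFinset (fun _ : Fin n => A), Real.exp (lam * ∑ i, b (a i)) ≤
      (#A : ℝ) ^ n * Real.exp (n * (lam ^ 2 / 2)) := by
  have h1 : ∀ a : Fin n → ι, Real.exp (lam * ∑ i, b (a i)) = ∏ i, Real.exp (lam * b (a i)) := by
    intro a
    rw [mul_sum, Real.exp_sum]
  simp_rw [h1]
  rw [sum_prod_piFinset A (fun (_ : Fin n) a => Real.exp (lam * b a))]
  simp only [prod_const, card_univ, Fintype.card_fin]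
  rw [Real.exp_nat_mul, ← mul_pow]
  refine pow_le_pow_left₀ (sum_nonneg fun _ _ => (Real.exp_pos _).le) ?_ n
  -- The convexity bound on `[-1, 1]`; its linear term disappears because `b` has mean zero.
  calc ∑ a ∈ A, Real.exp (lam * b a) ≤ ∑ a ∈ A, (Real.cosh lam + b a * Real.sinh lam) := by
        refine sum_le_sum fun a ha => ?_
        rw [mul_comm]
        exact Real.exp_mul_le_cosh_add_mul_sinh (hb a ha) lam
    _ = #A * Real.cosh lam := by
        rw [sum_add_distrib, ← sum_mul, hmean]
        simp
    _ ≤ _ := by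
        gcongr
        exact Real.cosh_le_exp_half_sq lam

/-- Jensen's inequality for the exponential function, in a form bounding a sum. -/
theorem mul_sum_le_of_sum_exp_le {ι : Type*} {Z : Finset ι} {e : ι → ℝ} {μ c : ℝ}
    (h : ∑ y ∈ Z, Real.exp (μ * e y) ≤ Real.exp c * #Z) : μ * ∑ y ∈ Z, e y ≤ c * #Z := by
  have h1 : ∑ y ∈ Z, (μ * e y - c + 1) ≤ ∑ y ∈ Z, Real.exp (μ * e y) * Real.exp (-c) := by
    refine sum_le_sum fun y _ => ?_
    rw [← Real.exp_add]
    exact Real.add_one_le_exp _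
  rw [← sum_mul] at h1
  have h2 : (∑ y ∈ Z, Real.exp (μ * e y)) * Real.exp (-c) ≤ #Z := by
    calc _ ≤ Real.exp c * #Z * Real.exp (-c) := by gcongr
      _ = (Real.exp c * Real.exp (-c)) * #Z := by ring
      _ = #Z := by rw [← Real.exp_add]; simp
  rw [sum_add_distrib, sum_sub_distrib, ← mul_sum] at h1
  simp only [sum_const, nsmul_eq_mul] at h1
  linarith

variable {G : Type*} [AddCommGroup G] [DecidableEq G]

/-- The proportion of pairs `(a, s) ∈ A × S` with `x + s + a ∈ E`. -/
noncomputable def hitFreq (A S E : Finset G) (x : G) : ℝ :=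
  (∑ s ∈ S, (∑ a ∈ A, if x + s + a ∈ E then (1 : ℝ) else 0) / #A) / #S

theorem hitFreq_zero {A S : Finset G} (hA : A.Nonempty) (hS : S.Nonempty) :
    hitFreq A S (A + S) 0 = 1 := by
  have hA0 : (#A : ℝ) ≠ 0 := by exact_mod_cast hA.card_pos.ne'
  have hS0 : (#S : ℝ) ≠ 0 := by exact_mod_cast hS.card_pos.ne'
  have : ∀ s ∈ S, (∑ a ∈ A, if 0 + s + a ∈ A + S then (1 : ℝ) else 0) / #A = 1 := by
    intro s hs
    rw [sum_congr rfl (g := fun _ => (1 : ℝ))]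
    · simp [hA0]
    · intro a ha
      rw [if_pos]
      rw [zero_add, add_comm s a]
      exact add_mem_add ha hs
  rw [hitFreq, sum_congr rfl this]
  simp [hS0]

/-- The membership criterion behind every inclusion in `(A + S) - (A + S)`: together with
`hitFreq_zero`, it suffices that the frequency has dropped by less than `1`. -/
theorem mem_of_hitFreq_ne_zero {A S : Finset G} {x : G} (h : hitFreq A S (A + S) x ≠ 0) :
    x ∈ (A + S) - (A + S) := by
  by_contra hx
  apply h
  have : ∀ s ∈ S, (∑ a ∈ A, if x + s + a ∈ A + S then (1 : ℝ) else 0) / #A = 0 := by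
    intro s hs
    rw [sum_eq_zero, zero_div]
    intro a ha
    rw [if_neg]
    intro hmem
    exact hx (mem_sub.2 ⟨_, hmem, a + s, add_mem_add ha hs, by abel⟩)
  rw [hitFreq, sum_congr rfl this]
  simp

/-- **Croot–Sisask almost periodicity**, uniform version for `hitFreq`. -/
theorem exists_almost_periods {A S E Y : Finset G} (hA : A.Nonempty) (hS : S.Nonempty) {K R μ : ℝ}
    (hAS : (#(A + S) : ℝ) ≤ K * #A) (hY : ∀ y, ∀ a ∈ A, y + a ∈ E → y ∈ Y)
    (hR : (#Y : ℝ) ≤ R * #S) (hμ : 0 < μ) {n : ℕ} (hn : n ≠ 0) :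
    ∃ X : Finset G, 0 ∈ X ∧ (#S : ℝ) ≤ 2 * K ^ n * #X ∧ ∀ t ∈ X, ∀ t' ∈ X, ∀ z,
      |hitFreq A S E (z + t) - hitFreq A S E (z + t')| ≤
        2 * ((Real.log (1 + 4 * R) + μ ^ 2 / (2 * n)) / μ) := by
  classical
  have hA0 : (0 : ℝ) < #A := by exact_mod_cast hA.card_pos
  have hS0 : (0 : ℝ) < #S := by exact_mod_cast hS.card_pos
  have hn0 : (0 : ℝ) < n := by exact_mod_cast Nat.pos_of_ne_zero hn
  have hR0 : 0 ≤ R := by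
    by_contra! hneg
    have : R * #S < 0 := mul_neg_of_neg_of_pos hneg hS0
    have h3 : (0 : ℝ) ≤ #Y := by positivity
    linarith
  set q : G → ℝ := fun y => (∑ a ∈ A, if y + a ∈ E then (1 : ℝ) else 0) / #A with hq
  set ind : G → ℝ := fun y => if y ∈ E then (1 : ℝ) else 0 with hind
  have hq0 : ∀ y, 0 ≤ q y := fun y =>
    div_nonneg (sum_nonneg fun a _ => by split_ifs <;> norm_num) hA0.le
  have hq1 : ∀ y, q y ≤ 1 := by
    intro y
    rw [hq]
    simp only
    rw [div_le_one hA0]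
    calc (∑ a ∈ A, if y + a ∈ E then (1 : ℝ) else 0) ≤ ∑ a ∈ A, (1 : ℝ) :=
          sum_le_sum fun a _ => by split_ifs <;> norm_num
      _ = #A := by simp
  -- A tuple `a` is a sample of size `n` from `A`, and `err a y` is the error of its empirical
  -- frequency as an estimate of `q y`.
  set err : (Fin n → G) → G → ℝ := fun a y => (∑ i, (ind (y + a i) - q y)) / n with herr
  have herr' : ∀ a y, err a y = (∑ i, ind (y + a i)) / n - q y := by
    intro a y
    simp only [herr, sum_sub_distrib, sum_const, card_univ, Fintype.card_fin, nsmul_eq_mul]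
    field_simp
  set V : Finset (Fin n → G) := Fintype.piFinset (fun _ : Fin n => A) with hV
  have hVcard : (#V : ℝ) = (#A : ℝ) ^ n := by
    rw [hV, Fintype.card_piFinset]
    simp
  set c0 : ℝ := μ ^ 2 / (2 * n) with hc0
  -- exponential moments at a point
  have hmom : ∀ (l : ℝ), l ^ 2 = μ ^ 2 → ∀ y,
      ∑ a ∈ V, Real.exp (l * err a y) ≤ (#A : ℝ) ^ n * Real.exp c0 := by
    intro l hl y
    have hb : ∀ a ∈ A, |ind (y + a) - q y| ≤ 1 := by
      intro a _
      rw [abs_le]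
      have h1 := hq0 y
      have h2 := hq1 y
      have h3 : 0 ≤ ind (y + a) := by simp only [hind]; split_ifs <;> norm_num
      have h4 : ind (y + a) ≤ 1 := by simp only [hind]; split_ifs <;> norm_num
      constructor <;> linarith
    have hm : ∑ a ∈ A, (ind (y + a) - q y) = 0 := by
      rw [sum_sub_distrib]
      simp only [hind, hq, sum_const, nsmul_eq_mul]
      field_simp
      ring
    have := sum_exp_sample_le hb hm n (l / n)
    have e1 : (n : ℝ) * ((l / n) ^ 2 / 2) = c0 := by
      rw [hc0, div_pow, hl]
      field_simp
    rw [e1] at this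
    refine le_trans (le_of_eq (sum_congr rfl fun a _ => ?_)) this
    simp only [herr]
    congr 1
    ring
  have hmom2 : ∑ a ∈ V, ∑ y ∈ Y, Real.exp (μ * |err a y|) ≤
      2 * Real.exp c0 * #Y * (#A : ℝ) ^ n := by
    rw [sum_comm]
    calc ∑ y ∈ Y, ∑ a ∈ V, Real.exp (μ * |err a y|)
        ≤ ∑ y ∈ Y, 2 * ((#A : ℝ) ^ n * Real.exp c0) := by
          refine sum_le_sum fun y _ => ?_
          calc ∑ a ∈ V, Real.exp (μ * |err a y|)
              ≤ ∑ a ∈ V, (Real.exp (μ * err a y) + Real.exp (-μ * err a y)) := by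
                refine sum_le_sum fun a _ => ?_
                rcases abs_choice (err a y) with h | h <;> rw [h]
                · linarith [Real.exp_pos (-μ * err a y)]
                · have : μ * -err a y = -μ * err a y := by ring
                  rw [this]
                  linarith [Real.exp_pos (μ * err a y)]
            _ ≤ _ := by
                rw [sum_add_distrib]
                linarith [hmom μ rfl y, hmom (-μ) (by ring) y]
      _ = _ := by
          simp only [sum_const, nsmul_eq_mul]
          ring
  -- The threshold is twice the average in `hmom2`, so Markov's inequality keeps at least half of
  -- the samples.
  set Good : Finset (Fin n → G) :=
    V.filter fun a => ∑ y ∈ Y, Real.exp (μ * |err a y|) ≤ 4 * Real.exp c0 * #Y with hGood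
  have hGoodcard : (#A : ℝ) ^ n / 2 ≤ #Good := by
    rcases Y.eq_empty_or_nonempty with hYe | hYne
    · have : Good = V := by
        rw [hGood, filter_eq_self]
        intro a _
        simp [hYe]
      rw [this, hVcard]
      have : (0 : ℝ) < (#A : ℝ) ^ n := by positivity
      linarith
    have hY0 : (0 : ℝ) < #Y := by exact_mod_cast hYne.card_pos
    have hbad : (#(V \ Good) : ℝ) * (4 * Real.exp c0 * #Y) ≤
        2 * Real.exp c0 * #Y * (#A : ℝ) ^ n := by
      refine le_trans ?_ hmom2
      calc (#(V \ Good) : ℝ) * (4 * Real.exp c0 * #Y)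
          = ∑ a ∈ V \ Good, 4 * Real.exp c0 * #Y := by simp
        _ ≤ ∑ a ∈ V \ Good, ∑ y ∈ Y, Real.exp (μ * |err a y|) := by
            refine sum_le_sum fun a ha => ?_
            rw [mem_sdiff] at ha
            by_contra! hcon
            exact ha.2 (mem_filter.2 ⟨ha.1, hcon.le⟩)
        _ ≤ _ := sum_le_sum_of_subset_of_nonneg sdiff_subset
            fun a _ _ => sum_nonneg fun y _ => (Real.exp_pos _).le
    have hbad2 : (#(V \ Good) : ℝ) ≤ (#A : ℝ) ^ n / 2 := by
      have h4 : 0 < 4 * Real.exp c0 * #Y := by positivity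
      refine le_of_mul_le_mul_right (hbad.trans (le_of_eq ?_)) h4
      ring
    have hsum : (#(V \ Good) : ℝ) + #Good = #V := by
      exact_mod_cast card_sdiff_add_card_eq_card (filter_subset _ V)
    linarith
  -- pigeonhole
  obtain ⟨u, X₀, hX₀, hcard⟩ : ∃ u : Fin n → G, ∃ X₀ : Finset G,
      (∀ t ∈ X₀, (fun i => u i - t) ∈ Good) ∧ (#S : ℝ) ≤ 2 * K ^ n * #X₀ := by
    set Z : Finset (Fin n → G) := Fintype.piFinset (fun _ : Fin n => A + S) with hZ
    have hZcard : (#Z : ℝ) = (#(A + S) : ℝ) ^ n := by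
      rw [hZ, Fintype.card_piFinset]
      simp
    have hZ0 : (0 : ℝ) < #Z := by
      rw [hZcard]
      have : (0 : ℝ) < #(A + S) := by exact_mod_cast (hA.add hS).card_pos
      positivity
    have hmaps : ∀ p ∈ Good ×ˢ S, (fun i => p.1 i + p.2) ∈ Z := by
      intro p hp
      rw [mem_product] at hp
      have h1 := (mem_filter.1 hp.1).1
      rw [hV, Fintype.mem_piFinset] at h1
      exact Fintype.mem_piFinset.2 fun i => add_mem_add (h1 i) hp.2
    obtain ⟨u, -, hu⟩ := exists_le_card_fiber_of_nsmul_le_card_of_maps_to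
      (b := (#Good * #S : ℝ) / #Z) hmaps (card_pos.1 (by exact_mod_cast hZ0)) (by
        rw [nsmul_eq_mul, card_product]
        push_cast
        rw [mul_div_cancel₀ _ hZ0.ne'])
    refine ⟨u, S.filter fun t => (fun i => u i - t) ∈ Good, fun t ht => (mem_filter.1 ht).2, ?_⟩
    set X₀ := S.filter fun t => (fun i => u i - t) ∈ Good
    have hle : #((Good ×ˢ S).filter fun p => (fun i => p.1 i + p.2) = u) ≤ #X₀ := by
      refine card_le_card_of_injOn Prod.snd ?_ ?_
      · intro p hp
        simp only [coe_filter, Set.mem_ofPred_eq, mem_product] at hp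
        simp only [X₀, coe_filter, Set.mem_ofPred_eq]
        refine ⟨hp.1.2, ?_⟩
        convert hp.1.1 using 1
        funext i
        rw [← hp.2]
        simp
      · intro p hp p' hp' hpp
        simp only [coe_filter, Set.mem_ofPred_eq] at hp hp'
        refine Prod.ext ?_ hpp
        funext i
        have := congrFun (hp.2.trans hp'.2.symm) i
        simp only [hpp] at this
        exact add_right_cancel this
    have h5 : (#Good * #S : ℝ) / #Z ≤ #X₀ := hu.trans (by exact_mod_cast hle)
    rw [div_le_iff₀ hZ0, hZcard] at h5
    have h6 : (#(A + S) : ℝ) ^ n ≤ (K * #A) ^ n := by gcongr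
    have h7 : (#A : ℝ) ^ n / 2 * #S ≤ #X₀ * (K * #A) ^ n :=
      calc _ ≤ (#Good : ℝ) * #S := by gcongr
        _ ≤ _ := h5
        _ ≤ _ := by gcongr
    have h8 : (0 : ℝ) < (#A : ℝ) ^ n := by positivity
    refine le_of_mul_le_mul_left ?_ h8
    rw [mul_pow] at h7
    linarith
  have hX₀ne : X₀.Nonempty := by
    rw [nonempty_iff_ne_empty]
    rintro rfl
    simp at hcard
    exact hS.ne_empty hcard
  -- The approximant does not involve `t`: sampling at `z + t + s` with the good tuple `u - t` reads
  -- the points `z + s + u i`. So all shifts by `X₀` are close to one function. Jensen's inequality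
  -- for `exp` over `s ∈ S` makes the bound uniform in `z`.
  have hmain : ∀ t ∈ X₀, ∀ z, |(∑ s ∈ S, (∑ i, ind (z + s + u i)) / n) / #S -
      hitFreq A S E (z + t)| ≤ (Real.log (1 + 4 * R) + c0) / μ := by
    intro t ht z
    set a : Fin n → G := fun i => u i - t with ha
    have haG : a ∈ Good := hX₀ t ht
    obtain ⟨haV, hasum⟩ := mem_filter.1 haG
    rw [hV, Fintype.mem_piFinset] at haV
    have hoff : ∀ y, y ∉ Y → err a y = 0 := by
      intro y hy
      have h1 : ∀ b ∈ A, ¬ (y + b ∈ E) := fun b hb hmem => hy (hY y b hb hmem)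
      rw [herr']
      have h2 : q y = 0 := by
        simp only [hq]
        rw [sum_eq_zero, zero_div]
        intro b hb
        rw [if_neg (h1 b hb)]
      rw [h2, sum_eq_zero]
      · simp
      · intro i _
        simp only [hind]
        rw [if_neg (h1 _ (haV i))]
    -- Off `Y` the error vanishes and the term is `1`; the other terms embed injectively into the
    -- sum over `Y`. This gives the factor `1 + 4 * R`.
    have hsumexp : ∑ s ∈ S, Real.exp (μ * |err a (z + t + s)|) ≤
        Real.exp (Real.log (1 + 4 * R) + c0) * #S := by
      calc ∑ s ∈ S, Real.exp (μ * |err a (z + t + s)|)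
          ≤ ∑ s ∈ S, (1 + if z + t + s ∈ Y then Real.exp (μ * |err a (z + t + s)|) else 0) := by
            refine sum_le_sum fun s _ => ?_
            split_ifs with h
            · linarith
            · rw [hoff _ h]; simp
        _ = #S + ∑ s ∈ S with z + t + s ∈ Y, Real.exp (μ * |err a (z + t + s)|) := by
            rw [sum_add_distrib, sum_filter]
            simp
        _ ≤ #S + ∑ y ∈ Y, Real.exp (μ * |err a y|) := by
            gcongr
            rw [← sum_image (f := fun y => Real.exp (μ * |err a y|)) (g := fun s => z + t + s)]
            · refine sum_le_sum_of_subset_of_nonneg ?_ fun _ _ _ => (Real.exp_pos _).le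
              intro y hy
              obtain ⟨s, hs, rfl⟩ := mem_image.1 hy
              exact (mem_filter.1 hs).2
            · exact fun s _ s' _ h => add_left_cancel h
        _ ≤ #S + 4 * Real.exp c0 * (R * #S) := by
            gcongr
            exact hasum.trans (by gcongr)
        _ ≤ Real.exp c0 * #S + 4 * Real.exp c0 * (R * #S) := by
            gcongr
            have : 1 ≤ Real.exp c0 := Real.one_le_exp (by positivity)
            nlinarith
        _ = _ := by
            rw [Real.exp_add, Real.exp_log (by positivity)]
            ring
    have h9 := mul_sum_le_of_sum_exp_le hsumexp
    have h10 : (∑ s ∈ S, (∑ i, ind (z + s + u i)) / n) / #S - hitFreq A S E (z + t) =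
        (∑ s ∈ S, err a (z + t + s)) / #S := by
      rw [hitFreq, ← sub_div, ← sum_sub_distrib]
      congr 1
      refine sum_congr rfl fun s _ => ?_
      rw [herr']
      congr 2
      refine sum_congr rfl fun i _ => ?_
      congr 1
      simp only [ha]
      abel
    rw [h10, abs_div, abs_of_pos hS0, div_le_div_iff₀ hS0 hμ]
    calc |∑ s ∈ S, err a (z + t + s)| * μ ≤ (∑ s ∈ S, |err a (z + t + s)|) * μ := by
          gcongr
          exact abs_sum_le_sum_abs _ _
      _ ≤ _ := by linarith
  obtain ⟨t₀, ht₀⟩ := hX₀ne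
  refine ⟨X₀.image fun t => t - t₀, mem_image.2 ⟨t₀, ht₀, sub_self _⟩, ?_, ?_⟩
  · rwa [card_image_of_injective _ (sub_left_injective)]
  · intro t₁ ht₁ t₂ ht₂ z
    obtain ⟨t, ht, rfl⟩ := mem_image.1 ht₁
    obtain ⟨t', ht', rfl⟩ := mem_image.1 ht₂
    have h1 := hmain t ht (z - t₀)
    have h2 := hmain t' ht' (z - t₀)
    have e1 : z + (t - t₀) = z - t₀ + t := by abel
    have e2 : z + (t' - t₀) = z - t₀ + t' := by abel
    rw [e1, e2]
    rw [abs_le] at *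
    constructor <;> linarith [h1.1, h1.2, h2.1, h2.2]

end AlmostPeriods

/-! ### Fourier analysis: from almost periods to Bohr sets. -/

section Fourier

variable {G : Type*} [AddCommGroup G]

/-- The mean of a character over a finite set. -/
noncomputable def charMean (B : Finset G) (γ : AddChar G ℂ) : ℂ := (∑ x ∈ B, γ x) / #B

variable [Fintype G]

theorem AddChar.conj_eq_apply_neg (γ : AddChar G ℂ) (x : G) :
    (starRingEnd ℂ) (γ x) = γ (-x) := by
  rw [AddChar.map_neg_eq_conj]

theorem norm_charMean_le_one (B : Finset G) (γ : AddChar G ℂ) : ‖charMean B γ‖ ≤ 1 := by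
  rw [charMean, norm_div]
  have h : ‖∑ x ∈ B, γ x‖ ≤ #B := by
    refine (norm_sum_le _ _).trans ?_
    simp
  rcases B.eq_empty_or_nonempty with rfl | hB
  · simp
  · rw [div_le_one (by simpa using hB)]
    simpa using h

/-- Parseval's identity for indicator functions. -/
theorem sum_norm_sq_charSum (B : Finset G) :
    ∑ γ : AddChar G ℂ, ‖∑ x ∈ B, γ x‖ ^ 2 = (Fintype.card G : ℝ) * #B := by
  classical
  have h : ∀ γ : AddChar G ℂ, ((‖∑ x ∈ B, γ x‖ ^ 2 : ℝ) : ℂ) = ∑ x ∈ B, ∑ y ∈ B, γ (x - y) := by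
    intro γ
    push_cast
    rw [← Complex.mul_conj', map_sum, sum_mul_sum]
    refine sum_congr rfl fun x _ => sum_congr rfl fun y _ => ?_
    rw [AddChar.conj_eq_apply_neg, ← AddChar.map_add_eq_mul, sub_eq_add_neg]
  have h2 : ((∑ γ : AddChar G ℂ, ‖∑ x ∈ B, γ x‖ ^ 2 : ℝ) : ℂ) = (Fintype.card G : ℂ) * #B := by
    rw [Complex.ofReal_sum, sum_congr rfl fun γ _ => h γ, sum_comm]
    have : ∀ x ∈ B, ∑ γ : AddChar G ℂ, ∑ y ∈ B, γ (x - y) = Fintype.card G := by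
      intro x hx
      rw [sum_comm]
      simp_rw [AddChar.sum_apply_eq_ite, sub_eq_zero]
      simp [hx]
    rw [sum_congr rfl this]
    simp [mul_comm]
  exact_mod_cast h2

/-- Averaging an almost periodic function over iterated differences of its almost periods. -/
theorem exists_smoothing {f : G → ℝ} {c : AddChar G ℂ → ℂ} (hf : ∀ x, (f x : ℂ) = ∑ γ, c γ * γ x)
    {X : Finset G} (hX : X.Nonempty) {κ : ℝ}
    (hper : ∀ t ∈ X, ∀ t' ∈ X, ∀ z, |f (z + t) - f (z + t')| ≤ κ) (k : ℕ) :
    ∃ F : G → ℝ, (∀ x, |F x - f x| ≤ k * κ) ∧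
      ∀ x, (F x : ℂ) = ∑ γ, c γ * ((‖charMean X γ‖ ^ (2 * k) : ℝ) : ℂ) * γ x := by
  have hX0 : (0 : ℝ) < #X := by exact_mod_cast hX.card_pos
  induction k with
  | zero => exact ⟨f, by simp, by simpa using hf⟩
  | succ k ih =>
    obtain ⟨F, hF1, hF2⟩ := ih
    -- Averaging over the differences `t - t'` multiplies each coefficient by the nonnegative real
    -- `‖charMean X γ‖ ^ 2`, at the cost of one more `κ`.
    refine ⟨fun x => (∑ t ∈ X, ∑ t' ∈ X, F (x + t - t')) / (#X * #X), fun x => ?_, fun x => ?_⟩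
    · have e : (∑ t ∈ X, ∑ t' ∈ X, F (x + t - t')) / ((#X : ℝ) * #X) - f x =
          (∑ t ∈ X, ∑ t' ∈ X, (F (x + t - t') - f x)) / (#X * #X) := by
        simp only [sum_sub_distrib, sum_const, nsmul_eq_mul]
        field_simp
      rw [e, abs_div, abs_of_pos (by positivity : (0 : ℝ) < #X * #X), div_le_iff₀ (by positivity)]
      refine (abs_sum_le_sum_abs _ _).trans ?_
      calc ∑ t ∈ X, |∑ t' ∈ X, (F (x + t - t') - f x)|
          ≤ ∑ t ∈ X, ∑ t' ∈ X, ((k + 1 : ℕ) : ℝ) * κ := by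
            refine sum_le_sum fun t ht => (abs_sum_le_sum_abs _ _).trans
              (sum_le_sum fun t' ht' => ?_)
            have h1 := hF1 (x + t - t')
            have h2 := hper t ht t' ht' (x - t')
            have e1 : x - t' + t = x + t - t' := by abel
            rw [e1, sub_add_cancel] at h2
            rw [abs_le] at *
            push_cast
            constructor <;> linarith [h1.1, h1.2, h2.1, h2.2]
        _ = _ := by
            simp only [sum_const, nsmul_eq_mul]
            ring
    · push_cast
      simp_rw [hF2]
      rw [sum_congr rfl fun t _ => sum_comm, sum_comm, sum_div]
      refine sum_congr rfl fun γ _ => ?_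
      have e1 : ∀ t t' : G, γ (x + t - t') = γ x * (γ t * γ (-t')) := by
        intro t t'
        rw [sub_eq_add_neg, AddChar.map_add_eq_mul, AddChar.map_add_eq_mul, mul_assoc]
      simp_rw [e1, ← mul_assoc, ← mul_sum, mul_assoc, ← mul_sum, ← sum_mul]
      have e2 : ((‖charMean X γ‖ : ℝ) : ℂ) ^ 2 =
          (∑ t ∈ X, γ t) * (∑ t ∈ X, γ (-t)) / (#X * #X) := by
        rw [← Complex.mul_conj', charMean, map_div₀, map_sum]
        simp_rw [AddChar.conj_eq_apply_neg]
        simp only [map_natCast]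
        rw [div_mul_div_comm]
      have e3 : ((‖charMean X γ‖ : ℝ) : ℂ) ^ (2 * (k + 1)) =
          ((‖charMean X γ‖ : ℝ) : ℂ) ^ (2 * k) * ((‖charMean X γ‖ : ℝ) : ℂ) ^ 2 := by ring
      rw [e3, e2]
      push_cast
      ring

/-- The Fourier coefficients of `hitFreq`. -/
noncomputable def hitCoeff (A S E : Finset G) (γ : AddChar G ℂ) : ℂ :=
  (∑ e ∈ E, γ (-e)) * charMean A γ * charMean S γ / Fintype.card G

/-- The factor from `A` is at most `1`; the arithmetic–geometric mean inequality splits the other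
two, and Parseval gives `(|E| + |S|) / (2 |S|)`. Absolute summability allows a Bohr set condition to
be applied character by character. -/
theorem sum_norm_hitCoeff_le (A : Finset G) {S E : Finset G} (hS : S.Nonempty) {K : ℝ} (hK : 1 ≤ K)
    (hE : (#E : ℝ) ≤ K * #S) : ∑ γ : AddChar G ℂ, ‖hitCoeff A S E γ‖ ≤ K := by
  have hS0 : (0 : ℝ) < #S := by exact_mod_cast hS.card_pos
  have hG : (0 : ℝ) < Fintype.card G := by exact_mod_cast Fintype.card_pos
  have h1 : ∀ γ : AddChar G ℂ, ‖hitCoeff A S E γ‖ ≤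
      (‖∑ e ∈ E, γ e‖ ^ 2 + ‖∑ s ∈ S, γ s‖ ^ 2) * (1 / (2 * #S * Fintype.card G)) := by
    intro γ
    have hE' : ‖∑ e ∈ E, γ (-e)‖ = ‖∑ e ∈ E, γ e‖ := by
      rw [← RCLike.norm_conj (∑ e ∈ E, γ e), map_sum]
      simp_rw [AddChar.conj_eq_apply_neg]
    rw [hitCoeff, norm_div, norm_mul, norm_mul, hE', show charMean S γ = (∑ x ∈ S, γ x) / #S from rfl, norm_div]
    simp only [Complex.norm_natCast]
    have h2 := norm_charMean_le_one A γ
    set a := ‖∑ e ∈ E, γ e‖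
    set b := ‖∑ s ∈ S, γ s‖
    have ha : 0 ≤ a := norm_nonneg _
    have hb : 0 ≤ b := norm_nonneg _
    calc a * ‖charMean A γ‖ * (b / #S) / Fintype.card G ≤ a * 1 * (b / #S) / Fintype.card G := by
          gcongr
      _ = (2 * a * b) * (1 / (2 * #S * Fintype.card G)) := by field_simp
      _ ≤ _ := by
          gcongr
          exact two_mul_le_add_sq a b
  calc ∑ γ : AddChar G ℂ, ‖hitCoeff A S E γ‖
      ≤ ∑ γ : AddChar G ℂ, (‖∑ e ∈ E, γ e‖ ^ 2 + ‖∑ s ∈ S, γ s‖ ^ 2) *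
          (1 / (2 * #S * Fintype.card G)) := sum_le_sum fun γ _ => h1 γ
    _ = (Fintype.card G * #E + Fintype.card G * #S) * (1 / (2 * #S * Fintype.card G)) := by
        rw [← sum_mul, sum_add_distrib, sum_norm_sq_charSum, sum_norm_sq_charSum]
    _ ≤ (Fintype.card G * (K * #S) + Fintype.card G * (K * #S)) *
          (1 / (2 * #S * Fintype.card G)) := by
        gcongr
        nlinarith
    _ = K := by
        field_simp
        ring

variable [DecidableEq G]

/-- Fourier inversion for the indicator of `E`, averaged over `A` and `S`, each of which contributes
its mean `charMean`. -/
theorem hitFreq_eq_sum (A S E : Finset G) (x : G) :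
    (hitFreq A S E x : ℂ) = ∑ γ : AddChar G ℂ, hitCoeff A S E γ * γ x := by
  have hG : (Fintype.card G : ℂ) ≠ 0 := by exact_mod_cast Fintype.card_ne_zero
  have hind : ∀ y : G, (if y ∈ E then (1 : ℂ) else 0) =
      (∑ γ : AddChar G ℂ, (∑ e ∈ E, γ (-e)) * γ y) / Fintype.card G := by
    intro y
    have : ∀ γ : AddChar G ℂ, (∑ e ∈ E, γ (-e)) * γ y = ∑ e ∈ E, γ (y - e) := by
      intro γ
      rw [sum_mul]
      refine sum_congr rfl fun e _ => ?_
      rw [← AddChar.map_add_eq_mul]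
      congr 1
      abel
    rw [sum_congr rfl fun γ _ => this γ, sum_comm]
    simp_rw [AddChar.sum_apply_eq_ite, sub_eq_zero]
    rw [sum_ite_eq]
    split_ifs <;> simp [hG]
  rw [hitFreq]
  push_cast
  simp_rw [apply_ite (fun r : ℝ => (r : ℂ)), Complex.ofReal_one, Complex.ofReal_zero, hind]
  have hterm : ∀ γ : AddChar G ℂ, hitCoeff A S E γ * γ x =
      ∑ s ∈ S, ∑ a ∈ A, (∑ e ∈ E, γ (-e)) * γ (x + s + a) / Fintype.card G / #A / #S := by
    intro γ
    simp_rw [AddChar.map_add_eq_mul, ← sum_div, ← mul_assoc, ← mul_sum, ← sum_mul, ← mul_sum]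
    rw [hitCoeff, charMean, charMean]
    ring
  simp_rw [hterm]
  rw [sum_comm, sum_div]
  refine sum_congr rfl fun s _ => ?_
  rw [sum_comm, sum_div, sum_div]
  refine sum_congr rfl fun a _ => ?_
  simp_rw [sum_div]

/-- The Bohr set of the large spectrum of a set of almost periods lies in `(A + S) - (A + S)`. -/
theorem mem_sub_of_forall_norm_sub_one_le {A S X : Finset G} (hA : A.Nonempty) (hS : S.Nonempty)
    (hX : X.Nonempty) {K κ : ℝ} (hK : 1 ≤ K) (hAS : (#(A + S) : ℝ) ≤ K * #S)
    (hper : ∀ t ∈ X, ∀ t' ∈ X, ∀ z,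
      |hitFreq A S (A + S) (z + t) - hitFreq A S (A + S) (z + t')| ≤ κ)
    {k : ℕ} (hκ : k * κ ≤ 1 / 4) (hk : 16 * K ≤ 4 ^ k) {x : G}
    (hx : ∀ γ : AddChar G ℂ, 1 / 2 ≤ ‖charMean X γ‖ → ‖γ x - 1‖ ≤ 1 / (8 * K)) :
    x ∈ (A + S) - (A + S) := by
  apply mem_of_hitFreq_ne_zero
  have hK0 : 0 < K := by linarith
  obtain ⟨F, hF1, hF2⟩ := exists_smoothing (hitFreq_eq_sum A S (A + S)) hX hper k
  have h0 := hF1 0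
  have hx1 := hF1 x
  rw [hitFreq_zero hA hS] at h0
  -- On the large spectrum the hypothesis on `x` saves `1 / (8 * K)`; elsewhere the damping `(1 / 4)
  -- ^ k` does, since `16 * K ≤ 4 ^ k`. As `F` is within `1 / 4` of `hitFreq`, this leaves `hitFreq`
  -- at `x` at least `1 - 1/4 - 1/8 - 1/4 > 0`.
  have hdiff : |F x - F 0| ≤ 1 / 8 := by
    have e : ((F x - F 0 : ℝ) : ℂ) = ∑ γ : AddChar G ℂ, hitCoeff A S (A + S) γ *
        ((‖charMean X γ‖ ^ (2 * k) : ℝ) : ℂ) * (γ x - 1) := by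
      push_cast
      rw [hF2 x, hF2 0, ← sum_sub_distrib]
      refine sum_congr rfl fun γ _ => ?_
      rw [AddChar.map_zero_eq_one]
      push_cast
      ring
    have e2 : |F x - F 0| = ‖((F x - F 0 : ℝ) : ℂ)‖ := by
      rw [Complex.norm_real, Real.norm_eq_abs]
    rw [e2, e]
    refine (norm_sum_le _ _).trans ?_
    calc ∑ γ : AddChar G ℂ, ‖hitCoeff A S (A + S) γ *
        ((‖charMean X γ‖ ^ (2 * k) : ℝ) : ℂ) * (γ x - 1)‖
        ≤ ∑ γ : AddChar G ℂ, ‖hitCoeff A S (A + S) γ‖ * (1 / (8 * K)) := by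
          refine sum_le_sum fun γ _ => ?_
          rw [norm_mul, norm_mul, mul_assoc]
          gcongr
          rw [Complex.norm_real, Real.norm_of_nonneg (by positivity)]
          by_cases hγ : 1 / 2 ≤ ‖charMean X γ‖
          · have h1 : ‖charMean X γ‖ ^ (2 * k) ≤ 1 :=
              pow_le_one₀ (norm_nonneg _) (norm_charMean_le_one X γ)
            calc _ ≤ 1 * ‖γ x - 1‖ := by gcongr
              _ ≤ _ := by rw [one_mul]; exact hx γ hγ
          · have h1 : ‖charMean X γ‖ ^ (2 * k) ≤ (1 / 4) ^ k := by
              rw [pow_mul]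
              refine pow_le_pow_left₀ (by positivity) ?_ k
              push Not at hγ
              nlinarith [norm_nonneg (charMean X γ)]
            have h2 : ‖γ x - 1‖ ≤ 2 := by
              refine (norm_sub_le _ _).trans ?_
              simp
              norm_num
            calc _ ≤ (1 / 4) ^ k * (2 : ℝ) := by gcongr
              _ ≤ 1 / (8 * K) := by
                rw [div_pow, one_pow, ← mul_comm (2 : ℝ), mul_one_div,
                  div_le_div_iff₀ (by positivity) (by positivity)]
                linarith
      _ = (∑ γ : AddChar G ℂ, ‖hitCoeff A S (A + S) γ‖) * (1 / (8 * K)) := by rw [sum_mul]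
      _ ≤ K * (1 / (8 * K)) := by
          gcongr
          exact sum_norm_hitCoeff_le A hS hK hAS
      _ = 1 / 8 := by field_simp
  intro hzero
  rw [hzero] at hx1
  rw [abs_le] at *
  linarith [h0.1, hx1.2, hdiff.1]

/-- A nearly invariant set forces the characters in its large spectrum to be nearly trivial. -/
theorem norm_sub_one_le_of_nearly_invariant {U V : Finset G} {δ : ℝ} {x : G} (hU : U.Nonempty)
    (hUV : U ⊆ V) (hxV : x +ᵥ U ⊆ V) (hV : (#V : ℝ) ≤ (1 + δ) * #U) {γ : AddChar G ℂ}
    (hγ : 1 / 2 ≤ ‖charMean U γ‖) : ‖γ x - 1‖ ≤ 4 * δ := by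
  have hU0 : (0 : ℝ) < #U := by exact_mod_cast hU.card_pos
  -- The left side is the sum over `x + U` minus the sum over `U`. Both sets lie in `V` and miss at
  -- most `δ * #U` of it.
  have h1 : (γ x - 1) * ∑ u ∈ U, γ u = ∑ v ∈ V \ U, γ v - ∑ v ∈ V \ (x +ᵥ U), γ v := by
    have e1 : ∑ v ∈ V \ U, γ v + ∑ u ∈ U, γ u = ∑ v ∈ V, γ v := sum_sdiff hUV
    have e2 : ∑ v ∈ V \ (x +ᵥ U), γ v + ∑ u ∈ x +ᵥ U, γ u = ∑ v ∈ V, γ v := sum_sdiff hxV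
    have e3 : ∑ u ∈ x +ᵥ U, γ u = γ x * ∑ u ∈ U, γ u := by
      rw [← image_vadd, sum_image (fun a _ b _ h => by simpa using h), mul_sum]
      exact sum_congr rfl fun u _ => by rw [vadd_eq_add, AddChar.map_add_eq_mul]
    linear_combination e2 - e1 - e3
  have hnorm : ∀ B : Finset G, ‖∑ v ∈ B, γ v‖ ≤ #B := by
    intro B
    refine (norm_sum_le _ _).trans ?_
    simp
  have h2 : ‖γ x - 1‖ * ‖∑ u ∈ U, γ u‖ ≤ 2 * (δ * #U) := by
    rw [← norm_mul, h1]
    refine (norm_sub_le _ _).trans ?_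
    have c1 : (#(V \ U) : ℝ) + #U = #V := by exact_mod_cast card_sdiff_add_card_eq_card hUV
    have c2 : (#(V \ (x +ᵥ U)) : ℝ) + #U = #V := by
      have := card_sdiff_add_card_eq_card hxV
      rw [card_vadd_finset] at this
      exact_mod_cast this
    linarith [hnorm (V \ U), hnorm (V \ (x +ᵥ U))]
  have h3 : (#U : ℝ) / 2 ≤ ‖∑ u ∈ U, γ u‖ := by
    rw [charMean, norm_div, Complex.norm_natCast, le_div_iff₀ hU0] at hγ
    linarith
  have h4 : ‖γ x - 1‖ * (#U / 2) ≤ 2 * (δ * #U) := le_trans (by gcongr) h2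
  refine le_of_mul_le_mul_right ?_ hU0
  linarith

end Fourier

/-! ### Chang's theorem relative to a nearly invariant set. -/

section Spectrum

variable {G : Type*} [AddCommGroup G]

theorem AddChar.map_finsetSum {ι : Type*} (χ : AddChar G ℂ) (s : Finset ι) (f : ι → G) :
    χ (∑ i ∈ s, f i) = ∏ i ∈ s, χ (f i) := by
  classical
  induction s using Finset.induction_on with
  | empty => simp
  | insert a s ha ih => rw [sum_insert ha, prod_insert ha, AddChar.map_add_eq_mul, ih]

/-- The possible exponents in a signed product of a family of characters. -/
def signBox (r : ℕ) : Finset (Fin r → ℤ) := Fintype.piFinset fun _ => {-1, 0, 1}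

theorem card_signBox (r : ℕ) : #(signBox r) = 3 ^ r := by
  rw [signBox, Fintype.card_piFinset]
  simp

/-- The averaging weight is `W` convolved with `M` copies of `U`. The power `M` makes characters
outside the large spectrum of `U` negligible. -/
theorem sum_sum_char_eq (W U : Finset G) (hW : W.Nonempty) (hU : U.Nonempty) (M : ℕ)
    (χ : AddChar G ℂ) :
    ∑ u ∈ Fintype.piFinset (fun _ : Fin M => U), ∑ w ∈ W, χ (w + ∑ i, u i) =
      #W * (#U : ℂ) ^ M * (charMean W χ * charMean U χ ^ M) := by
  have hW0 : (#W : ℂ) ≠ 0 := by exact_mod_cast hW.card_pos.ne'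
  have hU0 : (#U : ℂ) ≠ 0 := by exact_mod_cast hU.card_pos.ne'
  have h1 : ∀ u : Fin M → G, ∑ w ∈ W, χ (w + ∑ i, u i) = (∑ w ∈ W, χ w) * ∏ i, χ (u i) := by
    intro u
    rw [sum_mul]
    refine sum_congr rfl fun w _ => ?_
    rw [AddChar.map_add_eq_mul, AddChar.map_finsetSum]
  simp_rw [h1]
  rw [← mul_sum, sum_prod_piFinset U (fun (_ : Fin M) u => χ u)]
  simp only [prod_const, card_univ, Fintype.card_fin]
  rw [charMean, charMean, div_pow]
  field_simp

variable [Fintype G]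

/-- A relative form of **Chang's theorem**: a family of characters in the large spectrum of `X`
which is dissociated relative to the convolution of `W` with `M` copies of `U` is small. -/
theorem card_le_of_dissociated {X W U : Finset G} (hX : X.Nonempty) (hW : W.Nonempty)
    (hU : U.Nonempty) {M : ℕ}
    (hsub : ∀ x ∈ X, ∀ u ∈ Fintype.piFinset (fun _ : Fin M => U), x - ∑ i, u i ∈ W)
    {r : ℕ} {τ : Fin r → AddChar G ℂ} (hτ : ∀ i, 1 / 2 ≤ ‖charMean X (τ i)‖) {η : ℝ}
    (hη0 : 0 ≤ η) (hη : 3 ^ r * η ≤ 1)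
    (hdis : ∀ ε ∈ signBox r, ε ≠ 0 →
      ‖charMean W (∏ i, τ i ^ ε i)‖ * ‖charMean U (∏ i, τ i ^ ε i)‖ ^ M ≤ η) :
    (r : ℝ) ≤ 8 * Real.log (2 * #W / #X) := by
  classical
  have hX0 : (0 : ℝ) < #X := by exact_mod_cast hX.card_pos
  have hW0 : (0 : ℝ) < #W := by exact_mod_cast hW.card_pos
  have hU0 : (0 : ℝ) < #U := by exact_mod_cast hU.card_pos
  have hm0 : ∀ i, charMean X (τ i) ≠ 0 := fun i h => by
    have := hτ i
    rw [h, norm_zero] at this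
    norm_num at this
  -- Unimodular phases rotating the means to positive reals, so that each `ψ i` has average at least
  -- `1 / 2` on `X`.
  set c : Fin r → ℂ := fun i =>
    (starRingEnd ℂ) (charMean X (τ i)) / ‖charMean X (τ i)‖ with hc
  have hcnorm : ∀ i, ‖c i‖ = 1 := by
    intro i
    have : ‖charMean X (τ i)‖ ≠ 0 := norm_ne_zero_iff.2 (hm0 i)
    simp only [hc, norm_div, RCLike.norm_conj, Complex.norm_real, norm_norm]
    exact div_self this
  have hcmean : ∀ i, c i * charMean X (τ i) = ‖charMean X (τ i)‖ := by
    intro i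
    have : (‖charMean X (τ i)‖ : ℂ) ≠ 0 := by exact_mod_cast norm_ne_zero_iff.2 (hm0 i)
    simp only [hc]
    rw [div_mul_eq_mul_div, Complex.conj_mul', sq, mul_div_assoc, div_self this, mul_one]
  set ψ : Fin r → G → ℝ := fun i x => (c i * τ i x).re with hψ
  have hψ1 : ∀ i x, |ψ i x| ≤ 1 := by
    intro i x
    refine (Complex.abs_re_le_norm _).trans ?_
    rw [norm_mul, hcnorm, AddChar.norm_apply, mul_one]
  have hψsum : ∀ i, (#X : ℝ) / 2 ≤ ∑ x ∈ X, ψ i x := by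
    intro i
    have : ∑ x ∈ X, ψ i x = #X * ‖charMean X (τ i)‖ := by
      simp only [hψ]
      rw [← Complex.re_sum, ← mul_sum]
      have e : ∑ x ∈ X, τ i x = #X * charMean X (τ i) := by
        rw [charMean, mul_div_cancel₀]
        exact_mod_cast hX0.ne'
      rw [e, mul_left_comm, hcmean]
      norm_cast
    rw [this]
    nlinarith [hτ i]
  set C : ℝ := Real.cosh (1 / 2) with hC
  set s : ℝ := Real.sinh (1 / 2) with hs
  have hC0 : 0 < C := Real.cosh_pos _
  have hs0 : 0 ≤ s := Real.sinh_nonneg_iff.2 (by norm_num)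
  have hsC : s < C := Real.sinh_lt_cosh _
  -- A Riesz product: it dominates `exp (½ ∑ ψ i)`, yet its Fourier expansion only involves the
  -- signed products controlled by `hdis`.
  set φ : G → ℝ := fun x => ∏ i, (C + ψ i x * s) with hφ
  have hφ0 : ∀ x, 0 ≤ φ x := by
    intro x
    refine prod_nonneg fun i _ => ?_
    have := (abs_le.1 (hψ1 i x)).1
    nlinarith
  have hexp : ∀ x, Real.exp (1 / 2 * ∑ i, ψ i x) ≤ φ x := by
    intro x
    rw [mul_sum, Real.exp_sum]
    refine prod_le_prod (fun _ _ => (Real.exp_pos _).le) fun i _ => ?_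
    rw [mul_comm]
    exact Real.exp_mul_le_cosh_add_mul_sinh (hψ1 i x) _
  -- Fourier expansion of the Riesz product
  set κ : Fin r → ℤ → ℂ := fun i e => if e = 0 then (C : ℂ) else
    if e = 1 then s * c i / 2 else s * (starRingEnd ℂ) (c i) / 2 with hκ
  have hκnorm : ∀ i e, ‖κ i e‖ ≤ C := by
    intro i e
    simp only [hκ]
    split_ifs
    · rw [Complex.norm_real, Real.norm_of_nonneg hC0.le]
    · rw [norm_div, norm_mul, hcnorm, Complex.norm_real, Real.norm_of_nonneg hs0]
      simp
      linarith
    · rw [norm_div, norm_mul, RCLike.norm_conj, hcnorm, Complex.norm_real, Real.norm_of_nonneg hs0]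
      simp
      linarith
  have hexpand : ∀ x, (φ x : ℂ) = ∑ ε ∈ signBox r, (∏ i, κ i (ε i)) * (∏ i, τ i ^ ε i) x := by
    intro x
    have h1 : ∀ i, ((C + ψ i x * s : ℝ) : ℂ) =
        ∑ e ∈ ({-1, 0, 1} : Finset ℤ), κ i e * (τ i ^ e) x := by
      intro i
      rw [sum_insert (by decide), sum_insert (by decide), sum_singleton]
      simp only [hκ]
      norm_num
      have h2 : ((ψ i x : ℝ) : ℂ) = (c i * τ i x + (starRingEnd ℂ) (c i * τ i x)) / 2 := by
        rw [Complex.add_conj]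
        simp [hψ]
      rw [h2, map_mul, AddChar.conj_eq_apply_neg, AddChar.map_neg_eq_inv]
      ring
    simp only [hφ]
    rw [Complex.ofReal_prod, prod_congr rfl fun i _ => h1 i, prod_univ_sum, signBox]
    refine sum_congr rfl fun ε _ => ?_
    rw [AddChar.prod_apply, prod_mul_distrib]
  -- As `φ ≥ 0`, every shift of `X` by a sum from `U` may be enlarged to `W`. In the expansion `ε =
  -- 0` contributes at most `1` and the `3 ^ r` error terms at most `3 ^ r * η ≤ 1`, whence the
  -- factor `2`.
  have hupper : (#U : ℝ) ^ M * ∑ x ∈ X, φ x ≤ 2 * #W * (#U : ℝ) ^ M * C ^ r := by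
    have h1 : (#U : ℝ) ^ M * ∑ x ∈ X, φ x ≤
        ∑ u ∈ Fintype.piFinset (fun _ : Fin M => U), ∑ w ∈ W, φ (w + ∑ i, u i) := by
      have e : (#U : ℝ) ^ M = #(Fintype.piFinset (fun _ : Fin M => U)) := by
        rw [Fintype.card_piFinset]
        simp
      rw [e, ← nsmul_eq_mul, ← sum_const]
      refine sum_le_sum fun u hu => ?_
      calc ∑ x ∈ X, φ x = ∑ w ∈ X.image (fun x => x - ∑ i, u i), φ (w + ∑ i, u i) := by
            rw [sum_image (fun a _ b _ h => sub_left_injective h)]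
            simp
        _ ≤ _ := by
            refine sum_le_sum_of_subset_of_nonneg ?_ fun _ _ _ => hφ0 _
            intro w hw
            obtain ⟨x, hx, rfl⟩ := mem_image.1 hw
            exact hsub x hx u hu
    refine h1.trans ?_
    have h2 : ((∑ u ∈ Fintype.piFinset (fun _ : Fin M => U), ∑ w ∈ W, φ (w + ∑ i, u i) : ℝ) : ℂ) =
        ∑ ε ∈ signBox r, (∏ i, κ i (ε i)) * (#W * (#U : ℂ) ^ M *
          (charMean W (∏ i, τ i ^ ε i) * charMean U (∏ i, τ i ^ ε i) ^ M)) := by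
      push_cast
      simp_rw [hexpand]
      rw [sum_congr rfl fun u _ => sum_comm, sum_comm]
      refine sum_congr rfl fun ε _ => ?_
      simp_rw [← mul_sum]
      rw [sum_sum_char_eq W U hW hU]
    have h3 : ∑ u ∈ Fintype.piFinset (fun _ : Fin M => U), ∑ w ∈ W, φ (w + ∑ i, u i) ≤
        ‖((∑ u ∈ Fintype.piFinset (fun _ : Fin M => U), ∑ w ∈ W, φ (w + ∑ i, u i) : ℝ) : ℂ)‖ := by
      rw [Complex.norm_real]
      exact le_abs_self _
    refine h3.trans ?_
    rw [h2]
    refine (norm_sum_le _ _).trans ?_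
    have hterm : ∀ ε ∈ signBox r, ‖(∏ i, κ i (ε i)) * (#W * (#U : ℂ) ^ M *
        (charMean W (∏ i, τ i ^ ε i) * charMean U (∏ i, τ i ^ ε i) ^ M))‖ ≤
        (C ^ r * (#W * (#U : ℝ) ^ M)) * ((if ε = 0 then 1 else 0) + η) := by
      intro ε hε
      have hprod : ‖∏ i, κ i (ε i)‖ ≤ C ^ r := by
        rw [norm_prod]
        calc ∏ i, ‖κ i (ε i)‖ ≤ ∏ _i : Fin r, C :=
              prod_le_prod (fun _ _ => norm_nonneg _) fun i _ => hκnorm i _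
          _ = C ^ r := by simp
      rw [norm_mul, norm_mul, norm_mul, norm_mul, norm_pow, norm_pow, Complex.norm_natCast,
        Complex.norm_natCast, ← mul_assoc]
      gcongr
      by_cases h0 : ε = 0
      · rw [if_pos h0]
        have h4 := norm_charMean_le_one W (∏ i, τ i ^ ε i)
        have h5 : ‖charMean U (∏ i, τ i ^ ε i)‖ ^ M ≤ 1 :=
          pow_le_one₀ (norm_nonneg _) (norm_charMean_le_one U _)
        have := mul_le_one₀ h4 (by positivity) h5
        linarith
      · rw [if_neg h0, zero_add]
        exact hdis ε hε h0
    refine (sum_le_sum hterm).trans ?_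
    rw [← mul_sum, sum_add_distrib, sum_const, card_signBox, nsmul_eq_mul, sum_ite_eq']
    have h6 : (if (0 : Fin r → ℤ) ∈ signBox r then (1 : ℝ) else 0) ≤ 1 := by
      split_ifs <;> norm_num
    push_cast
    have h7 : 0 ≤ C ^ r * (#W * (#U : ℝ) ^ M) := by positivity
    nlinarith
  have hfinal : ∑ x ∈ X, Real.exp (1 / 2 * ∑ i, ψ i x) ≤
      Real.exp (Real.log (2 * #W / #X) + r / 8) * #X := by
    have h1 : ∑ x ∈ X, φ x ≤ 2 * #W * C ^ r := by
      have h2 : (0 : ℝ) < (#U : ℝ) ^ M := by positivity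
      refine le_of_mul_le_mul_left (hupper.trans (le_of_eq ?_)) h2
      ring
    have h3 : C ^ r ≤ Real.exp (r / 8) := by
      calc C ^ r ≤ Real.exp ((1 / 2) ^ 2 / 2) ^ r :=
            pow_le_pow_left₀ hC0.le (Real.cosh_le_exp_half_sq _) r
        _ = Real.exp (r / 8) := by
            rw [← Real.exp_nat_mul]
            congr 1
            ring
    calc _ ≤ ∑ x ∈ X, φ x := sum_le_sum fun x _ => hexp x
      _ ≤ 2 * #W * C ^ r := h1
      _ ≤ 2 * #W * Real.exp (r / 8) := by gcongr
      _ = _ := by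
          rw [Real.exp_add, Real.exp_log (by positivity)]
          field_simp
  have h8 := mul_sum_le_of_sum_exp_le hfinal
  have h9 : (r : ℝ) * (#X / 2) ≤ ∑ x ∈ X, ∑ i, ψ i x := by
    rw [sum_comm]
    calc (r : ℝ) * (#X / 2) = ∑ _i : Fin r, (#X : ℝ) / 2 := by simp
      _ ≤ _ := sum_le_sum fun i _ => hψsum i
  -- Jensen bounds the average of `½ ∑ ψ i`, which is at least `r / 4`, while `cosh (1/2) ^ r` only
  -- costs `r / 8`.
  have h10 : (r : ℝ) / 4 ≤ Real.log (2 * #W / #X) + r / 8 := by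
    refine le_of_mul_le_mul_right ?_ hX0
    linarith
  linarith

/-- The large spectrum of `X` is generated by few characters together with the large spectrum of
`U`, provided `X` has few translates by sums of elements of `U`. -/
theorem exists_spectrum_generators {X W U : Finset G} (hX : X.Nonempty) (hW : W.Nonempty)
    (hU : U.Nonempty) {M tb : ℕ}
    (hsub : ∀ x ∈ X, ∀ u ∈ Fintype.piFinset (fun _ : Fin M => U), x - ∑ i, u i ∈ W)
    (htb : 8 * Real.log (2 * #W / #X) < tb + 1) (hM : 2 * (tb + 1) ≤ M) :
    ∃ r ≤ tb, ∃ τ : Fin r → AddChar G ℂ, ∀ γ : AddChar G ℂ, 1 / 2 ≤ ‖charMean X γ‖ →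
      ∃ ε ∈ signBox r, ∃ a : ℤ, (a = 1 ∨ a = -1) ∧
        1 / 2 ≤ ‖charMean U (γ ^ a * ∏ i, τ i ^ ε i)‖ := by
  by_contra! hcon
  set η : ℝ := 1 / 3 ^ (tb + 1) with hη
  -- While generation fails, the offending character can be appended: a product containing it to the
  -- power `±1` lies outside the large spectrum of `U`, so its `M`-th power is at most `(1 / 2) ^ M
  -- ≤ 4 ^ (-(tb + 1)) ≤ η`. A family of size `tb + 1` contradicts `card_le_of_dissociated`.
  have key : ∀ r ≤ tb + 1, ∃ τ : Fin r → AddChar G ℂ, (∀ i, 1 / 2 ≤ ‖charMean X (τ i)‖) ∧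
      ∀ ε ∈ signBox r, ε ≠ 0 →
        ‖charMean W (∏ i, τ i ^ ε i)‖ * ‖charMean U (∏ i, τ i ^ ε i)‖ ^ M ≤ η := by
    intro r
    induction r with
    | zero =>
      intro _
      refine ⟨fun i => i.elim0, fun i => i.elim0, fun ε _ h => absurd (funext fun i => i.elim0) h⟩
    | succ r ih =>
      intro hr
      obtain ⟨τ, hτ, hdis⟩ := ih (by omega)
      obtain ⟨γ, hγ, hγU⟩ := hcon r (by omega) τ
      refine ⟨Fin.cons γ τ, fun i => ?_, fun ε hε hne => ?_⟩
      · refine Fin.cases ?_ (fun i => ?_) i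
        · simpa using hγ
        · simpa using hτ i
      · rw [Fin.prod_univ_succ]
        simp only [Fin.cons_zero, Fin.cons_succ]
        rw [signBox, Fintype.mem_piFinset] at hε
        have htail : (fun i : Fin r => ε i.succ) ∈ signBox r :=
          Fintype.mem_piFinset.2 fun i => hε i.succ
        by_cases h0 : ε 0 = 0
        · rw [h0, zpow_zero, one_mul]
          refine hdis _ htail ?_
          intro hz
          apply hne
          funext i
          refine Fin.cases h0 (fun i => congrFun hz i) i
        · have ha : ε 0 = 1 ∨ ε 0 = -1 := by
            have := hε 0
            simp only [mem_insert, mem_singleton] at this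
            tauto
          have h1 := hγU _ htail (ε 0) ha
          calc _ ≤ 1 * (1 / 2) ^ M := by
                gcongr
                · exact norm_charMean_le_one W _
              _ ≤ (1 / 2 : ℝ) ^ (2 * (tb + 1)) := by
                rw [one_mul]
                exact pow_le_pow_of_le_one (by norm_num) (by norm_num) hM
              _ = (1 / 4 : ℝ) ^ (tb + 1) := by
                rw [pow_mul]
                norm_num
              _ ≤ (1 / 3 : ℝ) ^ (tb + 1) := by gcongr; norm_num
              _ = η := by rw [hη, div_pow, one_pow]
  obtain ⟨τ, hτ, hdis⟩ := key (tb + 1) le_rfl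
  have := card_le_of_dissociated hX hW hU hsub hτ (by positivity) (by
    rw [hη]
    field_simp
    rfl) hdis
  push_cast at this
  linarith

theorem norm_mul_sub_one_le {a b : ℂ} (ha : ‖a‖ = 1) : ‖a * b - 1‖ ≤ ‖a - 1‖ + ‖b - 1‖ := by
  have : a * b - 1 = a * (b - 1) + (a - 1) := by ring
  rw [this]
  refine (norm_add_le _ _).trans ?_
  rw [norm_mul, ha, one_mul, add_comm]

theorem norm_inv_sub_one {a : ℂ} (ha : ‖a‖ = 1) : ‖a⁻¹ - 1‖ = ‖a - 1‖ := by
  have h0 : a ≠ 0 := fun h => by simp [h] at ha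
  have : a⁻¹ - 1 = -(a⁻¹ * (a - 1)) := by
    field_simp
    ring
  rw [this, norm_neg, norm_mul, norm_inv, ha]
  simp

theorem norm_prod_zpow_sub_one_le {r : ℕ} {z : Fin r → ℂ} (hz : ∀ i, ‖z i‖ = 1) {ε : Fin r → ℤ}
    (hε : ε ∈ signBox r) {ρ : ℝ} (hρ : ∀ i, ‖z i - 1‖ ≤ ρ) :
    ‖∏ i, z i ^ ε i - 1‖ ≤ r * ρ := by
  induction r with
  | zero => simp
  | succ r ih =>
    rw [Fin.prod_univ_succ]
    rw [signBox, Fintype.mem_piFinset] at hε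
    refine (norm_mul_sub_one_le (by simp [hz])).trans ?_
    have h1 := ih (fun i => hz i.succ) (ε := fun i => ε i.succ)
      (Fintype.mem_piFinset.2 fun i => hε i.succ) fun i => hρ i.succ
    have h2 : ‖z 0 ^ ε 0 - 1‖ ≤ ρ := by
      have h3 := hε 0
      have hρ0 : 0 ≤ ρ := (norm_nonneg _).trans (hρ 0)
      simp only [mem_insert, mem_singleton] at h3
      rcases h3 with h | h | h <;> rw [h]
      · rw [zpow_neg_one, norm_inv_sub_one (hz 0)]
        exact hρ 0
      · simpa using hρ0
      · rw [zpow_one]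
        exact hρ 0
    push_cast
    linarith

/-- A character is close to `1` at a point where the generators of its spectral coset are. -/
theorem norm_apply_sub_one_le_of_generators {r : ℕ} {τ : Fin r → AddChar G ℂ} {γ : AddChar G ℂ}
    {ε : Fin r → ℤ} (hε : ε ∈ signBox r) {a : ℤ} (ha : a = 1 ∨ a = -1) {x : G} {ρ : ℝ}
    (hτ : ∀ i, ‖τ i x - 1‖ ≤ ρ) (hγ : ‖(γ ^ a * ∏ i, τ i ^ ε i) x - 1‖ ≤ ρ) :
    ‖γ x - 1‖ ≤ (r + 1) * ρ := by
  set Z : ℂ := ∏ i, τ i x ^ ε i with hZ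
  have hZn : ‖Z‖ = 1 := by simp [hZ, norm_prod]
  have hZ1 : ‖Z - 1‖ ≤ r * ρ := norm_prod_zpow_sub_one_le (fun i => by simp) hε hτ
  have hform : (γ ^ a * ∏ i, τ i ^ ε i) x = γ x ^ a * Z := by
    rw [AddChar.mul_apply, AddChar.prod_apply, AddChar.zpow_apply]
    simp [hZ]
  rw [hform] at hγ
  have hpow : ‖γ x ^ a - 1‖ ≤ (r + 1) * ρ := by
    have h0 : Z ≠ 0 := fun h => by simp [h] at hZn
    have e : γ x ^ a = Z⁻¹ * (γ x ^ a * Z) := by field_simp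
    rw [e]
    refine (norm_mul_sub_one_le (by simp [hZn])).trans ?_
    rw [norm_inv_sub_one hZn]
    linarith
  rcases ha with rfl | rfl
  · simpa using hpow
  · rwa [zpow_neg_one, norm_inv_sub_one (by simp)] at hpow

end Spectrum

/-! ### Bases of maximal determinant. -/

section Bases

variable {W : Type*} [AddCommGroup W] [Module ℝ W]

/-- A finite spanning set contains a basis. -/
theorem exists_basis_mem_of_span_eq_top {Q : Finset W} {n : ℕ}
    (hn : Module.finrank ℝ W = n) (hQ : Submodule.span ℝ (Q : Set W) = ⊤) :
    ∃ b : Module.Basis (Fin n) ℝ W, ∀ i, b i ∈ Q := by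
  obtain ⟨B, hBQ, hspan, hli⟩ := exists_linearIndependent ℝ (Q : Set W)
  rw [hQ] at hspan
  have hsp : ⊤ ≤ Submodule.span ℝ (Set.range (Subtype.val : B → W)) := by
    rw [Subtype.range_val, hspan]
  set b := Module.Basis.mk hli hsp
  have : Fintype B := ((Q.finite_toSet).subset hBQ).fintype
  have hcard : Fintype.card B = n := by rw [← hn, Module.finrank_eq_card_basis b]
  refine ⟨b.reindex (Fintype.equivFinOfCardEq hcard), fun i => ?_⟩
  rw [Module.Basis.reindex_apply, Module.Basis.mk_apply]
  exact hBQ (Subtype.prop _)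

/-- A finite spanning set contains a basis relative to which all its coordinates are at most `1`
in absolute value. -/
theorem exists_basis_mem_abs_repr_le_one {Q : Finset W} {n : ℕ}
    (hn : Module.finrank ℝ W = n) (hQ : Submodule.span ℝ (Q : Set W) = ⊤) :
    ∃ b : Module.Basis (Fin n) ℝ W, (∀ i, b i ∈ Q) ∧ ∀ v ∈ Q, ∀ i, |b.repr v i| ≤ 1 := by
  classical
  obtain ⟨e, he⟩ := exists_basis_mem_of_span_eq_top hn hQ
  -- Choose the tuple of largest determinant. By Cramer's rule a coordinate of `v` is the ratio of
  -- determinants after replacing `u i` by `v`.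
  obtain ⟨u, hu, hmax⟩ := exists_max_image (Fintype.piFinset fun _ : Fin n => Q)
    (fun u => |e.det u|) ⟨e, Fintype.mem_piFinset.2 he⟩
  rw [Fintype.mem_piFinset] at hu
  have hdet : 0 < |e.det u| := by
    have := hmax e (Fintype.mem_piFinset.2 he)
    rw [e.det_self, abs_one] at this
    linarith
  obtain ⟨hli, hsp⟩ := (e.is_basis_iff_det).2 (isUnit_iff_ne_zero.2 (abs_pos.1 hdet))
  refine ⟨Module.Basis.mk hli hsp.ge, fun i => by rw [Module.Basis.mk_apply]; exact hu i,
    fun v hv i => ?_⟩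
  have h1 := congrArg (fun f => f v) (e.det_smul_mk_coord_eq_det_update hli hsp.ge i)
  simp only [LinearMap.smul_apply, Module.Basis.coord_apply, smul_eq_mul,
    MultilinearMap.toLinearMap_apply] at h1
  have h2 := hmax (Function.update u i v) (Fintype.mem_piFinset.2 fun j => by
    by_cases hj : j = i
    · subst hj; simpa using hv
    · simpa [hj] using hu j)
  have h3 : |e.det u| * |(Module.Basis.mk hli hsp.ge).repr v i| ≤ |e.det u| * 1 := by
    rw [← abs_mul, h1, mul_one]
    exact h2
  exact le_of_mul_le_mul_left h3 hdet

end Bases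

/-! ### Successive minima and counting by cells. -/

section Minima

/-- A basis of minimal total length chosen from a finite spanning set, ordered by length: the
analogue of a system of vectors attaining the successive minima. -/
theorem exists_basis_successive_minima {E : Type*} [NormedAddCommGroup E] [NormedSpace ℝ E]
    {F : Finset E} {n : ℕ}
    (hn : Module.finrank ℝ E = n) (hF : Submodule.span ℝ (F : Set E) = ⊤) :
    ∃ b : Module.Basis (Fin n) ℝ E, (∀ i, b i ∈ F) ∧ Monotone (fun i => ‖b i‖) ∧
      ∀ w ∈ F, ∀ i, b.repr w i ≠ 0 → ‖b i‖ ≤ ‖w‖ := by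
  classical
  obtain ⟨e, he⟩ := exists_basis_mem_of_span_eq_top hn hF
  -- Exchange argument: replacing `u i` by a vector with nonzero `i`-th coordinate gives another
  -- basis from `F`, whose total length cannot be smaller.
  obtain ⟨u, hu, hmin⟩ := exists_min_image
    ((Fintype.piFinset fun _ : Fin n => F).filter fun u => IsUnit (e.det u))
    (fun u => ∑ i, ‖u i‖) ⟨e, mem_filter.2 ⟨Fintype.mem_piFinset.2 he, by simp [e.det_self]⟩⟩
  rw [mem_filter, Fintype.mem_piFinset] at hu
  obtain ⟨huF, hunit⟩ := hu
  obtain ⟨hli, hsp⟩ := (e.is_basis_iff_det).2 hunit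
  set b := Module.Basis.mk hli hsp.ge with hb
  have hbu : ∀ i, b i = u i := fun i => by rw [hb, Module.Basis.mk_apply]
  have hexch : ∀ w ∈ F, ∀ i, b.repr w i ≠ 0 → ‖b i‖ ≤ ‖w‖ := by
    intro w hw i hne
    have h1 := congrArg (fun f => f w) (e.det_smul_mk_coord_eq_det_update hli hsp.ge i)
    simp only [LinearMap.smul_apply, Module.Basis.coord_apply, smul_eq_mul,
      MultilinearMap.toLinearMap_apply] at h1
    have h2 := hmin (Function.update u i w) (mem_filter.2 ⟨Fintype.mem_piFinset.2 fun j => by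
      by_cases hj : j = i
      · subst hj; simpa using hw
      · simpa [hj] using huF j, by
        refine isUnit_iff_ne_zero.2 ?_
        have h3 := mul_ne_zero hunit.ne_zero hne
        rw [h1] at h3
        exact h3⟩)
    rw [← add_sum_erase _ _ (mem_univ i), ← add_sum_erase _ (fun j => ‖Function.update u i w j‖)
      (mem_univ i)] at h2
    have h3 : ∑ j ∈ univ.erase i, ‖Function.update u i w j‖ = ∑ j ∈ univ.erase i, ‖u j‖ :=
      sum_congr rfl fun j hj => by rw [Function.update_of_ne (ne_of_mem_erase hj)]
    rw [h3, Function.update_self] at h2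
    rw [hbu]
    linarith
  set σ := Tuple.sort (fun i => ‖b i‖)
  refine ⟨b.reindex σ.symm, fun i => ?_, ?_, fun w hw i hne => ?_⟩
  · rw [Module.Basis.reindex_apply, hbu]
    exact huF _
  · have := Tuple.monotone_sort (fun i => ‖b i‖)
    intro i j hij
    simpa [Module.Basis.reindex_apply] using this hij
  · rw [Module.Basis.reindex_apply]
    rw [Module.Basis.repr_reindex_apply] at hne
    exact hexch w hw _ hne

/-- Counting points of a finite set of bounded vectors in terms of the lengths of a basis formed by
short differences. -/
theorem card_le_prod_of_successive_minima {n : ℕ} {E : Type*} [NormedAddCommGroup E]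
    [InnerProductSpace ℝ E] [FiniteDimensional ℝ E] (hn : Module.finrank ℝ E = n)
    {R : Finset E} (hR : ∀ v ∈ R, ‖v‖ ≤ n) (b : Module.Basis (Fin n) ℝ E)
    (hmono : Monotone (fun i => ‖b i‖)) (h1 : ∀ i, ‖b i‖ ≤ 1)
    (hmin : ∀ v ∈ R, ∀ w ∈ R, ∀ i, b.repr (v - w) i ≠ 0 → ‖b i‖ ≤ ‖v - w‖) :
    (#R : ℝ) ≤ ∏ i, (5 * (n : ℝ) ^ 2 / ‖b i‖) := by
  classical
  have hb0 : ∀ i, 0 < ‖b i‖ := fun i => norm_pos_iff.2 (b.ne_zero i)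
  -- The cells are boxes in the Gram–Schmidt frame, of side `‖b i‖ / n` in direction `o i`.
  set o := InnerProductSpace.gramSchmidtOrthonormalBasis (𝕜 := ℝ) (by simpa using hn) (b : Fin n → E)
    with ho
  set cell : E → Fin n → ℤ := fun v i => ⌊inner ℝ (o i) v * (n / ‖b i‖)⌋ with hcell
  set N : Fin n → ℤ := fun i => ⌈(n : ℝ) ^ 2 / ‖b i‖⌉ with hN
  have hmaps : ∀ v ∈ R, cell v ∈ Fintype.piFinset fun i => Icc (-N i) (N i) := by
    intro v hv
    rw [Fintype.mem_piFinset]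
    intro i
    have hin : |inner ℝ (o i) v| ≤ n := by
      have := abs_real_inner_le_norm (o i) v
      rw [o.orthonormal.1 i, one_mul] at this
      exact this.trans (hR v hv)
    have hpos : (0 : ℝ) ≤ n / ‖b i‖ := by positivity
    have hbd : |inner ℝ (o i) v * (n / ‖b i‖)| ≤ (n : ℝ) ^ 2 / ‖b i‖ := by
      rw [abs_mul, abs_of_nonneg hpos]
      calc _ ≤ (n : ℝ) * (n / ‖b i‖) := by gcongr
        _ = _ := by ring
    rw [abs_le] at hbd
    have hc := Int.le_ceil ((n : ℝ) ^ 2 / ‖b i‖)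
    rw [mem_Icc]
    constructor
    · rw [hcell, Int.le_floor]
      push_cast
      simp only [hN]
      linarith [hbd.1]
    · have : ((cell v i : ℤ) : ℝ) ≤ N i := by
        simp only [hcell, hN]
        linarith [hbd.2, Int.floor_le (inner ℝ (o i) v * (n / ‖b i‖))]
      exact_mod_cast this
  -- If two points share a cell and `i₀` is the last nonzero coordinate of their difference, the
  -- components along `o j` vanish for `j > i₀` and are below `‖b i₀‖ / n` otherwise. The difference
  -- is then shorter than `b i₀`, against minimality.
  have hinj : Set.InjOn cell R := by
    intro v hv w hw hvw
    by_contra hne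
    have hw0 : v - w ≠ 0 := sub_ne_zero.2 hne
    -- the last nonzero coordinate
    have hsupp : (univ.filter fun i => b.repr (v - w) i ≠ 0).Nonempty := by
      by_contra hempty
      rw [not_nonempty_iff_eq_empty, filter_eq_empty_iff] at hempty
      apply hw0
      apply b.repr.injective
      ext i
      have := hempty (mem_univ i)
      push Not at this
      simpa using this
    set i₀ := (univ.filter fun i => b.repr (v - w) i ≠ 0).max' hsupp with hi₀
    have hi₀mem : b.repr (v - w) i₀ ≠ 0 := (mem_filter.1 (max'_mem _ hsupp)).2
    have hi₀max : ∀ i, i₀ < i → b.repr (v - w) i = 0 := by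
      intro i hi
      by_contra hcon
      exact absurd (le_max' _ i (mem_filter.2 ⟨mem_univ _, hcon⟩)) (not_le.2 hi)
    have hzero : ∀ j, i₀ < j → inner ℝ (o j) (v - w) = 0 := by
      intro j hj
      rw [← b.sum_repr (v - w), inner_sum]
      refine sum_eq_zero fun i _ => ?_
      rw [inner_smul_right]
      by_cases hij : i < j
      · rw [InnerProductSpace.gramSchmidtOrthonormalBasis_inv_triangular _ _ hij, mul_zero]
      · rw [hi₀max i (lt_of_lt_of_le hj (not_lt.1 hij)), zero_mul]
    have hlen : ‖b i₀‖ ≤ ‖v - w‖ := hmin v hv w hw i₀ hi₀mem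
    have hn0 : (0 : ℝ) < n := by
      have : 0 < n := i₀.pos
      exact_mod_cast this
    have hsmall : ∀ j, inner ℝ (o j) (v - w) ^ 2 < (‖b i₀‖ / n) ^ 2 := by
      intro j
      by_cases hj : i₀ < j
      · rw [hzero j hj, zero_pow two_ne_zero]
        have := hb0 i₀
        positivity
      have hjle : ‖b j‖ ≤ ‖b i₀‖ := hmono (not_lt.1 hj)
      have h2 := Int.abs_sub_lt_one_of_floor_eq_floor (congrFun hvw j)
      rw [← sub_mul, ← inner_sub_right, abs_mul,
        abs_of_pos (div_pos hn0 (hb0 j))] at h2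
      rw [← sq_abs (inner ℝ (o j) (v - w))]
      refine pow_lt_pow_left₀ ?_ (abs_nonneg _) (by norm_num)
      have h3 : |inner ℝ (o j) (v - w)| < ‖b j‖ / n := by
        rw [lt_div_iff₀ hn0]
        rw [← mul_div_assoc, div_lt_one (hb0 j)] at h2
        exact h2
      exact h3.trans_le (by gcongr)
    have hpars := o.sum_sq_norm_inner_right (v - w)
    have hlt : ∑ j, ‖inner ℝ (o j) (v - w)‖ ^ 2 < ∑ _j : Fin n, (‖b i₀‖ / n) ^ 2 := by
      refine sum_lt_sum_of_nonempty ⟨i₀, mem_univ _⟩ fun j _ => ?_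
      rw [Real.norm_eq_abs, sq_abs]
      exact hsmall j
    rw [hpars] at hlt
    simp only [sum_const, card_univ, Fintype.card_fin, nsmul_eq_mul] at hlt
    have h4 : (n : ℝ) * (‖b i₀‖ / n) ^ 2 ≤ ‖b i₀‖ ^ 2 := by
      have h5 : (1 : ℝ) ≤ n := by exact_mod_cast i₀.pos
      rw [div_pow]
      rw [← mul_div_assoc, div_le_iff₀ (by positivity)]
      have h7 : (n : ℝ) ≤ n ^ 2 := by nlinarith
      linarith [mul_le_mul_of_nonneg_right h7 (sq_nonneg ‖b i₀‖)]
    have h6 : ‖b i₀‖ ^ 2 ≤ ‖v - w‖ ^ 2 := by gcongr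
    linarith
  have hcard := card_le_card_of_injOn cell hmaps hinj
  rw [Fintype.card_piFinset] at hcard
  have hcard' : (#R : ℝ) ≤ ∏ i, (#(Icc (-N i) (N i)) : ℝ) := by exact_mod_cast hcard
  refine hcard'.trans (prod_le_prod (fun _ _ => by positivity) fun i _ => ?_)
  have hn1 : (1 : ℝ) ≤ n := by exact_mod_cast i.pos
  -- With `x = n ^ 2 / ‖b i‖ ≥ 1`, the count `2 * ⌈x⌉ + 1 < 2 * x + 3` is at most `5 * x`; this is
  -- the constant `5`.
  have hone : 1 ≤ (n : ℝ) ^ 2 / ‖b i‖ := by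
    rw [le_div_iff₀ (hb0 i)]
    nlinarith [h1 i]
  have hNn : 0 ≤ N i := Int.ceil_nonneg (by positivity)
  have hc := Int.ceil_lt_add_one ((n : ℝ) ^ 2 / ‖b i‖)
  have hcount : (#(Icc (-N i) (N i)) : ℝ) = 2 * N i + 1 := by
    rw [Int.card_Icc]
    have : (((N i + 1 - -N i).toNat : ℤ) : ℝ) = 2 * N i + 1 := by
      rw [Int.toNat_of_nonneg (by omega)]
      push_cast
      ring
    exact_mod_cast this
  rw [hcount]
  have : 5 * (n : ℝ) ^ 2 / ‖b i‖ = 5 * ((n : ℝ) ^ 2 / ‖b i‖) := by ring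
  rw [this]
  simp only [hN]
  linarith

end Minima

/-! ### From argument vectors to proper coset progressions. -/

section Geometry

/-- A finite spanning set in a real vector space of dimension `n` has independent differences
`u i` of controlled sizes `lam i` which account for its cardinality. -/
theorem exists_short_differences_of_span_eq_top {W : Type*} [AddCommGroup W] [Module ℝ W]
    [DecidableEq W] {Q : Finset W} (hzeroQ : 0 ∈ Q) {n : ℕ} (w : Module.Basis (Fin n) ℝ W)
    (hspan : Submodule.span ℝ (Q : Set W) = ⊤) (hwQ : ∀ i, w i ∈ Q)
    (hwrepr : ∀ v ∈ Q, ∀ i, |w.repr v i| ≤ 1) :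
    ∃ (u : Fin n → W) (lam : Fin n → ℝ), (∀ i, u i ∈ Q - Q) ∧ LinearIndependent ℝ u ∧
      (∀ i, 0 < lam i) ∧ (∀ i, lam i ≤ 1) ∧ (∀ i j, |w.repr (u i) j| ≤ lam i) ∧
      (#Q : ℝ) ≤ ∏ i, (5 * (n : ℝ) ^ 2 / lam i) := by
  classical
  obtain ⟨L, hLapp⟩ : ∃ L : W ≃ₗ[ℝ] EuclideanSpace ℝ (Fin n), ∀ v i, L v i = w.repr v i :=
    ⟨w.equivFun.trans (WithLp.linearEquiv 2 ℝ (Fin n → ℝ)).symm, fun _ _ => rfl⟩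
  obtain ⟨R, hR⟩ : ∃ R : Finset (EuclideanSpace ℝ (Fin n)), R = Q.image L := ⟨_, rfl⟩
  have hEn : Module.finrank ℝ (EuclideanSpace ℝ (Fin n)) = n := by simp
  have hzeroR : (0 : EuclideanSpace ℝ (Fin n)) ∈ R := by
    rw [hR]
    exact mem_image.2 ⟨0, hzeroQ, map_zero L⟩
  have hRspan : Submodule.span ℝ (R : Set (EuclideanSpace ℝ (Fin n))) = ⊤ := by
    rw [hR, coe_image]
    have := Submodule.map_span (L : W →ₗ[ℝ] EuclideanSpace ℝ (Fin n)) (Q : Set W)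
    rw [hspan] at this
    simp only [Submodule.map_top, LinearEquiv.range] at this
    exact this.symm
  obtain ⟨F, hF⟩ : ∃ F : Finset (EuclideanSpace ℝ (Fin n)), F = R - R := ⟨_, rfl⟩
  have hsubF : R ⊆ F := by
    intro v hv
    rw [hF]
    exact mem_sub.2 ⟨v, hv, 0, hzeroR, sub_zero v⟩
  have hFspan : Submodule.span ℝ (F : Set (EuclideanSpace ℝ (Fin n))) = ⊤ := by
    rw [← top_le_iff, ← hRspan]
    exact Submodule.span_mono (coe_subset.2 hsubF)
  obtain ⟨b, hbF, hmono, hmin⟩ := exists_basis_successive_minima hEn hFspan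
  have hb0 : ∀ i, 0 < ‖b i‖ := fun i => norm_pos_iff.2 (b.ne_zero i)
  have hLw : ∀ j, L (w j) = EuclideanSpace.single j (1 : ℝ) := by
    intro j
    ext i
    rw [hLapp, w.repr_self, Finsupp.single_apply]
    simp [eq_comm]
  -- The unit vectors `L (w j)` are themselves in `F`. Were `b i` longer than `1`, they would all
  -- have zero `i`-th coordinate, yet they span.
  have hb1 : ∀ i, ‖b i‖ ≤ 1 := by
    intro i
    by_contra! hgt
    have hall : ∀ j, b.coord i (L (w j)) = 0 := by
      intro j
      by_contra hne
      have h1 := hmin (L (w j)) (hsubF (by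
        rw [hR]
        exact mem_image_of_mem _ (hwQ j))) i hne
      rw [hLw] at h1
      simp at h1
      linarith
    have hzero : b.coord i = 0 := by
      refine (w.map L).ext fun j => ?_
      rw [Module.Basis.map_apply, hall j]
      simp
    have := congrArg (fun g => g (b i)) hzero
    simp at this
  have hRnorm : ∀ v ∈ R, ‖v‖ ≤ n := by
    intro v hv
    rw [hR] at hv
    obtain ⟨q, hq, rfl⟩ := mem_image.1 hv
    rw [EuclideanSpace.norm_eq]
    apply Real.sqrt_le_iff.2
    refine ⟨by positivity, ?_⟩
    calc ∑ i, ‖L q i‖ ^ 2 ≤ ∑ _i : Fin n, (1 : ℝ) := by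
          refine sum_le_sum fun i _ => ?_
          have := hwrepr q hq i
          rw [Real.norm_eq_abs, hLapp]
          exact pow_le_one₀ (abs_nonneg _) this
      _ = n := by simp
      _ ≤ (n : ℝ) ^ 2 := by exact_mod_cast Nat.le_self_pow two_ne_zero n
  have hcount := card_le_prod_of_successive_minima hEn hRnorm b hmono hb1
    (fun v hv u hu i hne => hmin (v - u) (hF ▸ sub_mem_sub hv hu) i hne)
  refine ⟨fun i => L.symm (b i), fun i => ‖b i‖, fun i => ?_, ?_, hb0, hb1, fun i j => ?_, ?_⟩
  · obtain ⟨u, hu, v, hv, huv⟩ := mem_sub.1 (hF ▸ hbF i)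
    rw [hR] at hu hv
    obtain ⟨u', hu', rfl⟩ := mem_image.1 hu
    obtain ⟨v', hv', rfl⟩ := mem_image.1 hv
    refine mem_sub.2 ⟨u', hu', v', hv', ?_⟩
    change u' - v' = L.symm (b i)
    rw [← huv, ← map_sub, LinearEquiv.symm_apply_apply]
  · exact b.linearIndependent.map' L.symm.toLinearMap (LinearEquiv.ker _)
  · rw [← hLapp, LinearEquiv.apply_symm_apply]
    exact PiLp.norm_apply_le (b i) j
  · rw [← card_image_of_injective Q L.injective, ← hR]
    exact hcount

/-- A finite set of vectors of sup norm at most `ρ` spanning a space of dimension `n` has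
independent differences `u i` of controlled sizes `lam i` which account for its cardinality. -/
theorem exists_short_differences {ι : Type*} [Fintype ι] {V : Finset (ι → ℝ)} (h0 : 0 ∈ V) {ρ : ℝ}
    (hρ : ∀ v ∈ V, ∀ k, |v k| ≤ ρ) {n : ℕ}
    (hn : Module.finrank ℝ (Submodule.span ℝ (V : Set (ι → ℝ))) = n) :
    ∃ (u : Fin n → ι → ℝ) (lam : Fin n → ℝ), (∀ i, u i ∈ V - V) ∧ LinearIndependent ℝ u ∧
      (∀ i, 0 < lam i) ∧ (∀ i, lam i ≤ 1) ∧ (∀ i k, |u i k| ≤ ρ * n * lam i) ∧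
      (#V : ℝ) ≤ ∏ i, (5 * (n : ℝ) ^ 2 / lam i) := by
  classical
  set W := Submodule.span ℝ (V : Set (ι → ℝ)) with hW
  set f : V → W := fun x => ⟨x, Submodule.subset_span x.2⟩ with hf
  set QW : Finset W := univ.image f with hQW
  have hspan : Submodule.span ℝ (QW : Set W) = ⊤ := by
    have : (QW : Set W) = (Subtype.val : W → ι → ℝ) ⁻¹' (V : Set (ι → ℝ)) := by
      ext w
      simp only [hQW, coe_image, coe_univ, Set.image_univ, Set.mem_range, Set.mem_preimage, hf]
      constructor
      · rintro ⟨x, rfl⟩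
        exact x.2
      · intro hx
        exact ⟨⟨w, hx⟩, Subtype.ext rfl⟩
    rw [this]
    exact Submodule.span_span_coe_preimage
  obtain ⟨w, hwQ, hwrepr⟩ := exists_basis_mem_abs_repr_le_one hn hspan
  have hzero : (0 : W) ∈ QW := mem_image.2 ⟨⟨0, h0⟩, mem_univ _, Subtype.ext rfl⟩
  obtain ⟨u, lam, huQ, hli, hlam0, hlam1, hrepr, hcount⟩ :=
    exists_short_differences_of_span_eq_top hzero w hspan hwQ hwrepr
  have hmem : ∀ q ∈ QW, (q : ι → ℝ) ∈ V := by
    intro q hq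
    obtain ⟨x, -, rfl⟩ := mem_image.1 hq
    exact x.2
  refine ⟨fun i => u i, lam, fun i => ?_, hli.map' W.subtype (Submodule.ker_subtype W), hlam0,
    hlam1, fun i k => ?_, ?_⟩
  · obtain ⟨x, hx, y, hy, hxy⟩ := mem_sub.1 (huQ i)
    exact mem_sub.2 ⟨x, hmem x hx, y, hmem y hy, congrArg Subtype.val hxy⟩
  · have e : (u i : ι → ℝ) k = ∑ j, w.repr (u i) j * (w j : ι → ℝ) k := by
      have e1 := congrArg (fun v : W => (v : ι → ℝ) k) (w.sum_repr (u i))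
      rw [← e1]
      simp only [Submodule.coe_sum, Finset.sum_apply, Submodule.coe_smul, Pi.smul_apply,
        smul_eq_mul]
    change |(u i : ι → ℝ) k| ≤ _
    rw [e]
    calc |∑ j, w.repr (u i) j * (w j : ι → ℝ) k| ≤ ∑ j, |w.repr (u i) j * (w j : ι → ℝ) k| :=
          abs_sum_le_sum_abs _ _
      _ ≤ ∑ _j : Fin n, lam i * ρ := by
          refine sum_le_sum fun j _ => ?_
          rw [abs_mul]
          exact mul_le_mul (hrepr i j) (hρ _ (hmem _ (hwQ j)) k) (abs_nonneg _) (hlam0 i).le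
      _ = _ := by
          simp
          ring
  · have hcardQ : #QW = #V := by
      have hinj : Function.Injective f := fun x y hxy =>
        Subtype.ext (congrArg (fun v : W => (v : ι → ℝ)) hxy)
      rw [hQW, card_image_of_injective _ hinj]
      simp
    rw [← hcardQ]
    exact hcount

variable {G : Type*} [AddCommGroup G]

/-- The vector of arguments of a family of characters at a point. -/
noncomputable def argLift {ι : Type*} (ω : ι → AddChar G ℂ) (x : G) : ι → ℝ :=
  fun k => (ω k x).arg

variable [Fintype G]

theorem exp_argLift {ι : Type*} (ω : ι → AddChar G ℂ) (x : G) (k : ι) :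
    Complex.exp (Complex.I * argLift ω x k) = ω k x := by
  have := Complex.norm_mul_exp_arg_mul_I (ω k x)
  rw [AddChar.norm_apply] at this
  rw [argLift, mul_comm]
  simpa using this

/-- Rigidity: a relation between angles modulo `2π` holds exactly over `ℝ` when the angles are
small. This turns identities in `G` into linear relations between lifts. -/
theorem eq_zero_of_exp_I_mul_eq_one {θ : ℝ} (h : Complex.exp (Complex.I * θ) = 1)
    (hθ : |θ| < 2 * Real.pi) : θ = 0 := by
  rw [Complex.exp_eq_one_iff] at h
  obtain ⟨m, hm⟩ := h
  have h1 : (θ : ℂ) = ((m * (2 * Real.pi) : ℝ) : ℂ) := by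
    have h2 : Complex.I * θ = Complex.I * ((m * (2 * Real.pi) : ℝ) : ℂ) := by
      rw [hm]
      push_cast
      ring
    exact mul_left_cancel₀ Complex.I_ne_zero h2
  have h3 : θ = m * (2 * Real.pi) := by exact_mod_cast h1
  have hm0 : m = 0 := by
    by_contra hne
    have h4 : (1 : ℝ) ≤ |(m : ℝ)| := by exact_mod_cast Int.one_le_abs hne
    rw [h3, abs_mul, abs_of_pos Real.two_pi_pos] at hθ
    nlinarith [Real.two_pi_pos]
  rw [h3, hm0]
  simp

/-- A finite set with short argument lifts spanning a space of dimension `n` is efficiently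
dominated by a proper symmetric coset progression of dimension `n` inside a Bohr set. -/
theorem exists_cosetProgression_of_argLift {ι : Type*} [Fintype ι] (ω : ι → AddChar G ℂ)
    {Q : Finset G} (h0 : 0 ∈ Q) {ρ : ℝ} (hρ : ∀ x ∈ Q, ∀ k, |argLift ω x k| ≤ ρ) {n : ℕ}
    (hn : Module.finrank ℝ (Submodule.span ℝ (argLift ω '' (Q : Set G))) = n)
    (hρn : ρ * n ^ 2 ≤ 1) :
    ∃ M : SymmCosetProgression G n, M.IsProper ∧
      (∀ x ∈ M.carrier, ∀ k, ‖ω k x - 1‖ ≤ ρ * n ^ 2) ∧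
      (#Q : ℝ) ≤ (5 * (n : ℝ) ^ 2) ^ n * (M.carrier.ncard : ℝ) := by
  classical
  set V : Finset (ι → ℝ) := Q.image (argLift ω) with hV
  rw [← coe_image] at hn
  have hV0 : (0 : ι → ℝ) ∈ V := by
    refine mem_image.2 ⟨0, h0, ?_⟩
    funext k
    simp [argLift]
  obtain ⟨u, lam, huV, hli, hlam0, hlam1, hubound, hcount⟩ :=
    exists_short_differences hV0 (ρ := ρ) (by
      intro v hv k
      obtain ⟨x, hx, rfl⟩ := mem_image.1 hv
      exact hρ x hx k) hn
  -- A difference of lifts of `x` and `y` gives the character values of `x - y`, whether or not it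
  -- is the principal lift of `x - y`.
  have hgen : ∀ i, ∃ x : G, ∀ k, ω k x = Complex.exp (Complex.I * u i k) := by
    intro i
    obtain ⟨p, hp, q, hq, hpq⟩ := mem_sub.1 (huV i)
    obtain ⟨x, -, rfl⟩ := mem_image.1 hp
    obtain ⟨y, -, rfl⟩ := mem_image.1 hq
    refine ⟨x - y, fun k => ?_⟩
    have e : u i = argLift ω x - argLift ω y := hpq.symm
    rw [e, Pi.sub_apply, AddChar.map_sub_eq_div, ← exp_argLift ω x k, ← exp_argLift ω y k,
      ← Complex.exp_sub]
    congr 1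
    push_cast
    ring
  choose g hg using hgen
  -- This length keeps `l i • u i` within `ρ * n`, hence the whole sum within `ρ * n ^ 2`, while `2
  -- * len i + 1` still exceeds `1 / lam i`.
  set len : Fin n → ℕ := fun i => ⌊1 / lam i⌋₊ with hlen
  have hlenpos : ∀ i, 0 < len i := by
    intro i
    refine Nat.floor_pos.2 ?_
    rw [le_div_iff₀ (hlam0 i), one_mul]
    exact hlam1 i
  set H : AddSubgroup G :=
    { carrier := {x | ∀ k, ω k x = 1}
      add_mem' := fun {x y} hx hy k => by rw [AddChar.map_add_eq_mul, hx k, hy k, mul_one]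
      zero_mem' := fun k => AddChar.map_zero_eq_one _
      neg_mem' := fun {x} hx k => by rw [AddChar.map_neg_eq_inv, hx k, inv_one] } with hH
  have hchar : ∀ h ∈ H, ∀ (l : Fin n → ℤ) k, ω k (h + ∑ i, l i • g i) =
      Complex.exp (Complex.I * ((∑ i, l i * u i k : ℝ) : ℂ)) := by
    intro h hh l k
    rw [AddChar.map_add_eq_mul, hh k, one_mul, AddChar.map_finsetSum]
    push_cast
    rw [mul_sum, Complex.exp_sum]
    refine prod_congr rfl fun i _ => ?_
    rw [AddChar.map_zsmul_eq_zpow, hg, ← Complex.exp_int_mul]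
    congr 1
    ring
  have hbound : ∀ l : Fin n → ℤ, (∀ i, |l i| ≤ (len i : ℤ)) → ∀ k,
      |∑ i, (l i : ℝ) * u i k| ≤ ρ * n ^ 2 := by
    intro l hl k
    by_cases hn0 : n = 0
    · subst hn0
      simp
    have hρ0 : 0 ≤ ρ := (abs_nonneg _).trans (hρ 0 h0 k)
    calc |∑ i, (l i : ℝ) * u i k| ≤ ∑ i, |(l i : ℝ) * u i k| := abs_sum_le_sum_abs _ _
      _ ≤ ∑ _i : Fin n, ρ * n := by
          refine sum_le_sum fun i _ => ?_
          rw [abs_mul]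
          have h1 : |(l i : ℝ)| ≤ 1 / lam i := by
            have h2 : |(l i : ℝ)| ≤ len i := by exact_mod_cast hl i
            exact h2.trans (Nat.floor_le (one_div_pos.2 (hlam0 i)).le)
          calc |(l i : ℝ)| * |u i k| ≤ 1 / lam i * (ρ * n * lam i) :=
                mul_le_mul h1 (hubound i k) (abs_nonneg _) (one_div_pos.2 (hlam0 i)).le
            _ = ρ * n := by
                have := (hlam0 i).ne'
                field_simp
      _ = _ := by
          simp
          ring
  have hproper : ∀ h ∈ H, ∀ h' ∈ H, ∀ l l' : Fin n → ℤ,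
      (∀ i, |l i| ≤ (len i : ℤ)) → (∀ i, |l' i| ≤ (len i : ℤ)) →
      h + ∑ i, l i • g i = h' + ∑ i, l' i • g i → h = h' ∧ l = l' := by
    intro h hh h' hh' l l' hl hl' heq
    -- Each coordinate is trivial modulo `2π` and at most `2` in size, hence zero; independence of
    -- the `u i` then gives `l = l'`.
    have hz : ∑ i, ((l i : ℝ) - l' i) • u i = 0 := by
      funext k
      have e : (∑ i, ((l i : ℝ) - l' i) • u i) k =
          ∑ i, (l i : ℝ) * u i k - ∑ i, (l' i : ℝ) * u i k := by
        simp only [Finset.sum_apply, Pi.smul_apply, smul_eq_mul, ← sum_sub_distrib, sub_mul]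
      rw [e, Pi.zero_apply]
      apply eq_zero_of_exp_I_mul_eq_one
      · have h1 := hchar h hh l k
        rw [heq, hchar h' hh' l' k] at h1
        rw [Complex.ofReal_sub, mul_sub, Complex.exp_sub, h1]
        exact div_self (Complex.exp_ne_zero _)
      · have h1 := hbound l hl k
        have h2 := hbound l' hl' k
        have h3 := abs_sub (∑ i, (l i : ℝ) * u i k) (∑ i, (l' i : ℝ) * u i k)
        linarith [Real.pi_gt_three]
    have hll : l = l' := by
      funext i
      have := Fintype.linearIndependent_iff.1 hli _ hz i
      have h2 : (l i : ℝ) = l' i := by linarith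
      exact_mod_cast h2
    subst hll
    exact ⟨add_right_cancel heq, rfl⟩
  refine ⟨⟨H, g, len, hlenpos⟩, hproper, ?_, ?_⟩
  · rintro x ⟨h, hh, l, hl, rfl⟩ k
    rw [hchar h hh l k]
    refine Real.norm_exp_I_mul_ofReal_sub_one_le.trans ?_
    rw [Real.norm_eq_abs]
    exact hbound l hl k
  · set M : SymmCosetProgression G n := ⟨H, g, len, hlenpos⟩ with hM
    set Hf : Finset G := univ.filter fun x => x ∈ H with hHf
    set box : Finset (Fin n → ℤ) := Fintype.piFinset fun i => Icc (-(len i : ℤ)) (len i) with hbox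
    have hboxcard : (#box : ℝ) = ∏ i, (2 * (len i : ℝ) + 1) := by
      rw [hbox, Fintype.card_piFinset, Nat.cast_prod]
      refine prod_congr rfl fun i _ => ?_
      rw [Int.card_Icc]
      have : ((len i : ℤ) + 1 - -(len i : ℤ)).toNat = 2 * len i + 1 := by omega
      rw [this]
      push_cast
      rfl
    have hmemc : #Hf * #box ≤ M.carrier.ncard := by
      rw [← card_product, ← card_image_of_injOn (f := fun p : G × (Fin n → ℤ) =>
        p.1 + ∑ i, p.2 i • g i) (s := Hf ×ˢ box), ← Set.ncard_coe_finset]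
      · refine Set.ncard_le_ncard ?_ (Set.toFinite _)
        intro x hx
        obtain ⟨p, hp, rfl⟩ := mem_image.1 (mem_coe.1 hx)
        rw [mem_product, hHf, mem_filter, hbox, Fintype.mem_piFinset] at hp
        exact ⟨p.1, hp.1.2, p.2, fun i => abs_le.2 (mem_Icc.1 (hp.2 i)), rfl⟩
      · intro p hp p' hp' hpp
        rw [mem_coe, mem_product, hHf, mem_filter, hbox, Fintype.mem_piFinset] at hp hp'
        obtain ⟨h1, h2⟩ := hproper p.1 hp.1.2 p'.1 hp'.1.2 p.2 p'.2
          (fun i => abs_le.2 (mem_Icc.1 (hp.2 i))) (fun i => abs_le.2 (mem_Icc.1 (hp'.2 i))) hpp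
        exact Prod.ext h1 h2
    -- Two points with the same lift differ by an element of the common kernel `H`.
    have hfib : #Q ≤ #Hf * #V := by
      refine card_le_mul_card_image Q #Hf fun v hv => ?_
      obtain ⟨x₀, -, rfl⟩ := mem_image.1 hv
      refine card_le_card_of_injOn (fun x => x - x₀) ?_ (fun a _ b _ h => sub_left_injective h)
      intro x hx
      rw [mem_coe, mem_filter] at hx
      rw [mem_coe, hHf, mem_filter]
      refine ⟨mem_univ _, fun k => ?_⟩
      rw [AddChar.map_sub_eq_div, ← exp_argLift ω x k, ← exp_argLift ω x₀ k, hx.2]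
      exact div_self (Complex.exp_ne_zero _)
    have h1 : ∀ i, 1 / lam i ≤ 2 * (len i : ℝ) + 1 := by
      intro i
      have := Nat.lt_floor_add_one (1 / lam i)
      have h2 : (0 : ℝ) ≤ len i := by positivity
      simp only [hlen] at *
      linarith
    calc (#Q : ℝ) ≤ #V * #Hf := by
          rw [mul_comm]
          exact_mod_cast hfib
      _ ≤ (∏ i, (5 * (n : ℝ) ^ 2 / lam i)) * #Hf := by gcongr
      _ = (∏ i, (5 * (n : ℝ) ^ 2) * (1 / lam i)) * #Hf := by
          congr 1
          exact prod_congr rfl fun i _ => by ring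
      _ ≤ (∏ i, (5 * (n : ℝ) ^ 2) * (2 * (len i : ℝ) + 1)) * #Hf := by
          refine mul_le_mul_of_nonneg_right (prod_le_prod (fun i _ => ?_) fun i _ => ?_)
            (by positivity)
          · exact mul_nonneg (by positivity) (one_div_pos.2 (hlam0 i)).le
          · exact mul_le_mul_of_nonneg_left (h1 i) (by positivity)
      _ = (5 * (n : ℝ) ^ 2) ^ n * (#Hf * #box) := by
          rw [prod_mul_distrib, hboxcard]
          simp
          ring
      _ ≤ _ := by
          gcongr
          exact_mod_cast hmemc

end Geometry

/-! ### Dimension of the lifts, and pigeonholing of characters. -/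

section Assembly

variable {G : Type*} [AddCommGroup G]

section Lifts

variable [Fintype G]

theorem argLift_eq_of_exp_eq {ι : Type*} {ω : ι → AddChar G ℂ} {x : G} {k : ι} {θ : ℝ}
    (h : Complex.exp (Complex.I * θ) = ω k x) (hθ : |θ| < Real.pi) : argLift ω x k = θ := by
  have h1 : argLift ω x k - θ = 0 := by
    apply eq_zero_of_exp_I_mul_eq_one
    · rw [Complex.ofReal_sub, mul_sub, Complex.exp_sub, exp_argLift, h]
      exact div_self (by rw [← h]; exact Complex.exp_ne_zero _)
    · have h2 : |argLift ω x k| ≤ Real.pi := Complex.abs_arg_le_pi _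
      have h3 := abs_sub (argLift ω x k) θ
      linarith
  linarith

theorem abs_argLift_le {ι : Type*} {ω : ι → AddChar G ℂ} {x : G} {k : ι} {ρ : ℝ}
    (h : ‖ω k x - 1‖ ≤ ρ) : |argLift ω x k| ≤ Real.pi / 2 * ρ := by
  have h0 : ω k x ≠ 0 := fun h0 => by
    have := AddChar.norm_apply (ω k) x
    rw [h0] at this
    simp at this
  have := Complex.angle_le_mul_norm_sub (AddChar.norm_apply (ω k) x) (norm_one (α := ℂ))
  rw [Complex.angle_one_right h0] at this
  refine this.trans ?_
  have := Real.pi_pos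
  gcongr

end Lifts

variable [DecidableEq G]

theorem sum_mem_nsmul_of_mem {B : Finset G} {M : ℕ} {u : Fin M → G} (hu : ∀ i, u i ∈ B) :
    ∑ i, u i ∈ M • B := by
  induction M with
  | zero => simp
  | succ M ih =>
    rw [Fin.sum_univ_succ, succ_nsmul']
    exact add_mem_add (hu 0) (ih fun i => hu i.succ)

/-- Almost periods add up along iterated sumsets of the difference set. -/
theorem abs_sub_le_of_mem_nsmul {f : G → ℝ} {X : Finset G} {κ : ℝ}
    (hper : ∀ t ∈ X, ∀ t' ∈ X, ∀ z, |f (z + t) - f (z + t')| ≤ κ) (j : ℕ) :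
    ∀ y ∈ j • (X - X), ∀ z, |f (z + y) - f z| ≤ j * κ := by
  induction j with
  | zero =>
    intro y hy z
    simp at hy
    simp [hy]
  | succ j ih =>
    intro y hy z
    rw [succ_nsmul] at hy
    obtain ⟨a, ha, b, hb, rfl⟩ := mem_add.1 hy
    obtain ⟨t, ht, t', ht', rfl⟩ := mem_sub.1 hb
    have h1 := ih a ha z
    have h2 := hper t ht t' ht' (z + a - t')
    have e1 : z + a - t' + t = z + (a + (t - t')) := by abel
    have e2 : z + a - t' + t' = z + a := by abel
    rw [e1, e2] at h2
    push_cast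
    rw [abs_le] at *
    constructor <;> linarith [h1.1, h1.2, h2.1, h2.2]

variable [Fintype G]

/-- If `3P ⊆ 2P + Span τ`, the argument lifts of a small set `P` lie in the span of those of `τ`. -/
theorem argLift_mem_span_of_covering {ι : Type*} {ω : ι → AddChar G ℂ} {P : Finset G} {r : ℕ}
    {τ : Fin r → G} (hτ : ∀ i, τ i ∈ 3 • P) (hcov : 3 • P ⊆ 2 • P + boxSpan τ 1) {a : ℝ}
    (ha0 : 0 ≤ a) (ha : ∀ x ∈ P, ∀ k, |argLift ω x k| ≤ a) (har : (3 * r + 6) * a < 2 * Real.pi)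
    {x : G} (hx : x ∈ P) :
    argLift ω x ∈ Submodule.span ℝ (Set.range fun i => argLift ω (τ i)) := by
  have h3a : 3 * a < Real.pi := by
    have : 0 ≤ (r : ℝ) * a := by positivity
    linarith
  have hτbound : ∀ i k, |argLift ω (τ i) k| ≤ 3 * a := by
    intro i k
    have h3 := hτ i
    have e3 : 3 • P = P + P + P := by rw [succ_nsmul, two_nsmul]
    rw [e3] at h3
    obtain ⟨y, hy, p3, hp3, hy3⟩ := mem_add.1 h3
    obtain ⟨p1, hp1, p2, hp2, rfl⟩ := mem_add.1 hy
    have hb : |argLift ω p1 k + argLift ω p2 k + argLift ω p3 k| ≤ 3 * a := by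
      refine (abs_add_three _ _ _).trans ?_
      linarith [ha p1 hp1 k, ha p2 hp2 k, ha p3 hp3 k]
    rw [argLift_eq_of_exp_eq (θ := argLift ω p1 k + argLift ω p2 k + argLift ω p3 k) ?_
      (by linarith)]
    · exact hb
    · rw [← hy3, AddChar.map_add_eq_mul, AddChar.map_add_eq_mul, ← exp_argLift ω p1,
        ← exp_argLift ω p2, ← exp_argLift ω p3, ← Complex.exp_add, ← Complex.exp_add]
      congr 1
      push_cast
      ring
  -- The covering writes `3x = p + q + ∑ c i • τ i`. The angles involved total at most `(3r + 5) * a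
  -- < 2π`, so the relation lifts to `ℝ`.
  have hrel : ∀ x ∈ P, ∃ p ∈ P, ∃ q ∈ P, ∃ c : Fin r → ℤ,
      (3 : ℝ) • argLift ω x = argLift ω p + argLift ω q + ∑ i, (c i : ℝ) • argLift ω (τ i) := by
    intro x hx
    have h3x : 3 • x ∈ 3 • P := nsmul_mem_nsmul hx
    obtain ⟨y, hy, z, hz, hyz⟩ := mem_add.1 (hcov h3x)
    rw [two_nsmul] at hy
    obtain ⟨p, hp, q, hq, rfl⟩ := mem_add.1 hy
    obtain ⟨c, hc, rfl⟩ := mem_boxSpan.1 hz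
    refine ⟨p, hp, q, hq, c, ?_⟩
    funext k
    set θ : ℝ := 3 * argLift ω x k - (argLift ω p k + argLift ω q k +
      ∑ i, (c i : ℝ) * argLift ω (τ i) k) with hθ
    have hsum : |∑ i, (c i : ℝ) * argLift ω (τ i) k| ≤ r * (3 * a) := by
      calc |∑ i, (c i : ℝ) * argLift ω (τ i) k| ≤ ∑ i, |(c i : ℝ) * argLift ω (τ i) k| :=
            abs_sum_le_sum_abs _ _
        _ ≤ ∑ _i : Fin r, 3 * a := by
            refine sum_le_sum fun i _ => ?_
            rw [abs_mul]
            have h1 : |(c i : ℝ)| ≤ 1 := by exact_mod_cast hc i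
            calc |(c i : ℝ)| * |argLift ω (τ i) k| ≤ 1 * (3 * a) :=
                  mul_le_mul h1 (hτbound i k) (abs_nonneg _) zero_le_one
              _ = 3 * a := one_mul _
        _ = _ := by simp
    have hθ0 : θ = 0 := by
      apply eq_zero_of_exp_I_mul_eq_one
      · have hl : Complex.exp (Complex.I * ((3 * argLift ω x k : ℝ) : ℂ)) = ω k (3 • x) := by
          rw [AddChar.map_nsmul_eq_pow, ← exp_argLift ω x k, ← Complex.exp_nat_mul]
          congr 1
          push_cast
          ring
        have hr : Complex.exp (Complex.I * ((argLift ω p k + argLift ω q k +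
            ∑ i, (c i : ℝ) * argLift ω (τ i) k : ℝ) : ℂ)) = ω k (3 • x) := by
          rw [← hyz, AddChar.map_add_eq_mul, AddChar.map_add_eq_mul, AddChar.map_finsetSum,
            ← exp_argLift ω p k, ← exp_argLift ω q k, ← Complex.exp_add]
          push_cast
          rw [mul_add, mul_add, Complex.exp_add, mul_sum, Complex.exp_sum]
          congr 1
          refine prod_congr rfl fun i _ => ?_
          rw [AddChar.map_zsmul_eq_zpow, ← exp_argLift ω (τ i) k, ← Complex.exp_int_mul]
          congr 1
          ring
        rw [hθ, Complex.ofReal_sub, mul_sub, Complex.exp_sub, hl, hr]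
        exact div_self (by rw [← hl]; exact Complex.exp_ne_zero _)
      · have h1 := abs_le.1 (ha x hx k)
        have h2 := abs_le.1 (ha p hp k)
        have h3 := abs_le.1 (ha q hq k)
        have h4 := abs_le.1 hsum
        rw [abs_lt]
        constructor <;> nlinarith [h1.1, h1.2, h2.1, h2.2, h3.1, h3.2, h4.1, h4.2]
    simp only [Pi.add_apply, Pi.smul_apply, smul_eq_mul, Finset.sum_apply]
    linarith
  by_contra hnot
  obtain ⟨f, hfx, hfS⟩ := Submodule.exists_le_ker_of_notMem hnot
  have hfτ : ∀ i, f (argLift ω (τ i)) = 0 := fun i =>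
    LinearMap.mem_ker.1 (hfS (Submodule.subset_span ⟨i, rfl⟩))
  -- A functional vanishing on the lifts of `τ` satisfies `3 f(x₁) = f(p) + f(q)`. At a point
  -- maximising `|f|` this forces `f = 0` on the lifts of `P`.
  obtain ⟨x₁, hx₁, hmax⟩ := exists_max_image P (fun y => |f (argLift ω y)|) ⟨x, hx⟩
  obtain ⟨p, hp, q, hq, c, hpq⟩ := hrel x₁ hx₁
  have h1 := congrArg f hpq
  rw [map_smul, map_add, map_add, map_sum] at h1
  simp only [map_smul, hfτ, mul_zero, sum_const_zero, add_zero, smul_eq_mul] at h1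
  have h2 : 3 * |f (argLift ω x₁)| = |f (argLift ω p) + f (argLift ω q)| := by
    rw [← h1, abs_mul]
    norm_num
  have h3 := abs_add_le (f (argLift ω p)) (f (argLift ω q))
  have h4 := hmax p hp
  have h5 := hmax q hq
  have h6 := hmax x hx
  have h7 : 0 < |f (argLift ω x)| := abs_pos.2 hfx
  linarith

/-- A large subset of `P`, translated to contain `0`, on which finitely many characters are
nearly trivial. -/
theorem exists_subset_nearly_trivial {P : Finset G} (hP : P.Nonempty) {r : ℕ}
    (τ : Fin r → AddChar G ℂ) {N : ℕ} (hN : N ≠ 0) :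
    ∃ Q : Finset G, 0 ∈ Q ∧ (#P : ℝ) ≤ (N + 1) ^ r * #Q ∧
      (∃ p₀ ∈ P, ∀ x ∈ Q, x + p₀ ∈ P) ∧
      ∀ x ∈ Q, ∀ i, ‖τ i x - 1‖ ≤ 2 * Real.pi / N := by
  have hN0 : (0 : ℝ) < N := by exact_mod_cast Nat.pos_of_ne_zero hN
  have hpi := Real.pi_pos
  -- The circle is cut into `N` arcs. The argument `π` falls into an extra cell with index `N`,
  -- hence `N + 1` values.
  set cell : G → Fin r → ℕ := fun x i =>
    ⌊((τ i x).arg + Real.pi) * (N / (2 * Real.pi))⌋₊ with hcell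
  have hnn : ∀ x i, 0 ≤ ((τ i x).arg + Real.pi) * (N / (2 * Real.pi)) := by
    intro x i
    have := (Complex.arg_mem_Ioc (τ i x)).1
    exact mul_nonneg (by linarith) (by positivity)
  have hmaps : ∀ x ∈ P, cell x ∈ Fintype.piFinset fun _ : Fin r => range (N + 1) := by
    intro x _
    rw [Fintype.mem_piFinset]
    intro i
    rw [mem_range, Nat.lt_succ_iff]
    have h1 : ((τ i x).arg + Real.pi) * (N / (2 * Real.pi)) ≤ N := by
      have := (Complex.arg_mem_Ioc (τ i x)).2
      calc _ ≤ (Real.pi + Real.pi) * (N / (2 * Real.pi)) := by gcongr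
        _ = N := by field_simp; ring
    exact Nat.floor_le_of_le h1
  have hcard : #(Fintype.piFinset fun _ : Fin r => range (N + 1)) = (N + 1) ^ r := by
    rw [Fintype.card_piFinset]
    simp
  obtain ⟨y, -, hy⟩ := exists_le_card_fiber_of_nsmul_le_card_of_maps_to
    (b := (#P : ℝ) / (N + 1) ^ r) hmaps
    (card_pos.1 (by rw [hcard]; positivity)) (by
      rw [nsmul_eq_mul, hcard]
      push_cast
      rw [mul_div_cancel₀ _ (by positivity)])
  set P₁ := P.filter fun x => cell x = y with hP₁
  have hP₁card : (#P : ℝ) ≤ (N + 1) ^ r * #P₁ := by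
    rw [div_le_iff₀ (by positivity)] at hy
    linarith
  have hP₁ne : P₁.Nonempty := by
    rw [nonempty_iff_ne_empty]
    intro h
    rw [h] at hP₁card
    simp at hP₁card
    exact hP.ne_empty hP₁card
  obtain ⟨p₀, hp₀⟩ := hP₁ne
  refine ⟨P₁.image fun x => x - p₀, mem_image.2 ⟨p₀, hp₀, sub_self _⟩, ?_,
    ⟨p₀, (mem_filter.1 hp₀).1, ?_⟩, ?_⟩
  · rwa [card_image_of_injective _ sub_left_injective]
  · intro x hx
    obtain ⟨p, hp, rfl⟩ := mem_image.1 hx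
    rw [sub_add_cancel]
    exact (mem_filter.1 hp).1
  · intro x hx i
    obtain ⟨p, hp, rfl⟩ := mem_image.1 hx
    have hc : cell p i = cell p₀ i := by rw [(mem_filter.1 hp).2, (mem_filter.1 hp₀).2]
    have h1 : |((τ i p).arg + Real.pi) * (N / (2 * Real.pi)) -
        ((τ i p₀).arg + Real.pi) * (N / (2 * Real.pi))| < 1 := by
      have a1 := Nat.floor_le (hnn p i)
      have a2 := Nat.lt_floor_add_one (((τ i p).arg + Real.pi) * (N / (2 * Real.pi)))
      have a3 := Nat.floor_le (hnn p₀ i)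
      have a4 := Nat.lt_floor_add_one (((τ i p₀).arg + Real.pi) * (N / (2 * Real.pi)))
      simp only [hcell] at hc
      rw [hc] at a1 a2
      rw [abs_lt]
      constructor <;> linarith
    have h2 : |(τ i p).arg - (τ i p₀).arg| ≤ 2 * Real.pi / N := by
      have e : ((τ i p).arg + Real.pi) * (N / (2 * Real.pi)) -
        ((τ i p₀).arg + Real.pi) * (N / (2 * Real.pi)) =
          ((τ i p).arg - (τ i p₀).arg) * (N / (2 * Real.pi)) := by ring
      rw [e, abs_mul, abs_of_pos (by positivity : (0 : ℝ) < N / (2 * Real.pi))] at h1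
      rw [le_div_iff₀ hN0]
      rw [← mul_div_assoc, div_lt_one (by positivity)] at h1
      exact h1.le
    have h3 : τ i (p - p₀) = Complex.exp (Complex.I * (((τ i p).arg - (τ i p₀).arg : ℝ) : ℂ)) := by
      have e1 : Complex.exp (Complex.I * ((τ i p).arg : ℂ)) = τ i p := exp_argLift τ p i
      have e2 : Complex.exp (Complex.I * ((τ i p₀).arg : ℂ)) = τ i p₀ := exp_argLift τ p₀ i
      rw [AddChar.map_sub_eq_div, Complex.ofReal_sub, mul_sub, Complex.exp_sub, e1, e2]
    rw [h3]
    refine Real.norm_exp_I_mul_ofReal_sub_one_le.trans ?_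
    rwa [Real.norm_eq_abs]

/-- Dimension of the span of lifts indexed by a sum type. -/
theorem finrank_span_le_of_inr_mem {r : ℕ} {κ : Type*} [Fintype κ] {V : Set (Fin r ⊕ κ → ℝ)}
    {S : Submodule ℝ (κ → ℝ)} {m : ℕ} (hS : Module.finrank ℝ S ≤ m)
    (hV : ∀ v ∈ V, (fun k => v (Sum.inr k)) ∈ S) :
    Module.finrank ℝ (Submodule.span ℝ V) ≤ r + m := by
  set p : (Fin r ⊕ κ → ℝ) →ₗ[ℝ] (κ → ℝ) := LinearMap.funLeft ℝ ℝ Sum.inr with hp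
  set l : (Fin r ⊕ κ → ℝ) →ₗ[ℝ] (Fin r → ℝ) := LinearMap.funLeft ℝ ℝ Sum.inl with hl
  have hle : Submodule.span ℝ V ≤ S.comap p := Submodule.span_le.2 fun v hv => hV v hv
  set φ : Submodule.span ℝ V →ₗ[ℝ] (Fin r → ℝ) × S :=
    (l.comp (Submodule.subtype _)).prod
      ((p.comp (Submodule.subtype _)).codRestrict S fun v => hle v.2) with hφ
  have hinj : Function.Injective φ := by
    intro v w hvw
    have h1 := congrArg Prod.fst hvw
    have h2 := congrArg (fun z => ((Prod.snd z : S) : κ → ℝ)) hvw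
    apply Subtype.ext
    funext k
    cases k with
    | inl k => exact congrFun h1 k
    | inr k => exact congrFun h2 k
  refine (LinearMap.finrank_le_finrank_of_injective hinj).trans ?_
  rw [Module.finrank_prod]
  simpa using hS

end Assembly

/-! ### The theorem in a finite group with explicit parameters. -/

section FiniteCore

variable {G : Type*} [AddCommGroup G] [DecidableEq G]

section

variable [Fintype G]

/-- If `P` is covered economically by translates of itself and nearly annihilated by the large
spectrum of `U`, then a large proper coset progression is nearly annihilated by every character
generated by `τ` and that spectrum. -/
theorem exists_cosetProgression_of_spectrum {P U : Finset G} (h0 : 0 ∈ P)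
    (hU : U.Nonempty) {Nc : ℕ} (hNc : Nc ≠ 0)
    (hV : (#(P + U) : ℝ) ≤ (1 + 1 / (2 * Nc)) * #U) {r r₂ : ℕ} (τ : Fin r → AddChar G ℂ)
    {σ : Fin r₂ → G} (hσ : ∀ i, σ i ∈ 3 • P) (hcov : 3 • P ⊆ 2 • P + boxSpan σ 1)
    (hNc' : (3 * r₂ + 6 : ℝ) < 2 * Nc) (hdim : 10 * ((r + r₂ : ℕ) : ℝ) ^ 2 ≤ Nc) :
    ∃ (s : ℕ) (M : SymmCosetProgression G s), s ≤ r + r₂ ∧ M.IsProper ∧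
      (∀ x ∈ M.carrier, (∀ i, ‖τ i x - 1‖ ≤ 10 / Nc * (r + r₂ : ℕ) ^ 2) ∧
        ∀ ψ : AddChar G ℂ, 1 / 2 ≤ ‖charMean U ψ‖ → ‖ψ x - 1‖ ≤ 10 / Nc * (r + r₂ : ℕ) ^ 2) ∧
      (#P : ℝ) ≤ (Nc + 1) ^ r * (5 * ((r + r₂ : ℕ) : ℝ) ^ 2 + 1) ^ (r + r₂) *
        (M.carrier.ncard : ℝ) := by
  classical
  have hNc0 : (0 : ℝ) < Nc := by exact_mod_cast Nat.pos_of_ne_zero hNc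
  have hpi := Real.pi_pos
  have hpi3 := Real.pi_gt_three
  have hpi4 := Real.pi_lt_d2
  set ψ : {γ : AddChar G ℂ // 1 / 2 ≤ ‖charMean U γ‖} → AddChar G ℂ := Subtype.val with hψ
  have hPψ : ∀ x ∈ P, ∀ k, ‖ψ k x - 1‖ ≤ 2 / Nc := by
    intro x hx k
    have := norm_sub_one_le_of_nearly_invariant (V := P + U) (x := x) hU
      (fun u hu => mem_add.2 ⟨0, h0, u, hu, zero_add u⟩)
      (fun v hv => by
        obtain ⟨u, hu, rfl⟩ := mem_vadd_finset.1 hv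
        exact add_mem_add hx hu) hV k.2
    refine this.trans (le_of_eq ?_)
    field_simp
    norm_num
  have hPlift : ∀ x ∈ P, ∀ k, |argLift ψ x k| ≤ Real.pi / Nc := by
    intro x hx k
    refine (abs_argLift_le (hPψ x hx k)).trans (le_of_eq ?_)
    field_simp
  have hspan := fun x (hx : x ∈ P) => argLift_mem_span_of_covering (ω := ψ) hσ hcov
    (by positivity : 0 ≤ Real.pi / Nc) hPlift
    (by rw [← mul_div_assoc, div_lt_iff₀ hNc0]; nlinarith) hx
  obtain ⟨Q, hQ0, hPQ, ⟨p₀, hp₀, hQP⟩, hQτ⟩ := exists_subset_nearly_trivial ⟨0, h0⟩ τ hNc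
  have hNc3 : (3 : ℝ) < Nc := by
    have : (0 : ℝ) ≤ r₂ := by positivity
    linarith
  have hQψ : ∀ x ∈ Q, argLift ψ x = argLift ψ (x + p₀) - argLift ψ p₀ := by
    intro x hx
    funext k
    apply argLift_eq_of_exp_eq
    · have hne : ψ k p₀ ≠ 0 := fun h => by
        have := AddChar.norm_apply (ψ k) p₀
        rw [h] at this
        simp at this
      rw [Pi.sub_apply, Complex.ofReal_sub, mul_sub, Complex.exp_sub, exp_argLift, exp_argLift,
        AddChar.map_add_eq_mul]
      field_simp
    · have h1 := hPlift _ (hQP x hx) k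
      have h2 := hPlift _ hp₀ k
      have h3 := abs_sub (argLift ψ (x + p₀) k) (argLift ψ p₀ k)
      have h4 : Real.pi / Nc < Real.pi / 2 := by gcongr; linarith
      simp only [Pi.sub_apply]
      linarith
  -- Both kinds of characters are lifted together. The first block adds at most `r` dimensions; the
  -- second, whatever its size, at most `r₂`.
  set ω : Fin r ⊕ {γ : AddChar G ℂ // 1 / 2 ≤ ‖charMean U γ‖} → AddChar G ℂ := Sum.elim τ ψ with hω
  -- The constant `10` covers `π ^ 2` for the pigeonholed characters and `2π` for those from the
  -- spectrum of `U`.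
  have hQω : ∀ x ∈ Q, ∀ k, |argLift ω x k| ≤ 10 / Nc := by
    intro x hx k
    cases k with
    | inl i =>
      have := abs_argLift_le (ω := ω) (k := Sum.inl i) (hQτ x hx i)
      refine this.trans ?_
      rw [← mul_div_assoc]
      gcongr
      nlinarith
    | inr k =>
      have h1 := hPlift _ (hQP x hx) k
      have h2 := hPlift _ hp₀ k
      have h3 := abs_sub (argLift ψ (x + p₀) k) (argLift ψ p₀ k)
      have h4 : argLift ω x (Sum.inr k) = argLift ψ (x + p₀) k - argLift ψ p₀ k :=
        congrFun (hQψ x hx) k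
      rw [h4]
      have h5 : 2 * (Real.pi / Nc) ≤ 10 / Nc := by
        rw [← mul_div_assoc]
        gcongr
        linarith
      linarith
  have hfin : Module.finrank ℝ (Submodule.span ℝ (argLift ω '' (Q : Set G))) ≤ r + r₂ := by
    apply finrank_span_le_of_inr_mem
      (S := Submodule.span ℝ (Set.range fun i => argLift ψ (σ i)))
    · exact (finrank_range_le_card _).trans (by simp)
    · rintro v ⟨x, hx, rfl⟩
      have : (fun k => argLift ω x (Sum.inr k)) = argLift ψ x := rfl
      rw [this, hQψ x hx]
      exact Submodule.sub_mem _ (hspan _ (hQP x hx)) (hspan _ hp₀)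
  set s := Module.finrank ℝ (Submodule.span ℝ (argLift ω '' (Q : Set G))) with hs
  have hsr : (s : ℝ) ≤ (r + r₂ : ℕ) := by exact_mod_cast hfin
  have hρs : 10 / (Nc : ℝ) * (s : ℝ) ^ 2 ≤ 10 / Nc * ((r + r₂ : ℕ) : ℝ) ^ 2 := by gcongr
  obtain ⟨M, hM, hMω, hMQ⟩ := exists_cosetProgression_of_argLift ω hQ0 hQω hs.symm
    (hρs.trans (by rw [div_mul_eq_mul_div, div_le_one hNc0]; exact hdim))
  refine ⟨s, M, hfin, hM, fun x hx => ⟨fun i => (hMω x hx (Sum.inl i)).trans hρs,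
    fun γ hγ => (hMω x hx (Sum.inr ⟨γ, hγ⟩)).trans hρs⟩, hPQ.trans ?_⟩
  rw [mul_assoc]
  gcongr
  refine hMQ.trans ?_
  gcongr
  calc (5 * (s : ℝ) ^ 2) ^ s ≤ (5 * ((r + r₂ : ℕ) : ℝ) ^ 2 + 1) ^ s := by
        gcongr
        have : (s : ℝ) ^ 2 ≤ ((r + r₂ : ℕ) : ℝ) ^ 2 := by gcongr
        linarith
    _ ≤ _ := pow_le_pow_right₀ (by nlinarith [sq_nonneg ((r + r₂ : ℕ) : ℝ)]) hfin

end

/-- Almost periods whose iterated difference sets stay inside `(A + S) - (A + S)`. -/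
theorem exists_almost_periods_nsmul_subset {A S : Finset G} (hA : A.Nonempty) (hS : S.Nonempty)
    {K μ : ℝ} (hK : 1 ≤ K) (h1 : (#(A + S) : ℝ) ≤ K * #A) (h2 : (#(A + S) : ℝ) ≤ K * #S)
    (hμ : 0 < μ) {n N : ℕ} (hn : n ≠ 0) (hN : N ≠ 0)
    (hCS : 2 * ((Real.log (1 + 4 * K ^ 15) + μ ^ 2 / (2 * n)) / μ) ≤ 1 / (4 * N)) :
    ∃ X : Finset G, 0 ∈ X ∧ (#S : ℝ) ≤ 2 * K ^ n * #X ∧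
      (∀ t ∈ X, ∀ t' ∈ X, ∀ z,
        |hitFreq A S (A + S) (z + t) - hitFreq A S (A + S) (z + t')| ≤ 1 / (4 * N)) ∧
      N • (X - X) ⊆ (A + S) - (A + S) := by
  have hN0 : (0 : ℝ) < N := by exact_mod_cast Nat.pos_of_ne_zero hN
  -- This set contains every `y` for which `y + a` can hit `A + S`; subtracting one `s ∈ S` embeds
  -- it in `(A + S) - (A + S)`.
  have hY : (#((A + S) - A) : ℝ) ≤ K ^ 15 * #S := by
    obtain ⟨s, hs⟩ := hS
    have hle : #((A + S) - A) ≤ #((A + S) - (A + S)) := by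
      apply card_le_card_of_injOn (fun y => y - s)
      · intro y hy
        obtain ⟨b, hb, a, ha, rfl⟩ := mem_sub.1 hy
        exact mem_sub.2 ⟨b, hb, a + s, add_mem_add ha hs, by simp only; abel⟩
      · intro y _ y' _ h
        simpa using h
    have := card_nsmul_sub_le_pow_mul hA ⟨s, hs⟩ hK h1 h2 one_ne_zero
    rw [one_nsmul] at this
    refine le_trans (by exact_mod_cast hle) this
  obtain ⟨X, hX0, hX1, hX2⟩ := exists_almost_periods (E := A + S) hA hS h1
    (fun y a ha hya => mem_sub.2 ⟨_, hya, a, ha, by abel⟩) hY hμ hn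
  have hper := fun t ht t' ht' z => (hX2 t ht t' ht' z).trans hCS
  refine ⟨X, hX0, hX1, hper, fun y hy => mem_of_hitFreq_ne_zero fun hzero => ?_⟩
  have := abs_sub_le_of_mem_nsmul hper N y hy 0
  rw [zero_add, hzero, hitFreq_zero hA hS] at this
  have h3 : (N : ℝ) * (1 / (4 * N)) = 1 / 4 := by field_simp
  rw [h3] at this
  norm_num at this

/-- The finite case, with explicit parameters. -/
theorem exists_cosetProgression_of_finite [Fintype G] {A S : Finset G} (hA : A.Nonempty) (hS : S.Nonempty)
    {K μ : ℝ} (hK : 1 ≤ K) (h1 : (#(A + S) : ℝ) ≤ K * #A) (h2 : (#(A + S) : ℝ) ≤ K * #S)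
    (hμ : 0 < μ) {n N m J tb Nc : ℕ} (hn : n ≠ 0) (hN : N ≠ 0)
    (hCS : 2 * ((Real.log (1 + 4 * K ^ 15) + μ ^ 2 / (2 * n)) / μ) ≤ 1 / (4 * N))
    (hKN : 16 * K ≤ 4 ^ N) (hm : 2 * K ^ (16 * n) < 2 ^ m) (hmn : 3 * m + 1 ≤ n * N)
    (hJ : J ≠ 0) (hJm : (4 * J : ℝ) ^ m < (1 + 1 / (2 * Nc)) ^ J)
    (htb : 8 * Real.log (2 * (8 * (tb + 1) * J) ^ m) < tb + 1)
    (hNc : 80 * K * (tb + m + 1) ^ 3 ≤ Nc) :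
    ∃ (s : ℕ) (M : SymmCosetProgression G s), s ≤ tb + m ∧ M.IsProper ∧
      M.carrier ⊆ (((A + S) - (A + S) : Finset G) : Set G) ∧
      (#(A + S) : ℝ) ≤ 2 * K ^ (n + 1) * (Nc + 1) ^ tb *
        (5 * ((tb + m : ℕ) : ℝ) ^ 2 + 1) ^ (tb + m) * (M.carrier.ncard : ℝ) := by
  have hK0 : 0 < K := by linarith
  have hNcpos : (80 : ℝ) ≤ Nc := by
    refine le_trans ?_ hNc
    have : (1 : ℝ) ≤ (tb + m + 1) ^ 3 := one_le_pow₀ (by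
      have : (0 : ℝ) ≤ tb + m := by positivity
      linarith)
    nlinarith
  have hNc0 : Nc ≠ 0 := by rintro rfl; norm_num at hNcpos
  have hNcp : (0 : ℝ) < Nc := by linarith
  have hm0 : m ≠ 0 := by
    rintro rfl
    have : 1 ≤ K ^ (16 * n) := one_le_pow₀ hK
    norm_num at hm
    linarith
  obtain ⟨X, hX0, hSX, hper, hND⟩ :=
    exists_almost_periods_nsmul_subset hA hS hK h1 h2 hμ hn hN hCS
  have hXne : X.Nonempty := ⟨0, hX0⟩
  have hX0' : (0 : ℝ) < #X := by exact_mod_cast hXne.card_pos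
  set P := X - X with hP
  have hP0 : 0 ∈ P := mem_sub.2 ⟨0, hX0, 0, hX0, sub_zero 0⟩
  have hPsym : -P = P := by rw [hP, neg_sub]
  have hXP : X ⊆ P := fun x hx => mem_sub.2 ⟨x, hx, 0, hX0, sub_zero x⟩
  have hXPc : (#X : ℝ) ≤ #P := by exact_mod_cast card_le_card hXP
  -- Since `N • P ⊆ D` and `3 * m + 1 ≤ n * N`, the multiple sits in `n • D`, of size at most `K ^
  -- (15 * n) * |S| ≤ 2 * K ^ (16 * n) * |X|`.
  have hgrow : (#((3 * m + 1) • P) : ℝ) < 2 ^ m * #X := by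
    have e1 : #((3 * m + 1) • P) ≤ #(n • ((A + S) - (A + S))) := by
      apply card_le_card
      refine (nsmul_subset_nsmul_of_le hP0 hmn).trans ?_
      rw [mul_comm, mul_nsmul]
      exact nsmul_subset_nsmul_left hND
    calc (#((3 * m + 1) • P) : ℝ) ≤ #(n • ((A + S) - (A + S))) := by exact_mod_cast e1
      _ ≤ K ^ (15 * n) * #S := card_nsmul_sub_le_pow_mul hA hS hK h1 h2 hn
      _ ≤ K ^ (15 * n) * (2 * K ^ n * #X) := by gcongr
      _ = 2 * K ^ (16 * n) * #X := by ring
      _ < 2 ^ m * #X := by gcongr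
  obtain ⟨r₂, hr₂, σ, hσ, hcov⟩ := chang_covering (m := m) hP0 hPsym (by
    have : (#((3 * m + 1) • P) : ℝ) < 2 ^ m * #P := hgrow.trans_le (by gcongr)
    exact_mod_cast this)
  have hpow : ∀ j : ℕ, j ≠ 0 → (#((j + 1) • P) : ℝ) ≤ (4 * j : ℝ) ^ m * #X := by
    intro j hj
    obtain ⟨j, rfl⟩ := Nat.exists_eq_succ_of_ne_zero hj
    have e1 : (#((j + 2) • P) : ℝ) ≤ #(2 • P) * (2 * j + 1) ^ r₂ := by
      exact_mod_cast card_nsmul_le_of_covering hcov j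
    have e2 : (#(2 • P) : ℝ) ≤ 2 ^ m * #X := by
      refine le_trans ?_ hgrow.le
      exact_mod_cast card_le_card (nsmul_subset_nsmul_of_le hP0 (by omega))
    calc (#((j + 2) • P) : ℝ) ≤ #(2 • P) * (2 * j + 1) ^ r₂ := e1
      _ ≤ (2 ^ m * #X) * (2 * j + 1) ^ m := by
          gcongr
          have : (0 : ℝ) ≤ j := by positivity
          linarith
      _ = (2 * (2 * j + 1)) ^ m * #X := by rw [mul_pow]; ring
      _ ≤ (4 * (j.succ : ℝ)) ^ m * #X := by
          gcongr ?_ ^ m * _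
          push_cast
          linarith
  -- Polynomial growth cannot sustain a factor `1 + 1 / (2 * Nc)` at each of `J` steps.
  obtain ⟨j, hjJ, hj⟩ := exists_card_succ_nsmul_le (P := P) (J := J)
    (by positivity : (0 : ℝ) ≤ 1 / (2 * Nc)) (by
      calc (#((J + 1) • P) : ℝ) ≤ (4 * J : ℝ) ^ m * #X := hpow J hJ
        _ ≤ (4 * J : ℝ) ^ m * #P := by gcongr
        _ < _ := by gcongr)
  set U := (j + 1) • P with hU
  have hUne : U.Nonempty := by
    refine ⟨0, ?_⟩
    have := nsmul_subset_nsmul_of_le hP0 (Nat.zero_le (j + 1))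
    exact this (by simp)
  have hWcard : (#((2 * (tb + 1) * J + 1) • P) : ℝ) ≤ (8 * (tb + 1) * J) ^ m * #X := by
    refine (hpow (2 * (tb + 1) * J) (by positivity)).trans (le_of_eq ?_)
    push_cast
    ring
  have hWne : ((2 * (tb + 1) * J + 1) • P).Nonempty :=
    ⟨0, nsmul_subset_nsmul_of_le hP0 (Nat.zero_le _) (by simp)⟩
  have hJ1 : (1 : ℝ) ≤ J := by exact_mod_cast Nat.one_le_iff_ne_zero.2 hJ
  obtain ⟨r, hr, τ, hτ⟩ := exists_spectrum_generators (X := X)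
    (W := (2 * (tb + 1) * J + 1) • P) (U := U) (M := 2 * (tb + 1)) (tb := tb) hXne hWne hUne
    (by
      intro x hx u hu
      have e1 : ∑ i, -u i ∈ (2 * (tb + 1)) • U := sum_mem_nsmul_of_mem fun i => by
        have := Fintype.mem_piFinset.1 hu i
        have hUs : -U = U := by rw [hU, ← neg_nsmul, hPsym]
        rw [← hUs]
        simpa using this
      rw [hU, ← mul_nsmul'] at e1
      have e2 := nsmul_subset_nsmul_of_le hP0
        (Nat.mul_le_mul_left (2 * (tb + 1)) (Nat.succ_le_of_lt hjJ)) e1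
      rw [sub_eq_add_neg, ← sum_neg_distrib, succ_nsmul']
      exact add_mem_add (hXP hx) e2)
    (by
      refine lt_of_le_of_lt ?_ htb
      have : (0 : ℝ) < #((2 * (tb + 1) * J + 1) • P) := by exact_mod_cast hWne.card_pos
      refine mul_le_mul_of_nonneg_left (Real.log_le_log (by positivity) ?_) (by norm_num)
      rw [div_le_iff₀ hX0']
      linarith) le_rfl
  have hrs : ((r + r₂ : ℕ) : ℝ) ≤ tb + m := by exact_mod_cast add_le_add hr hr₂
  have hT1 : (1 : ℝ) ≤ tb + m + 1 := by
    have : (0 : ℝ) ≤ tb + m := by positivity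
    linarith
  have hT0 : (0 : ℝ) ≤ tb + m := by linarith
  have hsq : ((r + r₂ : ℕ) : ℝ) ^ 2 ≤ (tb + m + 1) ^ 2 := by gcongr; linarith
  have hcube : ((tb : ℝ) + m + 1) ^ 2 ≤ (tb + m + 1) ^ 3 := pow_le_pow_right₀ hT1 (by norm_num)
  have hNc1 : 80 * ((tb : ℝ) + m + 1) ^ 3 ≤ Nc := by
    refine le_trans ?_ hNc
    gcongr
    linarith
  have hlin : ((tb : ℝ) + m + 1) ≤ (tb + m + 1) ^ 3 := le_self_pow₀ hT1 (by norm_num)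
  obtain ⟨s, M, hs, hM, hMx, hMc⟩ := exists_cosetProgression_of_spectrum (P := P) (U := U) hP0
    hUne hNc0 (by rw [hU, ← succ_nsmul']; exact hj) τ hσ hcov
    (by
      have : (r₂ : ℝ) ≤ m := by exact_mod_cast hr₂
      have : (0 : ℝ) ≤ tb := by positivity
      linarith) (by linarith)
  refine ⟨s, M, hs.trans (add_le_add hr hr₂), hM, ?_, ?_⟩
  · intro x hx
    obtain ⟨hx1, hx2⟩ := hMx x hx
    refine mem_coe.2 (mem_sub_of_forall_norm_sub_one_le hA hS hXne hK h2 hper (k := N) ?_ hKN ?_)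
    · have : (0 : ℝ) < N := by exact_mod_cast Nat.pos_of_ne_zero hN
      apply le_of_eq
      field_simp
    · intro γ hγ
      obtain ⟨ε, hε, a, ha, hb⟩ := hτ γ hγ
      refine (norm_apply_sub_one_le_of_generators hε ha hx1 (hx2 _ hb)).trans ?_
      have hr1 : (r : ℝ) + 1 ≤ tb + m + 1 := by
        have : (r : ℝ) ≤ tb := by exact_mod_cast hr
        have : (0 : ℝ) ≤ m := by positivity
        linarith
      -- A character of the large spectrum of `X` is assembled from at most `r` generators and one
      -- character of the spectrum of `U`; `hNc` is exactly what brings the total error under `1 /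
      -- (8 * K)`.
      calc ((r : ℝ) + 1) * (10 / Nc * ((r + r₂ : ℕ) : ℝ) ^ 2)
          ≤ ((tb : ℝ) + m + 1) * (10 / Nc * ((tb : ℝ) + m + 1) ^ 2) := by gcongr
        _ = 10 * ((tb : ℝ) + m + 1) ^ 3 / Nc := by ring
        _ ≤ 1 / (8 * K) := by
          rw [div_le_div_iff₀ hNcp (by positivity)]
          linarith
  · have hrt : r + r₂ ≤ tb + m := add_le_add hr hr₂
    calc (#(A + S) : ℝ) ≤ K * #S := h2
      _ ≤ K * (2 * K ^ n * #P) := by gcongr; exact hSX.trans (by gcongr)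
      _ = 2 * K ^ (n + 1) * #P := by ring
      _ ≤ 2 * K ^ (n + 1) * ((Nc + 1) ^ r * (5 * ((r + r₂ : ℕ) : ℝ) ^ 2 + 1) ^ (r + r₂) *
            (M.carrier.ncard : ℝ)) := by gcongr
      _ ≤ 2 * K ^ (n + 1) * ((Nc + 1) ^ tb * (5 * ((tb + m : ℕ) : ℝ) ^ 2 + 1) ^ (tb + m) *
            (M.carrier.ncard : ℝ)) := by
          gcongr ?_ * (?_ * ?_ * _)
          · exact pow_le_pow_right₀ (by linarith) hr
          · refine le_trans (pow_le_pow_left₀ (by positivity) ?_ _)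
              (pow_le_pow_right₀ (by nlinarith [sq_nonneg ((tb + m : ℕ) : ℝ)]) hrt)
            gcongr
      _ = _ := by ring

end FiniteCore

/-! ### Choice of parameters in terms of `L = log K`. -/

section Parameters

/-- `N ~ L` makes `4 ^ N` beat `16 K`. Taking `μ ~ L N` and `n ~ L N ^ 2 ~ L ^ 3` bounds both error
terms by `17 L`; finally `m ~ n L ~ L ^ 4` absorbs `K ^ (16 n)`. -/
theorem exists_sampling_parameters {L : ℝ} (hL : 1 ≤ L) :
    ∃ (n N m : ℕ) (μ : ℝ), 0 < μ ∧ n ≠ 0 ∧ N ≠ 0 ∧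
      2 * ((Real.log (1 + 4 * Real.exp L ^ 15) + μ ^ 2 / (2 * n)) / μ) ≤ 1 / (4 * N) ∧
      16 * Real.exp L ≤ 4 ^ N ∧ 2 * Real.exp L ^ (16 * n) < 2 ^ m ∧ 3 * m + 1 ≤ n * N ∧
      n ≤ m ∧ (m : ℝ) ≤ 4 * 10 ^ 8 * L ^ 4 := by
  set N : ℕ := ⌈72 * L⌉₊ + 10 with hN
  have hN1 : 72 * L + 10 ≤ N := by
    have := Nat.le_ceil (72 * L)
    rw [hN]; push_cast; linarith
  have hN2 : (N : ℝ) ≤ 83 * L := by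
    have := (Nat.ceil_lt_add_one (by positivity : 0 ≤ 72 * L)).le
    rw [hN]; push_cast; linarith
  have hN0 : (0 : ℝ) < N := by linarith
  set n : ℕ := ⌈2176 * L * N ^ 2⌉₊ with hn
  have hn1 : 2176 * L * N ^ 2 ≤ n := Nat.le_ceil _
  have hn0 : (0 : ℝ) < n := lt_of_lt_of_le (by positivity) hn1
  have hn0' : n ≠ 0 := by
    rintro h
    rw [h] at hn0
    simp at hn0
  have hn1' : (1 : ℝ) ≤ n := by exact_mod_cast Nat.one_le_iff_ne_zero.2 hn0'
  have hn2 : (n : ℝ) ≤ 15 * 10 ^ 6 * L ^ 3 := by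
    have e1 := (Nat.ceil_lt_add_one (by positivity : 0 ≤ 2176 * L * (N : ℝ) ^ 2)).le
    have e2 : 2176 * L * (N : ℝ) ^ 2 ≤ 2176 * L * (83 * L) ^ 2 := by gcongr
    have e3 : 1 ≤ L ^ 3 := one_le_pow₀ hL
    have e4 : 2176 * L * (83 * L) ^ 2 = 14990464 * L ^ 3 := by ring
    rw [← hn] at e1
    linarith
  set m : ℕ := ⌈24 * n * L⌉₊ + 2 with hm
  have hm1 : 24 * n * L + 2 ≤ m := by
    have := Nat.le_ceil (24 * n * L)
    rw [hm]; push_cast; linarith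
  have hm2 : (m : ℝ) ≤ 24 * n * L + 3 := by
    have := (Nat.ceil_lt_add_one (by positivity : 0 ≤ 24 * n * L)).le
    rw [hm]; push_cast; linarith
  refine ⟨n, N, m, 272 * L * N, by positivity, hn0', by omega, ?_, ?_, ?_, ?_, ?_, ?_⟩
  · have hlog : Real.log (1 + 4 * Real.exp L ^ 15) ≤ 17 * L := by
      rw [Real.log_le_iff_le_exp (by positivity)]
      have e1 : 1 ≤ Real.exp L ^ 15 := one_le_pow₀ (Real.one_le_exp (by linarith))
      have e2 : (5 : ℝ) ≤ Real.exp L ^ 2 := by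
        have h1 : Real.exp 1 ≤ Real.exp L := Real.exp_le_exp.2 hL
        have h2 := Real.exp_one_gt_d9
        nlinarith
      have e3 : Real.exp (17 * L) = Real.exp L ^ 2 * Real.exp L ^ 15 := by
        rw [← pow_add, ← Real.exp_nat_mul]
        norm_num
      rw [e3]
      nlinarith
    have hμ : (272 * L * N) ^ 2 / (2 * (n : ℝ)) ≤ 17 * L := by
      rw [div_le_iff₀ (by positivity)]
      have : (272 * L * N) ^ 2 = 34 * L * (2176 * L * (N : ℝ) ^ 2) := by ring
      rw [this]
      nlinarith
    calc 2 * ((Real.log (1 + 4 * Real.exp L ^ 15) + (272 * L * N) ^ 2 / (2 * n)) / (272 * L * N))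
        ≤ 2 * ((17 * L + 17 * L) / (272 * L * N)) := by gcongr
      _ = 1 / (4 * N) := by field_simp; norm_num
  · have e1 : (16 : ℝ) ≤ Real.exp 1 ^ 3 := by
      have h2 := Real.exp_one_gt_d9
      calc (16 : ℝ) ≤ 2.7 ^ 3 := by norm_num
        _ ≤ _ := by gcongr; linarith
    calc 16 * Real.exp L ≤ Real.exp 1 ^ 3 * Real.exp L := by gcongr
      _ = Real.exp (3 + L) := by
          rw [← Real.exp_nat_mul, ← Real.exp_add]
          norm_num
      _ ≤ Real.exp (N * 1) := Real.exp_le_exp.2 (by linarith)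
      _ = Real.exp 1 ^ N := Real.exp_nat_mul _ _
      _ ≤ 4 ^ N := by
          gcongr
          linarith [Real.exp_one_lt_d9]
  · have h2 := Real.log_two_gt_d9
    calc 2 * Real.exp L ^ (16 * n) = Real.exp (Real.log 2 + 16 * n * L) := by
          rw [Real.exp_add, Real.exp_log (by norm_num), ← Real.exp_nat_mul]
          push_cast
          ring_nf
      _ < Real.exp (m * Real.log 2) := by
          apply Real.exp_lt_exp.2
          have h3 : (24 * n * L + 2) * Real.log 2 ≤ m * Real.log 2 := by gcongr
          have h4 : 0 < n * L := by positivity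
          nlinarith
      _ = 2 ^ m := by rw [Real.exp_nat_mul, Real.exp_log (by norm_num)]
  · have : (3 * m + 1 : ℝ) ≤ n * N := by nlinarith
    exact_mod_cast this
  · have : (n : ℝ) ≤ m := by nlinarith
    exact_mod_cast this
  · have e3 : 1 ≤ L ^ 4 := one_le_pow₀ hL
    have : 24 * n * L ≤ 24 * (15 * 10 ^ 6 * L ^ 3) * L := by gcongr
    have e4 : 24 * (15 * 10 ^ 6 * L ^ 3) * L = 36 * 10 ^ 7 * L ^ 4 := by ring
    linarith

theorem le_exp_of_le_mul_pow {L x : ℝ} (hL : 1 ≤ L) (hx : x ≤ 4 * 10 ^ 8 * L ^ 4) :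
    x ≤ Real.exp (24 * L) := by
  have h1 : L ≤ Real.exp L := by linarith [Real.add_one_le_exp L]
  have h2 : (4 * 10 ^ 8 : ℝ) ≤ Real.exp 1 ^ 20 := by
    calc (4 * 10 ^ 8 : ℝ) ≤ 2.7182 ^ 20 := by norm_num
      _ ≤ _ := by gcongr; linarith [Real.exp_one_gt_d9]
  calc x ≤ 4 * 10 ^ 8 * L ^ 4 := hx
    _ ≤ Real.exp 1 ^ 20 * Real.exp L ^ 4 := by gcongr
    _ = Real.exp (20 + 4 * L) := by
        rw [← Real.exp_nat_mul, ← Real.exp_nat_mul, ← Real.exp_add]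
        norm_num
    _ ≤ Real.exp (24 * L) := Real.exp_le_exp.2 (by linarith)

/-- With `J = y ^ 2`, `log (4 J) ≤ 4 y`, so `J / (4 Nc)` beats `m * log (4 J)` as soon as `y > 16 m
Nc`; this explains `17`. -/
theorem four_mul_pow_lt_one_add_pow {m Nc J : ℕ} (hm : m ≠ 0) (hNc : Nc ≠ 0)
    (hJ : J = (17 * m * Nc) ^ 2) :
    (4 * J : ℝ) ^ m < (1 + 1 / (2 * Nc)) ^ J := by
  have hm0 : (0 : ℝ) < m := by exact_mod_cast Nat.pos_of_ne_zero hm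
  have hc0 : (1 : ℝ) ≤ Nc := by exact_mod_cast Nat.one_le_iff_ne_zero.2 hNc
  have hJ' : (J : ℝ) = (17 * m * Nc) ^ 2 := by rw [hJ]; push_cast; ring
  have hJ0 : (0 : ℝ) < J := by rw [hJ']; positivity
  set y : ℝ := 17 * m * Nc with hy
  have hy0 : 0 < y := by positivity
  have hlog : Real.log (4 * J) ≤ 4 * y := by
    have e1 : (4 * J : ℝ) = (2 * y) ^ 2 := by rw [hJ']; ring
    rw [e1, Real.log_pow]
    have := Real.log_le_sub_one_of_pos (by positivity : 0 < 2 * y)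
    push_cast
    linarith
  have hδ : 1 / (4 * Nc : ℝ) ≤ Real.log (1 + 1 / (2 * Nc)) := by
    have hpos : (0 : ℝ) < 1 + 1 / (2 * Nc) := by positivity
    have := Real.one_sub_inv_le_log_of_pos hpos
    refine le_trans ?_ this
    have e : 1 - (1 + 1 / (2 * (Nc : ℝ)))⁻¹ = 1 / (2 * Nc + 1) := by
      field_simp
      ring
    rw [e]
    apply one_div_le_one_div_of_le <;> linarith
  rw [← Real.log_lt_log_iff (by positivity) (by positivity), Real.log_pow, Real.log_pow]
  calc m * Real.log (4 * J) ≤ m * (4 * y) := by gcongr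
    _ < J * (1 / (4 * Nc)) := by
        rw [hJ', hy, mul_one_div, lt_div_iff₀ (by positivity)]
        have : 0 < (m : ℝ) ^ 2 * Nc ^ 2 := by positivity
        nlinarith
    _ ≤ _ := by gcongr

/-- `Nc` is a power of `K` and `tb ~ m L ~ L ^ 5`. The loss is dominated by powers of `K` with
exponents of order `tb + m`, that is `exp (O(L ^ 6))`. -/
theorem exists_dimension_parameters {L : ℝ} (hL : 1 ≤ L) {n m : ℕ} (hn : n ≠ 0) (hnm : n ≤ m)
    (hm : (m : ℝ) ≤ 4 * 10 ^ 8 * L ^ 4) :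
    ∃ J tb Nc : ℕ, J ≠ 0 ∧ (4 * J : ℝ) ^ m < (1 + 1 / (2 * Nc)) ^ J ∧
      8 * Real.log (2 * (8 * (tb + 1) * J) ^ m) < tb + 1 ∧
      80 * Real.exp L * (tb + m + 1) ^ 3 ≤ Nc ∧
      ((tb + m : ℕ) : ℝ) ≤ 4 * 10 ^ 14 * L ^ 6 ∧
      2 * Real.exp L ^ (n + 1) * (Nc + 1) ^ tb * (5 * ((tb + m : ℕ) : ℝ) ^ 2 + 1) ^ (tb + m) ≤
        Real.exp (4 * 10 ^ 14 * L ^ 6) := by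
  have hm0 : m ≠ 0 := by omega
  have hm1 : (1 : ℝ) ≤ m := by exact_mod_cast Nat.one_le_iff_ne_zero.2 hm0
  have hmE := le_exp_of_le_mul_pow hL hm
  have hLE : L ≤ Real.exp L := by linarith [Real.add_one_le_exp L]
  have he := Real.exp_one_gt_d9
  have hpow : ∀ k : ℕ, (2.7 : ℝ) ^ k ≤ Real.exp (k * L) := by
    intro k
    rw [Real.exp_nat_mul]
    gcongr
    refine le_trans ?_ (Real.exp_le_exp.2 hL)
    linarith
  set Nc : ℕ := ⌈Real.exp (110 * L)⌉₊ with hNc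
  have hNc1 : Real.exp (110 * L) ≤ Nc := Nat.le_ceil _
  have hNc2 : (Nc : ℝ) + 1 ≤ Real.exp (111 * L) := by
    have e1 := (Nat.ceil_lt_add_one (Real.exp_pos (110 * L)).le).le
    have e2 : Real.exp (111 * L) = Real.exp L * Real.exp (110 * L) := by
      rw [← Real.exp_add]; ring_nf
    have e3 := hpow 1
    have e4 : (2 : ℝ) ≤ Real.exp (110 * L) := by
      refine le_trans ?_ (Real.exp_le_exp.2 (by linarith : 1 ≤ 110 * L))
      linarith
    norm_num at e3
    rw [e2]
    nlinarith
  have hNc0 : Nc ≠ 0 := by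
    rw [hNc]
    exact (Nat.ceil_pos.2 (Real.exp_pos _)).ne'
  have hNcp : (0 : ℝ) < Nc := by exact_mod_cast Nat.pos_of_ne_zero hNc0
  set J : ℕ := (17 * m * Nc) ^ 2 with hJ
  have hJ' : (J : ℝ) = (17 * m * Nc) ^ 2 := by rw [hJ]; push_cast; ring
  -- The condition on `tb` also has `tb` inside the logarithm. Scaling by `16 * m` there lets `log x
  -- ≤ x` absorb half of `tb + 1`; the rest, `8 * 305 * m * L + 8 * log 2`, gets doubled.
  set tb : ℕ := ⌈4880 * m * L + 16⌉₊ with htb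
  have htb1 : 4880 * m * L + 16 ≤ tb := Nat.le_ceil _
  have htb2 : (tb : ℝ) ≤ 4880 * m * L + 17 := by
    have := (Nat.ceil_lt_add_one (by positivity : 0 ≤ 4880 * m * L + 16)).le
    rw [← htb] at this
    linarith
  have hmL : (m : ℝ) ≤ m * L := le_mul_of_one_le_right (by linarith) hL
  have hT : (tb : ℝ) + m + 1 ≤ 4899 * (m * L) := by nlinarith
  have hT2 : (tb : ℝ) + m + 1 ≤ Real.exp (34 * L) := by
    have e1 := hpow 9
    norm_num at e1
    have e2 : Real.exp (34 * L) = Real.exp (9 * L) * (Real.exp (24 * L) * Real.exp L) := by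
      rw [← Real.exp_add, ← Real.exp_add]; ring_nf
    rw [e2]
    refine hT.trans ?_
    gcongr
    linarith
  have htb0 : (0 : ℝ) < tb + 1 := by positivity
  have hT3 : 4899 * (m * L) ≤ 1959600000000 * L ^ 5 := by
    have : (m : ℝ) * L ≤ 4 * 10 ^ 8 * L ^ 4 * L := by gcongr
    have e : 4 * 10 ^ 8 * L ^ 4 * L = 4 * 10 ^ 8 * L ^ 5 := by ring
    linarith
  refine ⟨J, tb, Nc, by positivity, four_mul_pow_lt_one_add_pow hm0 hNc0 hJ, ?_, ?_, ?_, ?_⟩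
  · have e1 : Real.log (2 * (8 * (tb + 1) * J) ^ m) =
        Real.log 2 + m * (Real.log ((tb + 1) / (16 * m)) + Real.log (36992 * m ^ 3 * Nc ^ 2)) := by
      rw [Real.log_mul (by norm_num) (by rw [hJ']; positivity), Real.log_pow,
        ← Real.log_mul (by positivity) (by positivity), hJ']
      congr 3
      field_simp
      norm_num
    have e2 : Real.log ((tb + 1) / (16 * m)) ≤ (tb + 1) / (16 * m) := by
      have := Real.log_le_sub_one_of_pos (by positivity : 0 < ((tb : ℝ) + 1) / (16 * m))
      linarith
    have e3 : Real.log (36992 * m ^ 3 * Nc ^ 2) ≤ 305 * L := by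
      rw [Real.log_le_iff_le_exp (by positivity)]
      have f1 := hpow 11
      norm_num at f1
      calc 36992 * (m : ℝ) ^ 3 * Nc ^ 2
          ≤ Real.exp (11 * L) * Real.exp (24 * L) ^ 3 * Real.exp (111 * L) ^ 2 := by
            gcongr <;> linarith
        _ = Real.exp (305 * L) := by
            rw [← Real.exp_nat_mul, ← Real.exp_nat_mul, ← Real.exp_add, ← Real.exp_add]
            norm_num
            ring
    have e4 : (m : ℝ) * (Real.log ((tb + 1) / (16 * m)) + Real.log (36992 * m ^ 3 * Nc ^ 2)) ≤
        m * ((tb + 1) / (16 * m) + 305 * L) := by gcongr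
    have e5 : (m : ℝ) * ((tb + 1) / (16 * m) + 305 * L) = (tb + 1) / 16 + 305 * m * L := by
      field_simp
    rw [e1]
    have := Real.log_two_lt_d9
    nlinarith
  · refine le_trans ?_ hNc1
    have f1 := hpow 5
    norm_num at f1
    calc 80 * Real.exp L * ((tb : ℝ) + m + 1) ^ 3
        ≤ Real.exp (5 * L) * Real.exp L * Real.exp (34 * L) ^ 3 := by gcongr; linarith
      _ = Real.exp (108 * L) := by
          rw [← Real.exp_nat_mul, ← Real.exp_add, ← Real.exp_add]
          norm_num
          ring
      _ ≤ _ := Real.exp_le_exp.2 (by linarith)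
  · have : L ^ 5 ≤ L ^ 6 := pow_le_pow_right₀ hL (by norm_num)
    push_cast
    linarith
  · have hT0 : (0 : ℝ) ≤ (tb + m : ℕ) := by positivity
    have f1 : 5 * ((tb + m : ℕ) : ℝ) ^ 2 + 1 ≤ Real.exp (70 * L) := by
      have g1 := hpow 2
      norm_num at g1
      have g2 : Real.exp (70 * L) = Real.exp (2 * L) * Real.exp (34 * L) ^ 2 := by
        rw [← Real.exp_nat_mul, ← Real.exp_add]
        norm_num
        ring
      have g3 : ((tb + m : ℕ) : ℝ) ^ 2 ≤ Real.exp (34 * L) ^ 2 := by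
        gcongr
        push_cast
        linarith
      have g4 : 1 ≤ Real.exp (34 * L) ^ 2 := one_le_pow₀ (Real.one_le_exp (by linarith))
      rw [g2]
      nlinarith
    have f2 : 2 * Real.exp L ^ (n + 1) ≤ Real.exp (L + (n + 1) * L) := by
      have g1 := hpow 1
      norm_num at g1
      rw [Real.exp_add, ← Nat.cast_succ, Real.exp_nat_mul]
      gcongr
      linarith
    have hnm' : (n : ℝ) ≤ m := by exact_mod_cast hnm
    calc 2 * Real.exp L ^ (n + 1) * (Nc + 1) ^ tb *
          (5 * ((tb + m : ℕ) : ℝ) ^ 2 + 1) ^ (tb + m)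
        ≤ Real.exp (L + (n + 1) * L) * Real.exp (111 * L) ^ tb * Real.exp (70 * L) ^ (tb + m) := by
          gcongr
      _ = Real.exp ((n + 2) * L + tb * (111 * L) + ((tb + m : ℕ) : ℝ) * (70 * L)) := by
          rw [← Real.exp_nat_mul, ← Real.exp_nat_mul, ← Real.exp_add, ← Real.exp_add]
          ring_nf
      _ ≤ Real.exp (4 * 10 ^ 14 * L ^ 6) := by
          apply Real.exp_le_exp.2
          have g1 : (tb : ℝ) + m + 1 ≤ 1959600000000 * L ^ 5 := hT.trans hT3
          have g2 : ((tb : ℝ) + m + 1) * L ≤ 1959600000000 * L ^ 5 * L := by gcongr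
          have g3 : 1959600000000 * L ^ 5 * L = 1959600000000 * L ^ 6 := by ring
          have g4 : n * L ≤ m * L := by gcongr
          have g5 : 0 ≤ tb * L := by positivity
          push_cast
          nlinarith

end Parameters

/-! ### Transfer from finite quotients. -/

section Transfer

namespace SymmCosetProgression

/-- The image of a coset progression under a homomorphism. -/
def map {G G' : Type*} [AddCommGroup G] [AddCommGroup G'] {d : ℕ} (f : G →+ G')
    (M : SymmCosetProgression G d) : SymmCosetProgression G' d where
  subgroup := M.subgroup.map f
  gen := fun i => f (M.gen i)
  len := M.len
  len_pos := M.len_pos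

variable {G G' : Type*} [AddCommGroup G] [AddCommGroup G'] {d : ℕ}

theorem map_add_sum_zsmul (f : G →+ G') (x : Fin d → G) (h : G) (l : Fin d → ℤ) :
    f (h + ∑ i, l i • x i) = f h + ∑ i, l i • f (x i) := by
  simp [map_sum]

theorem carrier_map (f : G →+ G') (M : SymmCosetProgression G d) :
    (M.map f).carrier = f '' M.carrier := by
  ext g
  constructor
  · rintro ⟨_, ⟨h, hh, rfl⟩, l, hl, rfl⟩
    exact ⟨_, ⟨h, hh, l, hl, rfl⟩, map_add_sum_zsmul f M.gen h l⟩
  · rintro ⟨_, ⟨h, hh, l, hl, rfl⟩, rfl⟩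
    exact ⟨f h, ⟨h, hh, rfl⟩, l, hl, map_add_sum_zsmul f M.gen h l⟩

theorem IsProper.map {f : G →+ G'} (hf : Function.Injective f) {M : SymmCosetProgression G d}
    (hM : M.IsProper) : (M.map f).IsProper := by
  rintro _ ⟨h, hh, rfl⟩ _ ⟨h', hh', rfl⟩ l l' hl hl' heq
  have := hM h hh h' hh' l l' hl hl' (hf (by
    rw [map_add_sum_zsmul, map_add_sum_zsmul]
    exact heq))
  exact ⟨by rw [this.1], this.2⟩

theorem gen_mem_carrier (M : SymmCosetProgression G d) (i : Fin d) : M.gen i ∈ M.carrier := by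
  refine ⟨0, M.subgroup.zero_mem, Pi.single i 1, fun j => ?_, ?_⟩
  · have h := M.len_pos j
    by_cases hij : j = i
    · subst hij
      simp only [Pi.single_eq_same, abs_one]
      exact_mod_cast h
    · rw [Pi.single_eq_of_ne hij]
      simp
  · rw [zero_add, sum_eq_single i]
    · simp
    · intro j _ hj
      rw [Pi.single_eq_of_ne hj, zero_smul]
    · simp

theorem subgroup_subset_carrier (M : SymmCosetProgression G d) {h : G} (hh : h ∈ M.subgroup) :
    h ∈ M.carrier :=
  ⟨h, hh, 0, fun i => by simp, by simp⟩

/-- A proper coset progression inside the image of `D` lifts along a homomorphism that is a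
Freiman isomorphism on `D`. -/
theorem exists_lift [DecidableEq G] {φ : G →+ G'} {D : Finset G} (h0 : 0 ∈ D)
    (hsym : ∀ x ∈ D, -x ∈ D)
    (hinj : ∀ x ∈ D, ∀ y ∈ D, ∀ z ∈ D, φ (x + y + z) = 0 → x + y + z = 0)
    (M : SymmCosetProgression G' d) (hM : M.IsProper) (hMD : M.carrier ⊆ φ '' (D : Set G)) :
    ∃ M₀ : SymmCosetProgression G d, M₀.IsProper ∧ M₀.carrier ⊆ (D : Set G) ∧
      M.carrier.ncard ≤ M₀.carrier.ncard := by
  -- Some `z ∈ D` has the same image as `x + y`, and faithfulness on triple sums forces `z = x + y`.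
  -- So `D` is closed under additions whose image stays in `M`.
  have hclosed : ∀ x ∈ D, ∀ y ∈ D, φ (x + y) ∈ M.carrier → x + y ∈ D := by
    intro x hx y hy hxy
    obtain ⟨z, hz, hzx⟩ := hMD hxy
    have := hinj x hx y hy (-z) (hsym z hz) (by rw [map_add, map_neg, hzx, add_neg_cancel])
    rw [add_neg_eq_zero] at this
    rw [this]
    exact hz
  have hinj' : ∀ x ∈ D, ∀ y ∈ D, φ x = φ y → x = y := by
    intro x hx y hy hxy
    have := hinj x hx (-y) (hsym y hy) 0 h0 (by simp [hxy])
    rwa [add_zero, add_neg_eq_zero] at this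
  choose g hgD hg using fun i => hMD (M.gen_mem_carrier i)
  have hgD' : ∀ i, g i ∈ D := fun i => hgD i
  let H : AddSubgroup G :=
    { carrier := {x | x ∈ D ∧ φ x ∈ M.subgroup}
      zero_mem' := ⟨h0, by simp⟩
      add_mem' := by
        rintro x y ⟨hx, hx'⟩ ⟨hy, hy'⟩
        have hxy : φ (x + y) ∈ M.subgroup := by
          rw [map_add]
          exact M.subgroup.add_mem hx' hy'
        exact ⟨hclosed x hx y hy (M.subgroup_subset_carrier hxy), hxy⟩
      neg_mem' := by
        rintro x ⟨hx, hx'⟩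
        exact ⟨hsym x hx, by rw [map_neg]; exact M.subgroup.neg_mem hx'⟩ }
  have hφ : ∀ (h : G) (l : Fin d → ℤ),
      φ (h + ∑ i, l i • g i) = φ h + ∑ i, l i • M.gen i := by
    intro h l
    rw [map_add_sum_zsmul]
    simp only [hg]
  -- Induction on `∑ |l i|`: moving one coefficient a unit towards `0` stays in the box, so
  -- `hclosed` allows one generator to be added at a time.
  have hsub : ∀ (n : ℕ) (h : G), h ∈ H → ∀ l : Fin d → ℤ, (∀ i, |l i| ≤ (M.len i : ℤ)) →
      ∑ i, (l i).natAbs = n → h + ∑ i, l i • g i ∈ D := by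
    intro n
    induction n with
    | zero =>
      intro h hh l _ hn
      have : ∀ i, l i = 0 := fun i =>
        Int.natAbs_eq_zero.1 ((sum_eq_zero_iff.1 hn) i (mem_univ i))
      simp only [this, zero_smul, sum_const_zero, add_zero]
      exact hh.1
    | succ n ih =>
      intro h hh l hl hn
      obtain ⟨i, hi⟩ : ∃ i, l i ≠ 0 := by
        by_contra! hcon
        simp [hcon] at hn
      obtain ⟨e, he, hle⟩ : ∃ e : ℤ, (e = 1 ∨ e = -1) ∧ (l i).natAbs = (l i - e).natAbs + 1 := by
        rcases lt_or_gt_of_ne hi with h1 | h1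
        · exact ⟨-1, Or.inr rfl, by omega⟩
        · exact ⟨1, Or.inl rfl, by omega⟩
      set l' : Fin d → ℤ := Function.update l i (l i - e) with hl'
      have hsame : l' i = l i - e := by simp [hl']
      have hne : ∀ j, j ≠ i → l' j = l j := fun j hj => by simp [hl', hj]
      have hb : ∀ j, |l' j| ≤ (M.len j : ℤ) := by
        intro j
        by_cases hj : j = i
        · subst hj
          have := hl j
          rw [hsame]
          rw [Int.abs_eq_natAbs] at this ⊢
          omega
        · rw [hne j hj]
          exact hl j
      have hsum : ∑ j, (l' j).natAbs = n := by
        rw [← add_sum_erase univ _ (mem_univ i)] at hn ⊢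
        have : ∑ j ∈ univ.erase i, (l' j).natAbs = ∑ j ∈ univ.erase i, (l j).natAbs :=
          sum_congr rfl fun j hj => by rw [hne j (ne_of_mem_erase hj)]
        rw [this, hsame]
        omega
      have hdec : h + ∑ j, l j • g j = (h + ∑ j, l' j • g j) + e • g i := by
        rw [← add_sum_erase univ (fun j => l j • g j) (mem_univ i),
          ← add_sum_erase univ (fun j => l' j • g j) (mem_univ i)]
        have : ∑ j ∈ univ.erase i, l' j • g j = ∑ j ∈ univ.erase i, l j • g j :=
          sum_congr rfl fun j hj => by rw [hne j (ne_of_mem_erase hj)]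
        rw [this, hsame, sub_smul]
        abel
      have heg : e • g i ∈ D := by
        rcases he with rfl | rfl
        · simpa using hgD' i
        · simpa using hsym _ (hgD' i)
      have hmem : φ ((h + ∑ j, l' j • g j) + e • g i) ∈ M.carrier := by
        rw [← hdec, hφ]
        exact ⟨φ h, hh.2, l, hl, rfl⟩
      rw [hdec]
      exact hclosed _ (ih h hh l' hb hsum) _ heg hmem
  refine ⟨⟨H, g, M.len, M.len_pos⟩, ?_, ?_, ?_⟩
  · rintro h hh h' hh' l l' hl hl' heq
    have := hM (φ h) hh.2 (φ h') hh'.2 l l' hl hl' (by rw [← hφ, ← hφ]; exact congrArg φ heq)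
    exact ⟨hinj' h hh.1 h' hh'.1 this.1, this.2⟩
  · rintro _ ⟨h, hh, l, hl, rfl⟩
    exact hsub _ h hh l hl rfl
  · have hfin : Set.Finite {x | ∃ h ∈ H, ∃ l : Fin d → ℤ,
        (∀ i, |l i| ≤ (M.len i : ℤ)) ∧ x = h + ∑ i, l i • g i} := by
      refine D.finite_toSet.subset ?_
      rintro _ ⟨h, hh, l, hl, rfl⟩
      exact hsub _ h hh l hl rfl
    refine le_trans (Set.ncard_le_ncard ?_ (hfin.image φ)) (Set.ncard_image_le hfin)
    rintro x ⟨h', hh', l, hl, rfl⟩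
    obtain ⟨h, hh, rfl⟩ := hMD (M.subgroup_subset_carrier hh')
    exact ⟨h + ∑ i, l i • g i, ⟨h, ⟨hh, hh'⟩, l, hl, rfl⟩, hφ h l⟩

end SymmCosetProgression

/-- The nonzero elements of a finite subset of a finitely generated abelian group survive in some
finite quotient. -/
theorem exists_finite_addMonoidHom_ne_zero (G : Type*) [AddCommGroup G] [AddGroup.FG G]
    (B : Finset G) : ∃ (F : Type) (_ : AddCommGroup F) (_ : Fintype F) (φ : G →+ F),
      ∀ x ∈ B, φ x = 0 → x = 0 := by
  classical
  obtain ⟨n, ι, hι, p, hp, e, ⟨f⟩⟩ := AddCommGroup.equiv_free_prod_directSum_zmod G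
  -- The modulus exceeds every free coordinate of elements of `B`, so none of them vanishes modulo
  -- `q` unless it is zero.
  set q : ℕ := ∑ x ∈ B, ∑ j, ((f x).1 j).natAbs + 1 with hq
  have : NeZero q := ⟨by omega⟩
  have : ∀ i, NeZero (p i ^ e i) := fun i => ⟨pow_ne_zero _ (hp i).ne_zero⟩
  let g₁ : ((Fin n →₀ ℤ) × DirectSum ι fun i => ZMod (p i ^ e i)) →+ (Fin n → ZMod q) :=
    { toFun := fun x j => (x.1 j : ZMod q)
      map_zero' := by ext; simp
      map_add' := by intro x y; ext; simp }
  let g₂ : ((Fin n →₀ ℤ) × DirectSum ι fun i => ZMod (p i ^ e i)) →+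
      ((i : ι) → ZMod (p i ^ e i)) :=
    { toFun := fun x i => x.2 i
      map_zero' := by ext; simp
      map_add' := by intro x y; ext; simp }
  refine ⟨(Fin n → ZMod q) × ((i : ι) → ZMod (p i ^ e i)), inferInstance, inferInstance,
    (g₁.prod g₂).comp f.toAddMonoidHom, fun x hx h => ?_⟩
  have h1 : ∀ j, ((f x).1 j : ZMod q) = 0 := fun j => congrFun (congrArg Prod.fst h) j
  have h2 : ∀ i, (f x).2 i = 0 := fun i => congrFun (congrArg Prod.snd h) i
  have h3 : ∀ j, (f x).1 j = 0 := by
    intro j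
    have hd := (ZMod.intCast_zmod_eq_zero_iff_dvd _ _).1 (h1 j)
    apply Int.eq_zero_of_abs_lt_dvd hd
    have hle : ((f x).1 j).natAbs ≤ ∑ x ∈ B, ∑ j, ((f x).1 j).natAbs :=
      (single_le_sum (f := fun j => ((f x).1 j).natAbs) (fun _ _ => Nat.zero_le _)
        (mem_univ j)).trans
        (single_le_sum (f := fun x => ∑ j, ((f x).1 j).natAbs) (fun _ _ => Nat.zero_le _) hx)
    rw [Int.abs_eq_natAbs]
    exact_mod_cast Nat.lt_succ_of_le hle
  apply f.injective
  rw [map_zero]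
  refine Prod.ext (Finsupp.ext h3) ?_
  ext i
  exact h2 i

end Transfer

theorem image_sub_distrib {G G' : Type*} [AddCommGroup G] [AddCommGroup G'] [DecidableEq G]
    [DecidableEq G'] (f : G →+ G') (A B : Finset G) :
    (A - B).image f = A.image f - B.image f :=
  image_image₂_distrib fun x y => map_sub f x y

/-! ### From finite to arbitrary abelian groups, and the final statement. -/

section Main

/-- The conclusion for finite abelian groups, with a bound depending only on `log K`. -/
theorem exists_cosetProgression_fintype {G : Type*} [AddCommGroup G] [DecidableEq G] [Fintype G]
    {A S : Finset G} (hA : A.Nonempty) (hS : S.Nonempty) {K : ℝ} (hK : 3 ≤ K)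
    (h1 : (#(A + S) : ℝ) ≤ K * #A) (h2 : (#(A + S) : ℝ) ≤ K * #S) :
    ∃ (s : ℕ) (M : SymmCosetProgression G s), (s : ℝ) ≤ 4 * 10 ^ 14 * Real.log K ^ 6 ∧
      M.IsProper ∧ M.carrier ⊆ (((A + S) - (A + S) : Finset G) : Set G) ∧
      (#(A + S) : ℝ) ≤ Real.exp (4 * 10 ^ 14 * Real.log K ^ 6) * (M.carrier.ncard : ℝ) := by
  have hL : 1 ≤ Real.log K := by
    rw [Real.le_log_iff_exp_le (by linarith)]
    linarith [Real.exp_one_lt_d9]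
  obtain ⟨n, N, m, μ, hμ, hn, hN, hCS, hKN, hm, hmn, hnm, hmL⟩ := exists_sampling_parameters hL
  obtain ⟨J, tb, Nc, hJ, hJm, htb, hNc, hd, hloss⟩ := exists_dimension_parameters hL hn hnm hmL
  rw [Real.exp_log (by linarith)] at hCS hKN hm hNc hloss
  obtain ⟨s, M, hs, hM, hMD, hMc⟩ := exists_cosetProgression_of_finite hA hS (by linarith) h1 h2
    hμ hn hN hCS hKN hm hmn hJ hJm htb hNc
  exact ⟨s, M, le_trans (by exact_mod_cast hs) hd, hM, hMD, hMc.trans (by gcongr)⟩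

/-- A finite quotient faithful on `D + D + D` preserves the sizes of `A`, `S` and `A + S`, and the
progression found there lifts back by `exists_lift`. -/
theorem exists_cosetProgression_of_fg {G : Type*} [AddCommGroup G] [DecidableEq G] [AddGroup.FG G]
    {A S : Finset G} (hA : A.Nonempty) (hS : S.Nonempty) {K : ℝ} (hK : 3 ≤ K)
    (h1 : (#(A + S) : ℝ) ≤ K * #A) (h2 : (#(A + S) : ℝ) ≤ K * #S) :
    ∃ (s : ℕ) (M : SymmCosetProgression G s), (s : ℝ) ≤ 4 * 10 ^ 14 * Real.log K ^ 6 ∧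
      M.IsProper ∧ M.carrier ⊆ (((A + S) - (A + S) : Finset G) : Set G) ∧
      (#(A + S) : ℝ) ≤ Real.exp (4 * 10 ^ 14 * Real.log K ^ 6) * (M.carrier.ncard : ℝ) := by
  classical
  set D := (A + S) - (A + S) with hD
  obtain ⟨a₀, ha₀⟩ := hA
  obtain ⟨s₀, hs₀⟩ := hS
  have h0 : 0 ∈ D := mem_sub.2 ⟨_, add_mem_add ha₀ hs₀, _, add_mem_add ha₀ hs₀, sub_self _⟩
  have hsym : ∀ x ∈ D, -x ∈ D := by
    intro x hx
    obtain ⟨a, ha, b, hb, rfl⟩ := mem_sub.1 hx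
    exact mem_sub.2 ⟨b, hb, a, ha, by abel⟩
  obtain ⟨F, _, _, φ, hφ⟩ := exists_finite_addMonoidHom_ne_zero G (D + D + D)
  have hinj : ∀ x ∈ D, ∀ y ∈ D, ∀ z ∈ D, φ (x + y + z) = 0 → x + y + z = 0 :=
    fun x hx y hy z hz => hφ _ (add_mem_add (add_mem_add hx hy) hz)
  have hinjD : ∀ x ∈ D, φ x = 0 → x = 0 := by
    intro x hx h
    have := hinj x hx 0 h0 0 h0 (by simpa using h)
    simpa using this
  have hcardAS : #((A + S).image φ) = #(A + S) := by
    apply card_image_of_injOn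
    intro x hx y hy hxy
    exact sub_eq_zero.1 (hinjD _ (mem_sub.2 ⟨x, hx, y, hy, rfl⟩) (by simp [hxy]))
  have hcardA : #(A.image φ) = #A := by
    apply card_image_of_injOn
    intro x hx y hy hxy
    refine sub_eq_zero.1 (hinjD _ (mem_sub.2 ⟨x + s₀, add_mem_add hx hs₀, y + s₀,
      add_mem_add hy hs₀, by abel⟩) (by simp [hxy]))
  have hcardS : #(S.image φ) = #S := by
    apply card_image_of_injOn
    intro x hx y hy hxy
    refine sub_eq_zero.1 (hinjD _ (mem_sub.2 ⟨a₀ + x, add_mem_add ha₀ hx, a₀ + y,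
      add_mem_add ha₀ hy, by abel⟩) (by simp [hxy]))
  have himg : (A + S).image φ = A.image φ + S.image φ := image_add φ
  obtain ⟨s, M, hs, hM, hMD, hMc⟩ := exists_cosetProgression_fintype (A := A.image φ)
    (S := S.image φ) ⟨φ a₀, mem_image_of_mem φ ha₀⟩ ⟨φ s₀, mem_image_of_mem φ hs₀⟩ hK
    (by rw [← himg, hcardAS, hcardA]; exact h1) (by rw [← himg, hcardAS, hcardS]; exact h2)
  rw [← himg, ← image_sub_distrib, coe_image] at hMD
  rw [← himg, hcardAS] at hMc
  obtain ⟨M₀, hM₀, hM₀D, hcard⟩ := M.exists_lift h0 hsym hinj hM hMD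
  refine ⟨s, M₀, hs, hM₀, hM₀D, hMc.trans ?_⟩
  gcongr

/-- Everything happens in the subgroup generated by `A ∪ S`, which is finitely generated. -/
theorem exists_cosetProgression {G : Type*} [AddCommGroup G] [DecidableEq G]
    {A S : Finset G} (hA : A.Nonempty) (hS : S.Nonempty) {K : ℝ} (hK : 3 ≤ K)
    (h1 : (#(A + S) : ℝ) ≤ K * #A) (h2 : (#(A + S) : ℝ) ≤ K * #S) :
    ∃ (s : ℕ) (M : SymmCosetProgression G s), (s : ℝ) ≤ 4 * 10 ^ 14 * Real.log K ^ 6 ∧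
      M.IsProper ∧ M.carrier ⊆ (((A + S) - (A + S) : Finset G) : Set G) ∧
      (#(A + S) : ℝ) ≤ Real.exp (4 * 10 ^ 14 * Real.log K ^ 6) * (M.carrier.ncard : ℝ) := by
  classical
  set Γ : AddSubgroup G := AddSubgroup.closure ((A ∪ S : Finset G) : Set G) with hΓ
  have : AddGroup.FG Γ := (AddGroup.fg_iff_addSubgroup_fg Γ).2 ⟨A ∪ S, rfl⟩
  have hinj : Function.Injective Γ.subtype := Γ.subtype_injective
  have hlift : ∀ B ⊆ A ∪ S, (B.preimage Γ.subtype hinj.injOn).image Γ.subtype = B := by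
    intro B hB
    rw [image_preimage, filter_true_of_mem]
    intro x hx
    exact ⟨⟨x, AddSubgroup.subset_closure (hB hx)⟩, rfl⟩
  obtain ⟨A', hA'⟩ : ∃ A' : Finset Γ, A'.image Γ.subtype = A := ⟨_, hlift A subset_union_left⟩
  obtain ⟨S', hS'⟩ : ∃ S' : Finset Γ, S'.image Γ.subtype = S := ⟨_, hlift S subset_union_right⟩
  have himg : (A' + S').image Γ.subtype = A + S := by rw [image_add Γ.subtype, hA', hS']
  have hcA : #A' = #A := by rw [← hA', card_image_of_injective _ hinj]
  have hcS : #S' = #S := by rw [← hS', card_image_of_injective _ hinj]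
  have hcAS : #(A' + S') = #(A + S) := by rw [← himg, card_image_of_injective _ hinj]
  rw [← hA', image_nonempty] at hA
  rw [← hS', image_nonempty] at hS
  obtain ⟨s, M, hs, hM, hMD, hMc⟩ := exists_cosetProgression_of_fg hA hS hK
    (by rw [hcAS, hcA]; exact h1) (by rw [hcAS, hcS]; exact h2)
  refine ⟨s, M.map Γ.subtype, hs, hM.map hinj, ?_, ?_⟩
  · rw [SymmCosetProgression.carrier_map, ← himg, ← image_sub_distrib Γ.subtype, coe_image]
    exact Set.image_mono hMD
  · rw [SymmCosetProgression.carrier_map, Set.ncard_image_of_injective _ hinj, ← hcAS]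
    exact hMc

end Main

end

theorem theorem1p1 :
    ∃ (d : ℝ → ℕ) (h : ℝ → ℝ),
      (∃ C : ℝ, ∀ K : ℝ, 3 ≤ K →
        (d K : ℝ) ≤ C * Real.log K ^ 6 ∧
        |h K| ≤ C * (Real.log K ^ 6 * Real.log (Real.log K))) ∧
      ∀ (G : Type*) [AddCommGroup G] [DecidableEq G] (A S : Finset G) (K : ℝ),
        A.Nonempty → S.Nonempty →
        ((A + S).card : ℝ) ≤ K * (min A.card S.card : ℕ) →
        ∃ (k : ℕ) (M : SymmCosetProgression G k),
          k ≤ d K ∧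
          M.IsProper ∧
          M.carrier ⊆ (((A - A) + (S - S) : Finset G) : Set G) ∧
          Real.exp (-h K) * ((A + S).card : ℝ) ≤ (M.carrier.ncard : ℝ) := by
  -- Using `max K 3` covers small `K`, where the hypothesis only weakens. The loss has no `log log
  -- K` factor; since `log log K ≥ log log 3 > 0`, the summand `(log log 3)⁻¹` in `C` fits it under
  -- the stated bound.
  refine ⟨fun K => ⌊4 * 10 ^ 14 * Real.log (max K 3) ^ 6⌋₊,
    fun K => 4 * 10 ^ 14 * Real.log (max K 3) ^ 6,
    ⟨4 * 10 ^ 14 * (1 + (Real.log (Real.log 3))⁻¹), fun K hK => ?_⟩, ?_⟩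
  · have hlog3 : 1 < Real.log 3 := by
      rw [Real.lt_log_iff_exp_lt (by norm_num)]
      linarith [Real.exp_one_lt_d9]
    have hll : 0 < Real.log (Real.log 3) := Real.log_pos hlog3
    have hK3 : Real.log 3 ≤ Real.log K := Real.log_le_log (by norm_num) hK
    have hllK : Real.log (Real.log 3) ≤ Real.log (Real.log K) :=
      Real.log_le_log (by linarith) hK3
    have hpos : 0 ≤ 4 * 10 ^ 14 * Real.log K ^ 6 := by positivity
    have hone : 1 ≤ (1 + (Real.log (Real.log 3))⁻¹) * Real.log (Real.log K) := by
      have h1 : 1 ≤ (Real.log (Real.log 3))⁻¹ * Real.log (Real.log K) := by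
        rw [inv_mul_eq_div, one_le_div hll]
        exact hllK
      linarith
    have hinv : 0 ≤ (Real.log (Real.log 3))⁻¹ := by positivity
    simp only [max_eq_left hK]
    constructor
    · refine (Nat.floor_le hpos).trans ?_
      nlinarith [mul_nonneg hpos hinv]
    · rw [abs_of_nonneg hpos]
      calc 4 * 10 ^ 14 * Real.log K ^ 6
          ≤ 4 * 10 ^ 14 * Real.log K ^ 6 *
            ((1 + (Real.log (Real.log 3))⁻¹) * Real.log (Real.log K)) :=
            le_mul_of_one_le_right hpos hone
        _ = _ := by ring
  · intro G _ _ A S K hA hS hK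
    have hK' : ((A + S).card : ℝ) ≤ max K 3 * (min A.card S.card : ℕ) :=
      hK.trans (mul_le_mul_of_nonneg_right (le_max_left K 3) (Nat.cast_nonneg _))
    have hmax : (0 : ℝ) ≤ max K 3 := le_trans (by norm_num) (le_max_right K 3)
    obtain ⟨s, M, hs, hM, hMD, hMc⟩ := exists_cosetProgression hA hS (le_max_right K 3)
      (hK'.trans (mul_le_mul_of_nonneg_left (by exact_mod_cast min_le_left _ _) hmax))
      (hK'.trans (mul_le_mul_of_nonneg_left (by exact_mod_cast min_le_right _ _) hmax))
    refine ⟨s, M, Nat.le_floor hs, hM, ?_, ?_⟩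
    · rw [← add_sub_add_comm]
      exact hMD
    · rw [Real.exp_neg, inv_mul_le_iff₀ (Real.exp_pos _)]
      exact hMc
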